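/- **Setting.** Let $\Bbbk$ be a field and $n \ge 0$. Order $\mathbb Z^n$ componentwise. A *$\mathbb Z^n$-module* $N$ is a functor from the poset $\mathbb Z^n$ to $\Bbbk$-vector spaces, equivalently a $\mathbb Z^n$-graded module $\bigoplus_{a} N_a$ over $\Bbbk[\mathbb N^n]=\Bbbk[x_1,\dots,x_n]$; morphisms have degree $0$. It is *$\mathbb Z^n$-finite* if $\dim_\Bbbk N_a<\infty$ for all $a$. It is *finitely determined* if it is $\mathbb Z^n$-finite and for each $i$ there is a bounded interval such that multiplication $x_i : N_b\to N_{b+e_i}$ is an isomorphism whenever $b_i$ lies outside of that interval. *Flat* means flat over $\Bbbk[\mathbb N^n]$; *injective* means injective in the category of $\mathbb Z^n$-modules. An injective module is *finite* if it is a finite direct sum of indecomposable modules; a flat module is *finite* if it is a finite direct sum of indecomposable modules and is $\mathbb Z^n$-finite. For a $\mathbb Z^n$-module $N$ we consider the following objects. * A *flange presentation* of $N$ is a morphism $\varphi:F\to E$ with $F$ flat, $E$ injective, and image isomorphic to $N$. It is finite if $F$ and $E$ are finite, and minimal if moreover the number of indecomposable summands of $F$ and that of $E$ are both the smallest possible among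 all finite flange presentations of $N$. * A *flat presentation* is a morphism $F_1\to F_0$ of flat modules with cokernel isomorphic to $N$; an *injective copresentation* is a morphism $E^0\to E^1$ of injective modules with kernel isomorphic to $N$. They are finite if both modules are finite. * A *flat resolution* is a complex $\cdots\to F_1\to F_0$ of flat modules whose only nonzero homology is $H_0\cong N$; an *injective resolution* is a complex $E^0\to E^1\to\cdots$ of injective modules whose only nonzero cohomology is $H^0\cong N$. They are finite if every term is finite and all but finitely many terms vanish. A finite *flat cover* of $M$ is a surjection $F\to M$ with $F$ finite flat, and it is minimal if the number of indecomposable summands of $F$ is the smallest possible among the finite flat covers of $M$; dually for finite *injective hulls* $M\hookrightarrow E$. A finite flat presentation or finite flat resolution is *minimal* if $F_0\to N$, $F_1\to\ker(F_0\to N)$ and (for a resolution) $F_{i+2}\to\ker(F_{i+1}\to F_{i})$ for $i\ge 0$ are minimal flat covers. A finite injective copresentation or finite injective resolution is *minimal* if $N\to E^0$, $\operatorname{coker}(N\to E^0)\to E^1$ and (for a resolution) $\operatorname{coker}(E^{i}\to E^{i+1})\to E^{i+2}$ for $i\ge 0$ are minimal injective hulls. **Theorem (syzygy theorem for $\mathbb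 Z^n$-modules).** For a $\mathbb Z^n$-module $N$ the following are equivalent: 0. $N$ is finitely determined; 1. $N$ admits a finite flange presentation; 2. $N$ admits a finite flat presentation; 3. $N$ admits a finite injective copresentation; 4. $N$ admits a finite flat resolution; 5. $N$ admits a finite injective resolution; 6. $N$ admits a minimal flange presentation; 7. $N$ admits a minimal flat presentation; 8. $N$ admits a minimal injective copresentation; 9. $N$ admits a minimal flat resolution; 10. $N$ admits a minimal injective resolution. Any two minimal flange presentations of $N$ are isomorphic, and likewise any two minimal flat presentations, minimal injective copresentations, minimal flat resolutions and minimal injective resolutions; the (noncanonical) isomorphism can be chosen to commute with the given identifications with $N$ of the image, cokernel, kernel, $H_0$ or $H^0$ respectively. In every minimal flat resolution $F_i=0$ for $i>n$, and in every minimal injective resolution $E^i=0$ for $i>n$. -/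

import Mathlib

open CategoryTheory CategoryTheory.Limits

universe u

/-- The poset `ℤⁿ`, with the componentwise order. (A copy of `Fin n → ℤ`, so that it becomes a
category as a poset and not as a product of categories.) -/
def ZnPoset (n : ℕ) : Type := Fin n → ℤ

instance (n : ℕ) : PartialOrder (ZnPoset n) := inferInstanceAs (PartialOrder (Fin n → ℤ))

instance (n : ℕ) : AddCommGroup (ZnPoset n) := inferInstanceAs (AddCommGroup (Fin n → ℤ))

/-- The standard basis vector `e_i` of `ℤⁿ`. -/
def ZnPoset.e {n : ℕ} (i : Fin n) : ZnPoset n := fun j => if j = i then 1 else 0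

/-- The inclusion of `ℕⁿ` in `ℤⁿ`. -/
def ZnPoset.ofNat {n : ℕ} (v : Fin n → ℕ) : ZnPoset n := fun j => (v j : ℤ)

lemma ZnPoset.le_add_e {n : ℕ} (b : ZnPoset n) (i : Fin n) : b ≤ b + ZnPoset.e i := by
  intro j
  change b j ≤ b j + (if j = i then 1 else 0)
  split <;> omega

lemma ZnPoset.le_add_ofNat {n : ℕ} (a : ZnPoset n) (v : Fin n → ℕ) :
    a ≤ a + ZnPoset.ofNat v := by
  intro j
  change a j ≤ a j + (v j : ℤ)
  omega

lemma ZnPoset.ofNat_zero (n : ℕ) : ZnPoset.ofNat (0 : Fin n → ℕ) = 0 := rfl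

lemma ZnPoset.ofNat_add {n : ℕ} (v w : Fin n → ℕ) :
    ZnPoset.ofNat (v + w) = ZnPoset.ofNat v + ZnPoset.ofNat w :=
  funext fun j => Nat.cast_add (v j) (w j)

/-- A `ℤⁿ`-module over the field `k`: a functor from the poset `ℤⁿ` (with the componentwise order)
to `k`-vector spaces; equivalently, a `ℤⁿ`-graded module over `k[ℕⁿ] = k[x₁, …, xₙ]`. -/
abbrev ZnModule (k : Type u) [Field k] (n : ℕ) : Type (u + 1) :=
  ZnPoset n ⥤ ModuleCat.{u} k

namespace ZnModule

variable {k : Type u} [Field k] {n : ℕ}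

/-- `M` is `ℤⁿ`-finite: every graded component has finite dimension. -/
def IsZnFinite (M : ZnModule k n) : Prop :=
  ∀ a : ZnPoset n, FiniteDimensional k (M.obj a)

/-- The multiplication map `x_i : M_b ⟶ M_{b + e_i}`. -/
def mulX (M : ZnModule k n) (i : Fin n) (b : ZnPoset n) :
    M.obj b ⟶ M.obj (b + ZnPoset.e i) :=
  M.map (homOfLE (ZnPoset.le_add_e b i))

/-- `M` is finitely determined: it is `ℤⁿ`-finite and, for each `i`, multiplication by `x_i` is an
isomorphism `M_b ⟶ M_{b + e_i}` whenever `b_i` lies outside of some bounded interval. -/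
def IsFinitelyDetermined (M : ZnModule k n) : Prop :=
  M.IsZnFinite ∧ ∀ i : Fin n, ∃ lo hi : ℤ, ∀ b : ZnPoset n, b i ∉ Set.Icc lo hi →
    IsIso (M.mulX i b)

/-! ### Flatness -/

/-- The total space `⨁ₐ Mₐ` of a `ℤⁿ`-module. -/
def Total (M : ZnModule k n) : Type u := DirectSum (ZnPoset n) fun a => M.obj a

noncomputable instance (M : ZnModule k n) : AddCommGroup M.Total :=
  inferInstanceAs (AddCommGroup (DirectSum (ZnPoset n) fun a => M.obj a))

noncomputable instance (M : ZnModule k n) : Module k M.Total :=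
  inferInstanceAs (Module k (DirectSum (ZnPoset n) fun a => M.obj a))

/-- The inclusion of the component `Mₐ` in the total space. -/
noncomputable def incl (M : ZnModule k n) (a : ZnPoset n) : M.obj a →ₗ[k] M.Total :=
  letI := Classical.decEq (ZnPoset n)
  DirectSum.lof k (ZnPoset n) (fun a => M.obj a) a

lemma total_hom_ext {M : ZnModule k n} {A : Type*} [AddCommGroup A] [Module k A]
    {f g : M.Total →ₗ[k] A} (h : ∀ a m, f (M.incl a m) = g (M.incl a m)) : f = g :=
  letI := Classical.decEq (ZnPoset n)
  DirectSum.linearMap_ext k fun a => LinearMap.ext fun m => h a m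

/-- Multiplication by the monomial `x^v` on the total space: on `Mₐ` it is the structure map
`Mₐ ⟶ M_{a + v}`. -/
noncomputable def monomialAct (M : ZnModule k n) (v : Fin n → ℕ) : M.Total →ₗ[k] M.Total :=
  letI := Classical.decEq (ZnPoset n)
  DirectSum.toModule k (ZnPoset n) M.Total fun a =>
    M.incl (a + ZnPoset.ofNat v) ∘ₗ (M.map (homOfLE (ZnPoset.le_add_ofNat a v))).hom

lemma monomialAct_incl (M : ZnModule k n) (v : Fin n → ℕ) (a : ZnPoset n) (m : M.obj a) :
    M.monomialAct v (M.incl a m) =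
      M.incl (a + ZnPoset.ofNat v) ((M.map (homOfLE (ZnPoset.le_add_ofNat a v))).hom m) :=
  letI := Classical.decEq (ZnPoset n)
  DirectSum.toModule_lof (R := k) (ι := ZnPoset n) (M := fun a => M.obj a) (N := M.Total)
    (φ := fun a => M.incl (a + ZnPoset.ofNat v) ∘ₗ (M.map (homOfLE (ZnPoset.le_add_ofNat a v))).hom) a m

lemma incl_map_eq (M : ZnModule k n) {a b c : ZnPoset n} (hb : a ≤ b) (hc : a ≤ c) (h : b = c)
    (m : M.obj a) :
    M.incl b ((M.map (homOfLE hb)).hom m) = M.incl c ((M.map (homOfLE hc)).hom m) := by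
  subst h; rfl

/-- The monomials act on the total space through a monoid homomorphism. -/
noncomputable def monomialHom (M : ZnModule k n) :
    Multiplicative (Fin n → ℕ) →* Module.End k M.Total where
  toFun v := M.monomialAct v.toAdd
  map_one' := by
    refine total_hom_ext fun a m => ?_
    rw [monomialAct_incl, M.incl_map_eq _ le_rfl (by rw [toAdd_one, ZnPoset.ofNat_zero, add_zero])]
    simp
  map_mul' v w := by
    refine total_hom_ext fun a m => ?_
    rw [Module.End.mul_apply, monomialAct_incl, monomialAct_incl, monomialAct_incl,
      ← ModuleCat.comp_apply, ← M.map_comp]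
    exact M.incl_map_eq _ _ (by
      rw [toAdd_mul, ZnPoset.ofNat_add, add_comm (ZnPoset.ofNat _), add_assoc]) m

/-- The total space is a module over the polynomial ring `k[ℕⁿ]`. -/
noncomputable instance (M : ZnModule k n) : Module (AddMonoidAlgebra k (Fin n → ℕ)) M.Total :=
  Module.compHom M.Total
    (AddMonoidAlgebra.lift k (Module.End k M.Total) (Fin n → ℕ) M.monomialHom).toRingHom

/-- The defining property of the action: `(r x^v) • m = r • (image of m in M_{a + v})`. -/
lemma single_smul_incl (M : ZnModule k n) (v : Fin n → ℕ) (r : k) (a : ZnPoset n) (m : M.obj a) :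
    (AddMonoidAlgebra.single v r : AddMonoidAlgebra k (Fin n → ℕ)) • M.incl a m =
      M.incl (a + ZnPoset.ofNat v) (r • (M.map (homOfLE (ZnPoset.le_add_ofNat a v))).hom m) := by
  change (AddMonoidAlgebra.lift k (Module.End k M.Total) (Fin n → ℕ) M.monomialHom
    (AddMonoidAlgebra.single v r)) (M.incl a m) = _
  rw [AddMonoidAlgebra.lift_single, map_smul, ← monomialAct_incl]
  rfl

/-- A `ℤⁿ`-module is flat if it is flat as a module over `k[ℕⁿ]`. -/
def IsFlat (M : ZnModule k n) : Prop :=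
  Module.Flat (AddMonoidAlgebra k (Fin n → ℕ)) M.Total

/-! ### Finite sums of indecomposables -/

attribute [local instance] Abelian.hasFiniteBiproducts

/-- `M` is a direct sum of `r` indecomposable `ℤⁿ`-modules. -/
def HasIndecSummands (M : ZnModule k n) (r : ℕ) : Prop :=
  ∃ X : Fin r → ZnModule k n, (∀ i, Indecomposable (X i)) ∧ Nonempty (M ≅ biproduct X)

/-- `E` is a finite injective module, with `r` indecomposable summands. -/
def IsFiniteInjective (E : ZnModule k n) (r : ℕ) : Prop :=
  Injective E ∧ E.HasIndecSummands r

/-- `F` is a finite flat module, with `r` indecomposable summands. Finite flat modules are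
`ℤⁿ`-finite, so that their indecomposable summands are the modules `k[b + ℤτ + ℕⁿ]`.
(Finite injective modules are `ℤⁿ`-finite automatically.) -/
def IsFiniteFlat (F : ZnModule k n) (r : ℕ) : Prop :=
  F.IsFlat ∧ F.IsZnFinite ∧ F.HasIndecSummands r

/-- A finite minimal injective hull `N ↪ E`: the number of indecomposable summands of `E` is the
smallest possible among the finite injective hulls of `N`. -/
def IsMinimalInjectiveHull {N E : ZnModule k n} (f : N ⟶ E) : Prop :=
  Mono f ∧ ∃ r, E.IsFiniteInjective r ∧
    ∀ (E' : ZnModule k n) (f' : N ⟶ E') (r' : ℕ), Mono f' → E'.IsFiniteInjective r' → r ≤ r'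

/-- A finite minimal flat cover `F ↠ N`: the number of indecomposable summands of `F` is the
smallest possible among the finite flat covers of `N`. -/
def IsMinimalFlatCover {F N : ZnModule k n} (f : F ⟶ N) : Prop :=
  Epi f ∧ ∃ r, F.IsFiniteFlat r ∧
    ∀ (F' : ZnModule k n) (f' : F' ⟶ N) (r' : ℕ), Epi f' → F'.IsFiniteFlat r' → r ≤ r'

/-! ### Flange presentations -/

/-- A flange presentation of `N`: a morphism `φ : F ⟶ E` from a flat to an injective module,
together with an isomorphism of its image with `N`. -/
structure FlangePresentation (N : ZnModule k n) where
  F : ZnModule k n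
  E : ZnModule k n
  φ : F ⟶ E
  flat : F.IsFlat
  injective : Injective E
  iso : image φ ≅ N

namespace FlangePresentation

variable {N : ZnModule k n}

/-- The surjection `F ⟶ N` of a flange presentation. -/
noncomputable def toN (P : FlangePresentation N) : P.F ⟶ N := factorThruImage P.φ ≫ P.iso.hom

/-- The injection `N ⟶ E` of a flange presentation. -/
noncomputable def fromN (P : FlangePresentation N) : N ⟶ P.E := P.iso.inv ≫ image.ι P.φ

/-- `F` and `E` are finite direct sums of indecomposables. -/
def IsFinite (P : FlangePresentation N) : Prop :=
  (∃ r, P.F.IsFiniteFlat r) ∧ ∃ s, P.E.IsFiniteInjective s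

/-- The numbers of indecomposable summands of `F` and of `E` are simultaneously minimized, among
the finite flange presentations of `N`. -/
def IsMinimal (P : FlangePresentation N) : Prop :=
  ∃ r s, P.F.IsFiniteFlat r ∧ P.E.IsFiniteInjective s ∧
    ∀ (P' : FlangePresentation N) (r' s' : ℕ),
      P'.F.IsFiniteFlat r' → P'.E.IsFiniteInjective s' → r ≤ r' ∧ s ≤ s'

/-- Isomorphism of flange presentations of `N` (over the identity of `N`). -/
def Isomorphic (P P' : FlangePresentation N) : Prop :=
  ∃ (f : P.F ≅ P'.F) (e : P.E ≅ P'.E), P.φ ≫ e.hom = f.hom ≫ P'.φ ∧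
    f.hom ≫ P'.toN = P.toN ∧ P.fromN ≫ e.hom = P'.fromN

end FlangePresentation

/-! ### Flat presentations and injective copresentations -/

/-- A flat presentation of `N`: a morphism `F₁ ⟶ F₀` of flat modules with cokernel `N`. -/
structure FlatPresentation (N : ZnModule k n) where
  F₁ : ZnModule k n
  F₀ : ZnModule k n
  d : F₁ ⟶ F₀
  flat₁ : F₁.IsFlat
  flat₀ : F₀.IsFlat
  iso : cokernel d ≅ N

namespace FlatPresentation

variable {N : ZnModule k n}

/-- The surjection `F₀ ⟶ N`. -/
noncomputable def π (P : FlatPresentation N) : P.F₀ ⟶ N := cokernel.π P.d ≫ P.iso.hom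

lemma d_π (P : FlatPresentation N) : P.d ≫ P.π = 0 := by simp [π]

/-- `F₁` and `F₀` are finite direct sums of indecomposables. -/
def IsFinite (P : FlatPresentation N) : Prop :=
  (∃ r, P.F₁.IsFiniteFlat r) ∧ ∃ s, P.F₀.IsFiniteFlat s

/-- `F₀ ⟶ N` and `F₁ ⟶ ker (F₀ ⟶ N)` are finite minimal flat covers. -/
def IsMinimal (P : FlatPresentation N) : Prop :=
  IsMinimalFlatCover P.π ∧ IsMinimalFlatCover (kernel.lift P.π P.d P.d_π)

/-- Isomorphism of flat presentations of `N` (over the identity of `N`). -/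
def Isomorphic (P P' : FlatPresentation N) : Prop :=
  ∃ (f₁ : P.F₁ ≅ P'.F₁) (f₀ : P.F₀ ≅ P'.F₀),
    P.d ≫ f₀.hom = f₁.hom ≫ P'.d ∧ f₀.hom ≫ P'.π = P.π

end FlatPresentation

/-- An injective copresentation of `N`: a morphism `E⁰ ⟶ E¹` of injective modules with
kernel `N`. -/
structure InjectiveCopresentation (N : ZnModule k n) where
  E₀ : ZnModule k n
  E₁ : ZnModule k n
  d : E₀ ⟶ E₁
  injective₀ : Injective E₀
  injective₁ : Injective E₁
  iso : N ≅ kernel d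

namespace InjectiveCopresentation

variable {N : ZnModule k n}

/-- The injection `N ⟶ E⁰`. -/
noncomputable def ι (P : InjectiveCopresentation N) : N ⟶ P.E₀ := P.iso.hom ≫ kernel.ι P.d

lemma ι_d (P : InjectiveCopresentation N) : P.ι ≫ P.d = 0 := by simp [ι]

/-- `E⁰` and `E¹` are finite direct sums of indecomposables. -/
def IsFinite (P : InjectiveCopresentation N) : Prop :=
  (∃ r, P.E₀.IsFiniteInjective r) ∧ ∃ s, P.E₁.IsFiniteInjective s

/-- `N ⟶ E⁰` and `coker (N ⟶ E⁰) ⟶ E¹` are finite minimal injective hulls. -/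
def IsMinimal (P : InjectiveCopresentation N) : Prop :=
  IsMinimalInjectiveHull P.ι ∧ IsMinimalInjectiveHull (cokernel.desc P.ι P.d P.ι_d)

/-- Isomorphism of injective copresentations of `N` (over the identity of `N`). -/
def Isomorphic (P P' : InjectiveCopresentation N) : Prop :=
  ∃ (e₀ : P.E₀ ≅ P'.E₀) (e₁ : P.E₁ ≅ P'.E₁),
    P.d ≫ e₁.hom = e₀.hom ≫ P'.d ∧ P.ι ≫ e₀.hom = P'.ι

end InjectiveCopresentation

/-! ### Flat and injective resolutions -/

/-- A flat resolution of `N`: a complex `⋯ ⟶ F₁ ⟶ F₀` of flat modules whose only nonzero homology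
is `H₀ ≅ N`. The isomorphism is recorded through the augmentation `π`. -/
structure FlatResolution (N : ZnModule k n) where
  complex : ChainComplex (ZnModule k n) ℕ
  flat : ∀ i, (complex.X i).IsFlat
  π : complex ⟶ (ChainComplex.single₀ (ZnModule k n)).obj N
  quasiIso : QuasiIso π

namespace FlatResolution

variable {N : ZnModule k n}

/-- The augmentation `F₀ ⟶ N`. -/
noncomputable def aug (R : FlatResolution N) : R.complex.X 0 ⟶ N := R.π.f 0

lemma d_aug (R : FlatResolution N) : R.complex.d 1 0 ≫ R.aug = 0 :=
  by
  have h := R.π.comm 1 0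
  have h0 : ((ChainComplex.single₀ (ZnModule k n)).obj N).d 1 0 = 0 :=
    HomologicalComplex.single_obj_d _ _ _ _ _
  rw [h0, comp_zero] at h
  exact h.symm

/-- `⨁ᵢ Fᵢ` has finitely many indecomposable summands. -/
def IsFinite (R : FlatResolution N) : Prop :=
  (∀ i, ∃ r, (R.complex.X i).IsFiniteFlat r) ∧ ∃ l : ℕ, ∀ i, l < i → IsZero (R.complex.X i)

/-- The resolution is finite, and `F₀ ⟶ N`, `F₁ ⟶ ker (F₀ ⟶ N)` and
`F_{i+2} ⟶ ker (F_{i+1} ⟶ F_i)` are minimal flat covers. -/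
def IsMinimal (R : FlatResolution N) : Prop :=
  R.IsFinite ∧ IsMinimalFlatCover R.aug ∧
    IsMinimalFlatCover (kernel.lift R.aug (R.complex.d 1 0) R.d_aug) ∧
    ∀ i, IsMinimalFlatCover (kernel.lift (R.complex.d (i + 1) i) (R.complex.d (i + 2) (i + 1))
      (R.complex.d_comp_d _ _ _))

/-- Isomorphism of flat resolutions of `N` (over the identity of `N`). -/
def Isomorphic (R R' : FlatResolution N) : Prop :=
  ∃ e : R.complex ≅ R'.complex, e.hom ≫ R'.π = R.π

end FlatResolution

namespace InjRes

variable {N : ZnModule k n}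

/-- The coaugmentation `N ⟶ E⁰`. -/
noncomputable def coaug (R : InjectiveResolution N) : N ⟶ R.cocomplex.X 0 := R.ι.f 0

lemma coaug_d (R : InjectiveResolution N) : coaug R ≫ R.cocomplex.d 0 1 = 0 :=
  R.ι_f_zero_comp_complex_d

/-- `⨁ᵢ Eⁱ` has finitely many indecomposable summands. -/
def IsFinite (R : InjectiveResolution N) : Prop :=
  (∀ i, ∃ r, (R.cocomplex.X i).IsFiniteInjective r) ∧
    ∃ l : ℕ, ∀ i, l < i → IsZero (R.cocomplex.X i)

/-- The resolution is finite, and `N ⟶ E⁰`, `coker (N ⟶ E⁰) ⟶ E¹` and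
`coker (Eⁱ ⟶ Eⁱ⁺¹) ⟶ Eⁱ⁺²` are minimal injective hulls. -/
def IsMinimal (R : InjectiveResolution N) : Prop :=
  IsFinite R ∧ IsMinimalInjectiveHull (coaug R) ∧
    IsMinimalInjectiveHull (cokernel.desc (coaug R) (R.cocomplex.d 0 1) (coaug_d R)) ∧
    ∀ i, IsMinimalInjectiveHull (cokernel.desc (R.cocomplex.d i (i + 1))
      (R.cocomplex.d (i + 1) (i + 2)) (R.cocomplex.d_comp_d _ _ _))

/-- Isomorphism of injective resolutions of `N` (over the identity of `N`). -/
def Isomorphic (R R' : InjectiveResolution N) : Prop :=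
  ∃ e : R.cocomplex ≅ R'.cocomplex, R.ι ≫ e.hom = R'.ι

end InjRes

end ZnModule

/-! Everything is proved for injective modules and carried to flat modules by Matlis duality, the
degreewise dual with degrees negated. On `ℤⁿ`-finite modules this is an exact contravariant
self-equivalence that exchanges finite flat and finite injective modules and keeps the number of
summands.

Injective modules. Every nonzero element has a monomial multiple whose annihilator is prime
(`exists_isPrimeElement`), and in an injective module such a multiple lies in a direct summand `k[a
+ ℤτ - ℕⁿ]` (`IsPrimeElement.exists_cofree_summand`). Each of these summands has dimension one in
all sufficiently negative degrees, so the dimension of a finitely determined injective module near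
`-∞` counts its indecomposable summands (`isFiniteInjective_iff`). This numerical invariant does the
work of a Krull–Schmidt theorem. It shows that a hull with the fewest summands is essential: if some
map is injective on `N` but not on the hull, a summand can be removed
(`IsMinimalInjectiveHull.mono_of_mono_comp`). Essential hulls are unique up to isomorphism over `N`.

Existence. A finitely determined module is controlled by a finite box of degrees. Each degree `c` of
the box gives a map to an injective indicator module with values in `N_c`, and the sum of these maps
is injective (`IsFinitelyDetermined.exists_mono`). Kernels and cokernels stay finitely determined,
so hulls can be iterated. Conversely, each finite object exhibits `N` as an image, kernel or
cokernel of a map between finitely determined modules.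

Length. Coinduction along one coordinate gives a short exact sequence starting with `N` whose other
two terms gain the extension property in that direction (`coind_shortExact`). Treating all `n`
directions bounds the injective dimension by `n`. A minimal resolution cannot be longer, because a
minimal hull of an injective module is an isomorphism.

Flat modules. The dual of a flat module is injective because maps `M ⟶ F*` correspond to functionals
on `M ⊗ F`. The dual of `k[a + ℤτ - ℕⁿ]` is flat because it is a directed union of free modules of
rank one. Flat modules need not be projective, but finite flat ones lift against surjections from
`ℤⁿ`-finite modules (`IsFiniteFlat.exists_lift`), which is all that the comparison maps require. -/

namespace ZnModule

attribute [local instance] Abelian.hasFiniteBiproducts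

variable {k : Type u} [Field k] {n : ℕ}

/-! ### Structure maps and morphisms, elementwise -/

/-- The structure map `M_a → M_b` of a `ℤⁿ`-module, for `a ≤ b`. -/
def tr (M : ZnModule k n) {a b : ZnPoset n} (h : a ≤ b) : M.obj a →ₗ[k] M.obj b :=
  (M.map (homOfLE h)).hom

@[simp] lemma tr_self (M : ZnModule k n) {a : ZnPoset n} (h : a ≤ a) (x : M.obj a) :
    M.tr h x = x := by
  change (M.map (𝟙 a)).hom x = x
  rw [M.map_id]; rfl

@[simp] lemma tr_tr (M : ZnModule k n) {a b c : ZnPoset n} (h : a ≤ b) (h' : b ≤ c) (x : M.obj a) :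
    M.tr h' (M.tr h x) = M.tr (h.trans h') x := by
  change (M.map (homOfLE h')).hom ((M.map (homOfLE h)).hom x) = (M.map (homOfLE h ≫ homOfLE h')).hom x
  rw [M.map_comp]; rfl

/-- The component of a morphism of `ℤⁿ`-modules, as a linear map. -/
def appL {M N : ZnModule k n} (f : M ⟶ N) (b : ZnPoset n) : M.obj b →ₗ[k] N.obj b :=
  (f.app b).hom

lemma appL_tr {M N : ZnModule k n} (f : M ⟶ N) {a b : ZnPoset n} (h : a ≤ b) (x : M.obj a) :
    appL f b (M.tr h x) = N.tr h (appL f a x) :=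
  congrArg (fun g => g.hom x) (f.naturality (homOfLE h))

@[simp] lemma appL_id (M : ZnModule k n) (b : ZnPoset n) (x : M.obj b) : appL (𝟙 M) b x = x := rfl

@[simp] lemma appL_comp {L M N : ZnModule k n} (f : L ⟶ M) (g : M ⟶ N) (b : ZnPoset n)
    (x : L.obj b) : appL (f ≫ g) b x = appL g b (appL f b x) := rfl

@[simp] lemma appL_zero {M N : ZnModule k n} (b : ZnPoset n) (x : M.obj b) :
    appL (0 : M ⟶ N) b x = 0 := rfl

@[simp] lemma appL_add {M N : ZnModule k n} (f g : M ⟶ N) (b : ZnPoset n) (x : M.obj b) :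
    appL (f + g) b x = appL f b x + appL g b x := rfl

lemma hom_ext_appL {M N : ZnModule k n} {f g : M ⟶ N} (h : ∀ b x, appL f b x = appL g b x) :
    f = g :=
  NatTrans.ext (funext fun b => ModuleCat.hom_ext (LinearMap.ext (h b)))

lemma appL_sum {M N : ZnModule k n} {ι : Type*} (s : Finset ι) (f : ι → (M ⟶ N)) (b : ZnPoset n)
    (x : M.obj b) : appL (∑ i ∈ s, f i) b x = ∑ i ∈ s, appL (f i) b x := by
  classical
  induction s using Finset.induction_on with
  | empty => simp
  | insert i s hi ih => rw [Finset.sum_insert hi, Finset.sum_insert hi, appL_add, ih]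

/-- A `ℤⁿ`-module from vector spaces and structure maps. -/
def ofMaps (X : ZnPoset n → Type u) [∀ b, AddCommGroup (X b)] [∀ b, Module k (X b)]
    (t : ∀ {a b}, a ≤ b → X a →ₗ[k] X b) (t_self : ∀ a x, t (le_refl a) x = x)
    (t_t : ∀ {a b c} (h : a ≤ b) (h' : b ≤ c) x, t h' (t h x) = t (h.trans h') x) :
    ZnModule k n where
  obj b := ModuleCat.of k (X b)
  map f := ModuleCat.ofHom (t (leOfHom f))
  map_id a := ModuleCat.hom_ext (LinearMap.ext (t_self a))
  map_comp f g := ModuleCat.hom_ext (LinearMap.ext fun x => (t_t (leOfHom f) (leOfHom g) x).symm)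

/-- A morphism of `ℤⁿ`-modules from a compatible family of linear maps. -/
def homOfMaps {M N : ZnModule k n} (φ : ∀ b, M.obj b →ₗ[k] N.obj b)
    (hφ : ∀ {a b} (h : a ≤ b) x, φ b (M.tr h x) = N.tr h (φ a x)) : M ⟶ N where
  app b := ModuleCat.ofHom (φ b)
  naturality _ _ f := ModuleCat.hom_ext (LinearMap.ext fun x => hφ (leOfHom f) x)

lemma mono_iff {M N : ZnModule k n} (f : M ⟶ N) : Mono f ↔ ∀ b, Function.Injective (appL f b) := by
  rw [NatTrans.mono_iff_mono_app]
  exact forall_congr' fun b => ModuleCat.mono_iff_injective _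

lemma epi_iff {M N : ZnModule k n} (f : M ⟶ N) : Epi f ↔ ∀ b, Function.Surjective (appL f b) := by
  rw [NatTrans.epi_iff_epi_app]
  exact forall_congr' fun b => ModuleCat.epi_iff_surjective _

lemma isIso_iff {M N : ZnModule k n} (f : M ⟶ N) : IsIso f ↔ ∀ b, Function.Bijective (appL f b) := by
  constructor
  · intro h b
    exact ⟨(mono_iff f).1 inferInstance b, (epi_iff f).1 inferInstance b⟩
  · intro h
    have := (mono_iff f).2 fun b => (h b).1
    have := (epi_iff f).2 fun b => (h b).2
    exact isIso_of_mono_of_epi f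

lemma isZero_iff (M : ZnModule k n) : IsZero M ↔ ∀ b (x : M.obj b), x = 0 := by
  rw [IsZero.iff_id_eq_zero]
  exact ⟨fun h b x => by simpa using congrArg (fun f => appL f b x) h,
    fun h => hom_ext_appL fun b x => by rw [appL_id, h b x]; exact (map_zero _).symm⟩

/-- The linear isomorphism of components given by an isomorphism. -/
noncomputable def isoL {M N : ZnModule k n} (e : M ≅ N) (b : ZnPoset n) : M.obj b ≃ₗ[k] N.obj b :=
  LinearEquiv.ofBijective (appL e.hom b) ((isIso_iff e.hom).1 inferInstance b)

lemma exact_of_shortComplex {S : ShortComplex (ZnModule k n)} (hS : S.Exact) (b : ZnPoset n)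
    (x : S.X₂.obj b) (hx : appL S.g b x = 0) : ∃ y, appL S.f b y = x :=
  (ShortComplex.moduleCat_exact_iff _).1 (hS.map ((evaluation _ _).obj b)) x hx

lemma exists_kernel_ι_eq {M N : ZnModule k n} (f : M ⟶ N) (b : ZnPoset n) (x : M.obj b)
    (hx : appL f b x = 0) : ∃ y, appL (kernel.ι f) b y = x :=
  exact_of_shortComplex (ShortComplex.exact_kernel f) b x hx

lemma exists_of_cokernel_π_eq_zero {M N : ZnModule k n} (f : M ⟶ N) (b : ZnPoset n) (x : N.obj b)
    (hx : appL (cokernel.π f) b x = 0) : ∃ y, appL f b y = x :=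
  exact_of_shortComplex (ShortComplex.exact_cokernel f) b x hx

lemma shortComplex_exact_iff (S : ShortComplex (ZnModule k n)) :
    S.Exact ↔ ∀ b (x : S.X₂.obj b), appL S.g b x = 0 → ∃ y, appL S.f b y = x := by
  refine ⟨exact_of_shortComplex, fun h => ?_⟩
  rw [ShortComplex.exact_iff_epi_kernel_lift, epi_iff]
  intro b y
  obtain ⟨x, hx⟩ := h b (appL (kernel.ι S.g) b y) (by
    rw [← appL_comp, kernel.condition, appL_zero])
  refine ⟨x, (mono_iff (kernel.ι S.g)).1 inferInstance b ?_⟩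
  rw [← appL_comp, kernel.lift_ι, hx]

lemma comp_apply_eq_zero {L M N : ZnModule k n} {f : L ⟶ M} {g : M ⟶ N} (w : f ≫ g = 0)
    (b : ZnPoset n) (x : L.obj b) : appL g b (appL f b x) = 0 := by
  rw [← appL_comp, w, appL_zero]

/-! ### Finitely determined modules -/

/-- Multiplication by `x_i` is bijective on `M_b` unless `lo_i ≤ b_i ≤ hi_i`. -/
def IsDeterminedBy (M : ZnModule k n) (lo hi : ZnPoset n) : Prop :=
  ∀ (i : Fin n) (b : ZnPoset n), (b i < lo i ∨ hi i < b i) →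
    Function.Bijective (M.tr (ZnPoset.le_add_e b i))

lemma IsDeterminedBy.mono {M : ZnModule k n} {lo hi lo' hi' : ZnPoset n}
    (h : M.IsDeterminedBy lo hi) (h₁ : ∀ i, lo' i ≤ lo i) (h₂ : ∀ i, hi i ≤ hi' i) :
    M.IsDeterminedBy lo' hi' := fun i b hb =>
  h i b (hb.imp (fun h => h.trans_le (h₁ i)) (fun h => (h₂ i).trans_lt h))

lemma isIso_mulX_iff (M : ZnModule k n) (i : Fin n) (b : ZnPoset n) :
    IsIso (M.mulX i b) ↔ Function.Bijective (M.tr (ZnPoset.le_add_e b i)) :=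
  ConcreteCategory.isIso_iff_bijective (M.mulX i b)

lemma isFinitelyDetermined_iff (M : ZnModule k n) :
    M.IsFinitelyDetermined ↔ M.IsZnFinite ∧ ∃ lo hi, M.IsDeterminedBy lo hi := by
  refine and_congr_right fun _ => ⟨fun h => ?_, fun ⟨lo, hi, h⟩ i => ⟨lo i, hi i, fun b hb => ?_⟩⟩
  · choose lo hi h using h
    refine ⟨lo, hi, fun i b hb => (M.isIso_mulX_iff i b).1 (h i b ?_)⟩
    rw [Set.mem_Icc]
    omega
  · rw [Set.mem_Icc] at hb
    exact (M.isIso_mulX_iff i b).2 (h i b (by omega))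

/-- Walk from `a` to `b` by unit steps. A coordinate that moves either stays strictly below `lo i`
until its last step or starts above `hi i`, so every step is one of the bijections provided by the
hypothesis. -/
lemma IsDeterminedBy.tr_bijective {M : ZnModule k n} {lo hi : ZnPoset n}
    (hM : M.IsDeterminedBy lo hi) {a b : ZnPoset n} (h : a ≤ b)
    (hab : ∀ i, a i = b i ∨ b i ≤ lo i ∨ hi i < a i) : Function.Bijective (M.tr h) := by
  induction hd : ∑ i, (b i - a i).toNat generalizing a with
  | zero =>
    have : a = b := by
      funext i
      have h1 := (Finset.sum_eq_zero_iff.1 hd) i (Finset.mem_univ i)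
      have h2 : a i ≤ b i := h i
      omega
    subst this
    exact ⟨fun x y hxy => by simpa using hxy, fun x => ⟨x, by simp⟩⟩
  | succ d ih =>
    obtain ⟨i, hi'⟩ : ∃ i, a i < b i := by
      by_contra! hc
      have : ∑ i, (b i - a i).toNat = 0 := Finset.sum_eq_zero fun i _ => by
        have := hc i
        omega
      omega
    have hval : ∀ j, (a + ZnPoset.e i) j = a j + if j = i then 1 else 0 := fun j => rfl
    have hle : a + ZnPoset.e i ≤ b := fun j => by
      have h2 : a j ≤ b j := h j
      change (a + ZnPoset.e i) j ≤ b j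
      rw [hval]
      split_ifs with hj
      · subst hj; omega
      · omega
    have h1 := hM i a (by have := hab i; omega)
    have h2 := ih hle (fun j => by
      have := hab j
      have h3 : a j ≤ b j := h j
      rw [hval]
      split_ifs with hj
      · subst hj; omega
      · omega) (by
      rw [← Finset.add_sum_erase _ _ (Finset.mem_univ i)] at hd ⊢
      have : ∑ j ∈ Finset.univ.erase i, (b j - (a + ZnPoset.e i) j).toNat =
          ∑ j ∈ Finset.univ.erase i, (b j - a j).toNat :=
        Finset.sum_congr rfl fun j hj => by
          rw [hval, if_neg (Finset.ne_of_mem_erase hj), add_zero]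
      rw [this, hval, if_pos rfl]
      omega)
    convert h2.comp h1 using 1
    funext x
    simp

lemma IsFinitelyDetermined.exists_isDeterminedBy₂ {M N : ZnModule k n}
    (hM : M.IsFinitelyDetermined) (hN : N.IsFinitelyDetermined) :
    ∃ lo hi, M.IsDeterminedBy lo hi ∧ N.IsDeterminedBy lo hi := by
  obtain ⟨-, lo, hi, h⟩ := (isFinitelyDetermined_iff M).1 hM
  obtain ⟨-, lo', hi', h'⟩ := (isFinitelyDetermined_iff N).1 hN
  exact ⟨fun i => min (lo i) (lo' i), fun i => max (hi i) (hi' i),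
    h.mono (fun i => min_le_left _ _) (fun i => le_max_left _ _),
    h'.mono (fun i => min_le_right _ _) (fun i => le_max_right _ _)⟩

lemma IsZnFinite.of_epi {M N : ZnModule k n} (f : M ⟶ N) [Epi f] (h : M.IsZnFinite) :
    N.IsZnFinite := fun a =>
  have := h a
  Module.Finite.of_surjective (appL f a) ((epi_iff f).1 inferInstance a)

lemma IsZnFinite.of_mono {M N : ZnModule k n} (f : M ⟶ N) [Mono f] (h : N.IsZnFinite) :
    M.IsZnFinite := fun a =>
  have := h a
  Module.Finite.of_injective (appL f a) ((mono_iff f).1 inferInstance a)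

/-- A submodule of a finitely determined module that is also a quotient of one is
finitely determined. -/
lemma IsFinitelyDetermined.of_epi_of_mono {F N E : ZnModule k n} (hF : F.IsFinitelyDetermined)
    (hE : E.IsFinitelyDetermined) (p : F ⟶ N) (j : N ⟶ E) [Epi p] [Mono j] :
    N.IsFinitelyDetermined := by
  obtain ⟨lo, hi, h, h'⟩ := hF.exists_isDeterminedBy₂ hE
  refine (isFinitelyDetermined_iff N).2 ⟨.of_epi p hF.1, lo, hi, fun i b hb => ⟨?_, ?_⟩⟩
  · refine Function.Injective.of_comp (f := appL j (b + ZnPoset.e i)) ?_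
    have h1 := (h' i b hb).1.comp ((mono_iff j).1 inferInstance b)
    convert h1 using 1
    funext x
    exact appL_tr j _ x
  · refine Function.Surjective.of_comp (g := appL p b) ?_
    have h1 := ((epi_iff p).1 inferInstance (b + ZnPoset.e i)).comp (h i b hb).2
    convert h1 using 1
    funext x
    exact (appL_tr p _ x).symm

lemma IsFinitelyDetermined.of_iso {M N : ZnModule k n} (e : M ≅ N) (h : M.IsFinitelyDetermined) :
    N.IsFinitelyDetermined :=
  h.of_epi_of_mono h e.hom e.inv

/-- A four-lemma chase in each degree where multiplication is bijective on both `M` and `N`. -/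
lemma IsFinitelyDetermined.kernel_of_exact {K M N : ZnModule k n} (hM : M.IsFinitelyDetermined)
    (hN : N.IsFinitelyDetermined) (i : K ⟶ M) (f : M ⟶ N) [Mono i] (w : i ≫ f = 0)
    (hex : (ShortComplex.mk i f w).Exact) : K.IsFinitelyDetermined := by
  obtain ⟨lo, hi, h, h'⟩ := hM.exists_isDeterminedBy₂ hN
  have hi' := (mono_iff i).1 inferInstance
  refine (isFinitelyDetermined_iff K).2 ⟨.of_mono i hM.1, lo, hi, fun j b hb => ⟨?_, fun y => ?_⟩⟩
  · refine Function.Injective.of_comp (f := appL i (b + ZnPoset.e j)) ?_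
    convert (h j b hb).1.comp (hi' b) using 1
    funext x
    exact appL_tr i _ x
  · obtain ⟨m, hm⟩ := (h j b hb).2 (appL i _ y)
    obtain ⟨x, hx⟩ := exact_of_shortComplex hex b m ((h' j b hb).1 (by
      rw [map_zero, ← appL_tr]
      change appL f _ _ = _
      rw [hm]
      exact comp_apply_eq_zero w _ y))
    exact ⟨x, hi' _ (by rw [appL_tr, ← hm]; exact congrArg _ hx)⟩

lemma IsFinitelyDetermined.cokernel_of_exact {M N C : ZnModule k n} (hM : M.IsFinitelyDetermined)
    (hN : N.IsFinitelyDetermined) (f : M ⟶ N) (p : N ⟶ C) [Epi p] (w : f ≫ p = 0)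
    (hex : (ShortComplex.mk f p w).Exact) : C.IsFinitelyDetermined := by
  obtain ⟨lo, hi, h, h'⟩ := hM.exists_isDeterminedBy₂ hN
  have hp := (epi_iff p).1 inferInstance
  refine (isFinitelyDetermined_iff C).2 ⟨.of_epi p hN.1, lo, hi, fun j b hb => ⟨?_, ?_⟩⟩
  · rw [injective_iff_map_eq_zero]
    intro x hx
    obtain ⟨y, rfl⟩ := hp b x
    rw [← appL_tr] at hx
    obtain ⟨z, hz⟩ := exact_of_shortComplex hex _ _ hx
    obtain ⟨z', rfl⟩ := (h j b hb).2 z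
    have : appL f b z' = y := (h' j b hb).1 (by rw [← appL_tr]; exact hz)
    rw [← this]
    exact comp_apply_eq_zero w _ z'
  · refine Function.Surjective.of_comp (g := appL p b) ?_
    convert (hp (b + ZnPoset.e j)).comp (h' j b hb).2 using 1
    funext x
    exact (appL_tr p _ x).symm

lemma IsFinitelyDetermined.kernel {M N : ZnModule k n} (f : M ⟶ N) (hM : M.IsFinitelyDetermined)
    (hN : N.IsFinitelyDetermined) : (Limits.kernel f).IsFinitelyDetermined :=
  hM.kernel_of_exact hN (kernel.ι f) f (kernel.condition f) (ShortComplex.exact_kernel f)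

lemma IsFinitelyDetermined.cokernel {M N : ZnModule k n} (f : M ⟶ N) (hM : M.IsFinitelyDetermined)
    (hN : N.IsFinitelyDetermined) : (Limits.cokernel f).IsFinitelyDetermined :=
  hM.cokernel_of_exact hN f (cokernel.π f) (cokernel.condition f) (ShortComplex.exact_cokernel f)

/-! ### Indicator modules -/

open Classical in
/-- The component in degree `c` of the indicator module: `V` if `c ∈ D ∩ U`, and `0` otherwise. -/
def indSub (D : LowerSet (ZnPoset n)) (U : UpperSet (ZnPoset n)) (V : Type u) [AddCommGroup V]
    [Module k V] (c : ZnPoset n) : Submodule k V where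
  -- A submodule of the fixed space `V`, rather than a case distinction between types, lets elements
  -- of different degrees be compared inside `V`.
  carrier := {v | ¬ (c ∈ D ∧ c ∈ U) → v = 0}
  add_mem' hv hw h := by rw [hv h, hw h, add_zero]
  zero_mem' _ := rfl
  smul_mem' r v hv h := by rw [hv h, smul_zero]

open Classical in
/-- The structure maps of the indicator module. -/
noncomputable def indMap (D : LowerSet (ZnPoset n)) (U : UpperSet (ZnPoset n)) (V : Type u)
    [AddCommGroup V] [Module k V] {a b : ZnPoset n} (h : a ≤ b) :
    indSub (k := k) D U V a →ₗ[k] indSub (k := k) D U V b :=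
  -- Only `b ∈ D` has to be tested: `a ∈ U` forces `b ∈ U`, and if `a ∉ U` the source is already
  -- zero.
  LinearMap.codRestrict _ (if b ∈ D then (indSub (k := k) D U V a).subtype else 0) fun v hv => by
    have hU : a ∈ U → b ∈ U := fun ha => U.upper' h ha
    split_ifs with hb
    · exact v.2 fun ha => hv ⟨hb, hU ha.2⟩
    · rfl

open Classical in
lemma indMap_val_of_mem (D : LowerSet (ZnPoset n)) (U : UpperSet (ZnPoset n)) (V : Type u)
    [AddCommGroup V] [Module k V] {a b : ZnPoset n} (h : a ≤ b) (hb : b ∈ D)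
    (x : indSub (k := k) D U V a) : (indMap D U V h x : V) = x := by
  change (if b ∈ D then (indSub (k := k) D U V a).subtype else 0) x = _
  rw [if_pos hb]; rfl

/-- The indicator module of `D ∩ U` with values in `V`, for a lower set `D` and an upper set `U`. -/
noncomputable def ind (D : LowerSet (ZnPoset n)) (U : UpperSet (ZnPoset n)) (V : Type u)
    [AddCommGroup V] [Module k V] : ZnModule k n :=
  ofMaps (fun c => indSub (k := k) D U V c) (fun h => indMap D U V h)
    (fun a x => Subtype.ext (by
      by_cases ha : a ∈ D
      · exact indMap_val_of_mem D U V _ ha x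
      · rw [x.2 fun h => ha h.1]
        exact (indMap D U V _ x).2 fun h => ha h.1))
    (fun {a b c} h h' x => Subtype.ext (by
      by_cases hc : c ∈ D
      · have hb : b ∈ D := D.lower' h' hc
        rw [indMap_val_of_mem D U V _ hc, indMap_val_of_mem D U V _ hc,
          indMap_val_of_mem D U V _ hb]
      · exact (Subtype.property (indMap D U V h' (indMap D U V h x)) fun h => hc h.1).trans
          (Subtype.property (indMap D U V (h.trans h') x) fun h => hc h.1).symm))

section ind

variable {D : LowerSet (ZnPoset n)} {U : UpperSet (ZnPoset n)} {V : Type u}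
  [AddCommGroup V] [Module k V]

/-- The inclusion of a component of the indicator module in `V`. -/
noncomputable def indVal (D : LowerSet (ZnPoset n)) (U : UpperSet (ZnPoset n)) (V : Type u)
    [AddCommGroup V] [Module k V] (c : ZnPoset n) :
    (ind (k := k) D U V).obj c →ₗ[k] V := (indSub (k := k) D U V c).subtype

lemma indVal_injective (c : ZnPoset n) : Function.Injective (indVal (k := k) D U V c) :=
  Subtype.val_injective

lemma indVal_eq_zero {c : ZnPoset n} (hc : ¬ (c ∈ D ∧ c ∈ U)) (x : (ind (k := k) D U V).obj c) :
    indVal D U V c x = 0 := Subtype.property x hc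

lemma indVal_tr {a b : ZnPoset n} (h : a ≤ b) (hb : b ∈ D) (x : (ind (k := k) D U V).obj a) :
    indVal D U V b ((ind D U V).tr h x) = indVal D U V a x :=  indMap_val_of_mem D U V h hb x

/-- The element of a component of the indicator module with a given value. -/
noncomputable def indMk (D : LowerSet (ZnPoset n)) (U : UpperSet (ZnPoset n)) {c : ZnPoset n}
    (hD : c ∈ D) (hU : c ∈ U) : V →ₗ[k] (ind (k := k) D U V).obj c :=
  LinearMap.codRestrict (indSub (k := k) D U V c) LinearMap.id fun _ h => (h ⟨hD, hU⟩).elim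

@[simp] lemma indVal_indMk {c : ZnPoset n} (hD : c ∈ D) (hU : c ∈ U) (v : V) :
    indVal D U V c (indMk (k := k) D U hD hU v) = v := rfl

open Classical in
/-- Maps into an indicator module, from compatible linear maps on the components. -/
noncomputable def homToInd {M : ZnModule k n} (φ : ∀ c ∈ D, M.obj c →ₗ[k] V)
    (hφ : ∀ a (ha : a ∈ D) b (hb : b ∈ D) (h : a ≤ b) x, φ b hb (M.tr h x) = φ a ha x) :
    M ⟶ ind D ⊥ V :=
  homOfMaps (fun c => if h : c ∈ D then indMk D ⊥ h UpperSet.mem_bot ∘ₗ φ c h else 0)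
    fun {a b} h x => by
      apply indVal_injective
      by_cases hb : b ∈ D
      · have ha : a ∈ D := D.lower' h hb
        rw [indVal_tr _ hb, dif_pos hb, dif_pos ha]
        exact hφ a ha b hb h x
      · rw [indVal_eq_zero fun h => hb h.1, indVal_eq_zero fun h => hb h.1]

lemma indVal_homToInd {M : ZnModule k n} (φ : ∀ c ∈ D, M.obj c →ₗ[k] V)
    (hφ : ∀ a (ha : a ∈ D) b (hb : b ∈ D) (h : a ≤ b) x, φ b hb (M.tr h x) = φ a ha x)
    {c : ZnPoset n} (hc : c ∈ D) (x : M.obj c) :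
    indVal D ⊥ V c (appL (homToInd φ hφ) c x) = φ c hc x := by
  classical
  change indVal D ⊥ V c ((if h : c ∈ D then indMk D ⊥ h UpperSet.mem_bot ∘ₗ φ c h else 0) x) = _
  rw [dif_pos hc]
  rfl

end ind

/-! ### Quadrants, the directed lower sets that support indecomposable injectives -/

/-- The quadrant `{c | c_i ≤ a_i for i ∉ τ}`. -/
def quadrant (τ : Finset (Fin n)) (a : ZnPoset n) : LowerSet (ZnPoset n) where
  carrier := {c | ∀ i ∉ τ, c i ≤ a i}
  lower' _ _ h hc i hi := (h i).trans (hc i hi)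

lemma mem_quadrant {τ : Finset (Fin n)} {a c : ZnPoset n} :
    c ∈ quadrant τ a ↔ ∀ i ∉ τ, c i ≤ a i := Iff.rfl

/-- The join of two elements of `ℤⁿ`. -/
def _root_.ZnPoset.sup (a b : ZnPoset n) : ZnPoset n := fun i => max (a i) (b i)

lemma _root_.ZnPoset.le_sup_left (a b : ZnPoset n) : a ≤ a.sup b := fun _ => le_max_left _ _

lemma _root_.ZnPoset.le_sup_right (a b : ZnPoset n) : b ≤ a.sup b := fun _ => le_max_right _ _

lemma self_mem_quadrant (τ : Finset (Fin n)) (a : ZnPoset n) : a ∈ quadrant τ a :=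
  fun _ _ => le_rfl

lemma sup_mem_quadrant {τ : Finset (Fin n)} {a c d : ZnPoset n} (hc : c ∈ quadrant τ a)
    (hd : d ∈ quadrant τ a) : c.sup d ∈ quadrant τ a := fun i hi => max_le (hc i hi) (hd i hi)

instance (τ : Finset (Fin n)) (a : ZnPoset n) : IsDirectedOrder (quadrant τ a) where
  directed c d := ⟨⟨c.1.sup d.1, sup_mem_quadrant c.2 d.2⟩, ZnPoset.le_sup_left _ _,
    ZnPoset.le_sup_right _ _⟩

/-! ### Colimits over a lower set, and maps to indicator modules -/

section colim

variable (D : LowerSet (ZnPoset n)) (M : ZnModule k n)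

open Classical in
/-- The colimit of `M` over the degrees in `D`. -/
abbrev colimOn : Type u :=
  Module.DirectLimit (fun c : D => M.obj c.1) (fun i j (h : i ≤ j) => M.tr (a := i.1) (b := j.1) h)

instance : DirectedSystem (fun c : D => M.obj c.1)
    (fun i j (h : i ≤ j) => M.tr (a := i.1) (b := j.1) h) where
  map_self _ _ := tr_self M _ _
  map_map _ _ _ _ _ _ := tr_tr M _ _ _

open Classical in
/-- The map from a component to the colimit. -/
noncomputable def toColimOn {c : ZnPoset n} (hc : c ∈ D) : M.obj c →ₗ[k] colimOn D M :=
  Module.DirectLimit.of k D (fun c : D => M.obj c.1)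
    (fun i j (h : i ≤ j) => M.tr (a := i.1) (b := j.1) h) ⟨c, hc⟩

lemma toColimOn_tr {a b : ZnPoset n} (ha : a ∈ D) (hb : b ∈ D) (h : a ≤ b) (x : M.obj a) :
    toColimOn D M hb (M.tr h x) = toColimOn D M ha x := by
  classical
  exact Module.DirectLimit.of_f (R := k) (ι := D) (G := fun c : D => M.obj c.1)
    (f := fun i j (h : i ≤ j) => M.tr (a := i.1) (b := j.1) h) (i := ⟨a, ha⟩) (j := ⟨b, hb⟩)
    (hij := h)

lemma exists_tr_eq_zero_of_toColimOn [IsDirectedOrder D] {a : ZnPoset n} (ha : a ∈ D) (x : M.obj a)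
    (hx : toColimOn D M ha x = 0) : ∃ b ∈ D, ∃ h : a ≤ b, M.tr h x = 0 := by
  classical
  obtain ⟨j, h, hj⟩ := Module.DirectLimit.of.zero_exact hx
  exact ⟨j.1, j.2, h, hj⟩

lemma exists_toColimOn_eq [IsDirectedOrder D] {a : ZnPoset n} (ha : a ∈ D) (z : colimOn D M) :
    ∃ c, ∃ hc : c ∈ D, ∃ x, toColimOn D M hc x = z := by
  classical
  have : Nonempty D := ⟨⟨a, ha⟩⟩
  obtain ⟨i, x, hx⟩ := Module.DirectLimit.exists_of z
  exact ⟨i.1, i.2, x, hx⟩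

variable {M} {V : Type u} [AddCommGroup V] [Module k V]

/-- The map into an indicator module given by a linear map on the colimit. -/
noncomputable def indOfColim (ψ : colimOn D M →ₗ[k] V) : M ⟶ ind D ⊥ V :=
  homToInd (fun _ hc => ψ ∘ₗ toColimOn D M hc) fun a ha b hb h x => by
    rw [LinearMap.comp_apply, toColimOn_tr D M ha hb]; rfl

lemma indVal_indOfColim (ψ : colimOn D M →ₗ[k] V) {c : ZnPoset n} (hc : c ∈ D) (x : M.obj c) :
    indVal D ⊥ V c (appL (indOfColim D ψ) c x) = ψ (toColimOn D M hc x) :=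
  indVal_homToInd _ _ hc x

variable {D}

lemma exists_colimOn_map {N : ZnModule k n} (f : M ⟶ N) :
    ∃ g : colimOn D M →ₗ[k] colimOn D N, ∀ {c} (hc : c ∈ D) x,
      g (toColimOn D M hc x) = toColimOn D N hc (appL f c x) := by
  classical
  exact ⟨Module.DirectLimit.map (fun c : D => appL f c.1) fun i j h => LinearMap.ext fun x =>
    appL_tr f _ x, fun hc x => Module.DirectLimit.map_apply_of _ _ _⟩

/-- With `indOfColim` this is the adjunction between the colimit over `D` and the indicator module:
maps to the latter are linear maps from the former to `V`. -/
lemma exists_eq_indOfColim (f : M ⟶ ind D ⊥ V) : ∃ ψ : colimOn D M →ₗ[k] V,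
    ∀ {c} (hc : c ∈ D) x, ψ (toColimOn D M hc x) = indVal D ⊥ V c (appL f c x) := by
  classical
  exact ⟨Module.DirectLimit.lift k D _ _ (fun c : D => indVal D ⊥ V c.1 ∘ₗ appL f c.1)
    fun i j h x => by
      simp only [LinearMap.comp_apply]
      rw [appL_tr, indVal_tr _ j.2], fun hc x => Module.DirectLimit.lift_of _ _ _⟩

lemma hom_ind_ext {f g : M ⟶ ind D ⊥ V}
    (h : ∀ c ∈ D, ∀ x, indVal D ⊥ V c (appL f c x) = indVal D ⊥ V c (appL g c x)) : f = g :=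
  hom_ext_appL fun c x => indVal_injective c (by
    by_cases hc : c ∈ D
    · exact h c hc x
    · rw [indVal_eq_zero fun h => hc h.1, indVal_eq_zero fun h => hc h.1])

end colim

/-- Directed colimits preserve monomorphisms, and an injection of vector spaces splits. By the
adjunction, extending a map to the indicator module means extending a linear map on the colimit over
the quadrant. -/
instance injective_ind (τ : Finset (Fin n)) (a : ZnPoset n) (V : Type u) [AddCommGroup V]
    [Module k V] : Injective (ind (k := k) (quadrant τ a) ⊥ V) where
  factors {M N} f i _ := by
    obtain ⟨ψ, hψ⟩ := exists_eq_indOfColim f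
    obtain ⟨g, hg⟩ := exists_colimOn_map (D := quadrant τ a) i
    have hinj : LinearMap.ker g = ⊥ := by
      rw [LinearMap.ker_eq_bot']
      intro z hz
      obtain ⟨c, hc, x, rfl⟩ := exists_toColimOn_eq _ _ (self_mem_quadrant τ a) z
      rw [hg] at hz
      obtain ⟨b, hb, h, hx⟩ := exists_tr_eq_zero_of_toColimOn _ _ _ _ hz
      rw [← appL_tr] at hx
      have := (injective_iff_map_eq_zero _).1 ((mono_iff i).1 inferInstance b) _ hx
      rw [← toColimOn_tr _ _ hc hb h, this, map_zero]
    obtain ⟨r, hr⟩ := g.exists_leftInverse_of_injective hinj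
    refine ⟨indOfColim _ (ψ ∘ₗ r), hom_ind_ext fun c hc x => ?_⟩
    rw [appL_comp, indVal_indOfColim _ _ hc, ← hψ hc, LinearMap.comp_apply, ← hg]
    exact congrArg ψ (LinearMap.congr_fun hr _)

/-- An element that survives everywhere in a quadrant is detected by a map to the
indicator module. -/
lemma exists_hom_ind {M : ZnModule k n} {τ : Finset (Fin n)} {a : ZnPoset n} (y : M.obj a)
    (hy : ∀ b ∈ quadrant τ a, ∀ h : a ≤ b, M.tr h y ≠ 0) :
    ∃ p : M ⟶ ind (quadrant τ a) ⊥ k, indVal (quadrant τ a) ⊥ k a (appL p a y) = 1 := by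
  have ha := self_mem_quadrant τ a
  have hne : toColimOn (quadrant τ a) M ha y ≠ 0 := fun h0 => by
    obtain ⟨b, hb, h, hx⟩ := exists_tr_eq_zero_of_toColimOn _ _ _ _ h0
    exact hy b hb h hx
  -- The functional is only known to be nonzero on the class of `y`; the inverse factor below
  -- normalises its value to one.
  obtain ⟨ψ, hψ⟩ := Module.Projective.exists_dual_ne_zero k hne
  refine ⟨indOfColim _ ((ψ (toColimOn (quadrant τ a) M ha y))⁻¹ • ψ), ?_⟩
  rw [indVal_indOfColim _ _ ha, LinearMap.smul_apply, smul_eq_mul, inv_mul_cancel₀ hψ]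

/-! ### Binary and finite direct sums -/

section biproducts

variable {C : Type*} [Category* C] [Preadditive C] [HasFiniteBiproducts C] [HasBinaryBiproducts C]

/-- A biproduct over `Fin (r + 1)` splits off its first summand. -/
noncomputable def biproductFinSucc {r : ℕ} (X : Fin (r + 1) → C) :
    biproduct X ≅ X 0 ⊞ biproduct (fun i : Fin r => X i.succ) where
  hom := biprod.lift (biproduct.π X 0) (biproduct.lift fun i => biproduct.π X i.succ)
  inv := biprod.desc (biproduct.ι X 0) (biproduct.desc fun i => biproduct.ι X i.succ)
  hom_inv_id := by
    rw [biprod.lift_desc, biproduct.lift_desc, ← biproduct.total, Fin.sum_univ_succ]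
  inv_hom_id := by
    ext i j
    · simp
    · simp [biproduct.ι_π_ne X (Fin.succ_ne_zero _).symm]
    · simp [biproduct.ι_π_ne X (Fin.succ_ne_zero _)]
    · by_cases h : i = j
      · subst h
        simp
      · have h' : i.succ ≠ j.succ := fun h' => h (Fin.succ_injective _ h')
        simp [biproduct.ι_π_ne _ h, biproduct.ι_π_ne X h']

/-- An isomorphism with a biproduct, from inclusions and projections. -/
noncomputable def isoBiprodOfMaps {M A B : C} (i : A ⟶ M) (j : B ⟶ M) (p : M ⟶ A) (q : M ⟶ B)
    (hip : i ≫ p = 𝟙 A) (hjq : j ≫ q = 𝟙 B) (hiq : i ≫ q = 0) (hjp : j ≫ p = 0)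
    (h : p ≫ i + q ≫ j = 𝟙 M) : M ≅ A ⊞ B where
  hom := biprod.lift p q
  inv := biprod.desc i j
  hom_inv_id := by rw [biprod.lift_desc, h]
  inv_hom_id := by ext <;> simp [hip, hjq, hiq, hjp]

end biproducts

lemma injective_of_retract {A E : ZnModule k n} [Injective E] (i : A ⟶ E) (p : E ⟶ A)
    (h : i ≫ p = 𝟙 A) : Injective A where
  factors g f _ := ⟨Injective.factorThru (g ≫ i) f ≫ p, by simp [h]⟩

/-- A split monomorphism exhibits its source as a direct summand. -/
lemma nonempty_iso_biprod_cokernel {A E : ZnModule k n} (i : A ⟶ E) (p : E ⟶ A)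
    (h : i ≫ p = 𝟙 A) : Nonempty (E ≅ A ⊞ cokernel i) :=
  ⟨(ShortComplex.Splitting.ofExactOfRetraction (ShortComplex.mk i (cokernel.π i) (by simp))
    (ShortComplex.exact_cokernel i) p h inferInstance).isoBinaryBiproduct⟩

/-- The components of a direct sum. -/
noncomputable def biprodL (A B : ZnModule k n) (c : ZnPoset n) :
    (A ⊞ B).obj c ≃ₗ[k] A.obj c × B.obj c where
  toFun x := (appL biprod.fst c x, appL biprod.snd c x)
  map_add' x y := by simp
  map_smul' r x := by simp
  invFun y := appL biprod.inl c y.1 + appL biprod.inr c y.2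
  left_inv x := by
    change appL (biprod.fst ≫ biprod.inl + biprod.snd ≫ biprod.inr) c x = x
    rw [biprod.total, appL_id]
  right_inv y := by
    simp only [map_add, ← appL_comp]
    simp

lemma biprodL_tr (A B : ZnModule k n) {a b : ZnPoset n} (h : a ≤ b) (x : (A ⊞ B).obj a) :
    biprodL A B b ((A ⊞ B).tr h x) =
      (A.tr h (biprodL A B a x).1, B.tr h (biprodL A B a x).2) :=
  Prod.ext (appL_tr _ h x) (appL_tr _ h x)

lemma IsFinitelyDetermined.biprod {A B : ZnModule k n} (hA : A.IsFinitelyDetermined)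
    (hB : B.IsFinitelyDetermined) : (A ⊞ B).IsFinitelyDetermined := by
  obtain ⟨lo, hi, h, h'⟩ := hA.exists_isDeterminedBy₂ hB
  refine (isFinitelyDetermined_iff _).2 ⟨fun a => ?_, lo, hi, fun i b hb => ?_⟩
  · have := hA.1 a
    have := hB.1 a
    exact Module.Finite.equiv (biprodL A B a).symm
  · refine ((biprodL A B _).bijective.of_comp_iff' _).1 ?_
    have := ((h i b hb).prodMap (h' i b hb)).comp (biprodL A B b).bijective
    convert this using 1
    funext x
    exact biprodL_tr A B _ x

lemma finrank_biprod {A B : ZnModule k n} (hA : A.IsZnFinite) (hB : B.IsZnFinite)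
    (c : ZnPoset n) : Module.finrank k ((A ⊞ B).obj c) =
      Module.finrank k (A.obj c) + Module.finrank k (B.obj c) := by
  have := hA c
  have := hB c
  rw [(biprodL A B c).finrank_eq, Module.finrank_prod]

lemma hasIndecSummands_zero_iff (M : ZnModule k n) : M.HasIndecSummands 0 ↔ IsZero M := by
  constructor
  · rintro ⟨X, -, ⟨e⟩⟩
    refine IsZero.of_iso ?_ e
    rw [IsZero.iff_id_eq_zero]
    exact biproduct.hom_ext _ _ fun i => i.elim0
  · intro h
    refine ⟨fun i => i.elim0, fun i => i.elim0, ⟨h.iso ?_⟩⟩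
    rw [IsZero.iff_id_eq_zero]
    exact biproduct.hom_ext _ _ fun i => i.elim0

/-- Turns the indexed biproduct into a recursion, so that summands can be counted by splitting them
off one at a time. -/
lemma hasIndecSummands_succ_iff (M : ZnModule k n) (r : ℕ) : M.HasIndecSummands (r + 1) ↔
    ∃ A B : ZnModule k n, Indecomposable A ∧ B.HasIndecSummands r ∧ Nonempty (M ≅ A ⊞ B) := by
  constructor
  · rintro ⟨X, hX, ⟨e⟩⟩
    exact ⟨_, _, hX 0, ⟨_, fun i => hX i.succ, ⟨Iso.refl _⟩⟩, ⟨e ≪≫ biproductFinSucc X⟩⟩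
  · rintro ⟨A, B, hA, ⟨Y, hY, ⟨e⟩⟩, ⟨e'⟩⟩
    refine ⟨Fin.cons A Y, fun i => Fin.cases hA hY i,
      ⟨e' ≪≫ biprod.mapIso (Iso.refl A) e ≪≫ (biproductFinSucc (Fin.cons A Y)).symm⟩⟩

/-! ### Prime elements -/

/-- The annihilator of `y ∈ M_b` is the prime ideal generated by the `x_i` with `i ∉ τ`. -/
def IsPrimeElement (M : ZnModule k n) (τ : Finset (Fin n)) {b : ZnPoset n} (y : M.obj b) : Prop :=
  ∀ c (h : b ≤ c), M.tr h y = 0 ↔ c ∉ quadrant τ b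

lemma add_e_apply (b : ZnPoset n) (i j : Fin n) :
    (b + ZnPoset.e i) j = b j + if j = i then 1 else 0 := rfl

lemma add_e_le {b c : ZnPoset n} (h : b ≤ c) {i : Fin n} (hi : b i < c i) :
    b + ZnPoset.e i ≤ c := fun j => by
  have h2 : b j ≤ c j := h j
  change (b + ZnPoset.e i) j ≤ c j
  rw [add_e_apply]
  split_ifs with hj
  · subst hj; omega
  · omega

/-- The set of variables that kill an element can only grow when the element is multiplied by a
monomial, and it has at most `n` members. At a nonzero multiple where it cannot grow further, the
variables outside it never kill any nonzero multiple, so the annihilator is generated by the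
variables inside it. -/
lemma exists_isPrimeElement (M : ZnModule k n) {a : ZnPoset n} (x : M.obj a) (hx : x ≠ 0) :
    ∃ b, ∃ h : a ≤ b, ∃ τ, M.IsPrimeElement τ (M.tr h x) := by
  classical
  let T : ∀ {b : ZnPoset n}, M.obj b → Finset (Fin n) := fun {b} y =>
    Finset.univ.filter fun i => M.tr (ZnPoset.le_add_e b i) y = 0
  have hT : ∀ {b} (y : M.obj b) i, i ∈ T y ↔ M.tr (ZnPoset.le_add_e b i) y = 0 := fun y i => by
    simp [T]
  induction hd : n - (T x).card using Nat.strong_induction_on generalizing a with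
  | _ d ih =>
  by_cases hmax : ∀ c (h : a ≤ c), M.tr h x ≠ 0 → T (M.tr h x) ⊆ T x
  · refine ⟨a, le_rfl, (T x)ᶜ, ?_⟩
    rw [tr_self]
    -- Along the directions outside `T x` the element survives: if a last step in direction `i`
    -- killed a nonzero multiple, `i` would belong to the set of that multiple, hence to `T x` by
    -- maximality.
    have hsurv : ∀ d : ℕ, ∀ c (h : a ≤ c), c ∈ quadrant (T x)ᶜ a → ∑ i, (c i - a i).toNat = d →
        M.tr h x ≠ 0 := by
      intro d
      induction d with
      | zero =>
        intro c h _ hd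
        have : a = c := by
          funext i
          have h1 := (Finset.sum_eq_zero_iff.1 hd) i (Finset.mem_univ i)
          have h2 : a i ≤ c i := h i
          omega
        subst this
        rwa [tr_self]
      | succ d ihd =>
        intro c h hc hd
        obtain ⟨i, hi⟩ : ∃ i, a i < c i := by
          by_contra! hc
          have : ∑ i, (c i - a i).toNat = 0 := Finset.sum_eq_zero fun i _ => by
            have := hc i
            omega
          omega
        have hiτ : i ∉ T x := fun hiT => by
          have := mem_quadrant.1 hc i (by simpa using hiT)
          omega
        obtain ⟨c', rfl⟩ : ∃ c', c = c' + ZnPoset.e i := ⟨c - ZnPoset.e i, by abel⟩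
        have hle : a ≤ c' := fun j => by
          change a j ≤ c' j
          have h2 : a j ≤ (c' + ZnPoset.e i) j := h j
          rw [add_e_apply] at h2 hi
          split_ifs at h2 with hj
          · subst hj; simp at hi; omega
          · omega
        have hle' : c' ≤ c' + ZnPoset.e i := ZnPoset.le_add_e c' i
        have hne := ihd c' hle (fun j hj => (hle' j).trans (hc j hj)) (by
          rw [← Finset.add_sum_erase _ _ (Finset.mem_univ i)] at hd ⊢
          have : ∑ j ∈ Finset.univ.erase i, ((c' + ZnPoset.e i) j - a j).toNat =
              ∑ j ∈ Finset.univ.erase i, (c' j - a j).toNat :=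
            Finset.sum_congr rfl fun j hj => by
              rw [add_e_apply, if_neg (Finset.ne_of_mem_erase hj), add_zero]
          rw [this, add_e_apply, if_pos rfl] at hd
          have : a i ≤ c' i := hle i
          omega)
        intro h0
        refine hiτ (hmax c' hle hne ((hT _ _).2 ?_))
        rwa [tr_tr]
    refine fun c h => ⟨fun h0 hc => hsurv _ c h hc rfl h0, fun hc => ?_⟩
    have : ∃ i ∉ (T x)ᶜ, a i < c i := by
      by_contra! hcon
      exact hc fun i hi => hcon i hi
    obtain ⟨i, hi, hlt⟩ := this
    have h0 := (hT x i).1 (by simpa using hi)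
    rw [← tr_tr M (ZnPoset.le_add_e a i) (add_e_le h hlt), h0, map_zero]
  -- Some nonzero multiple is killed by strictly more variables; the induction is on the number of
  -- variables left.
  · push Not at hmax
    obtain ⟨c, h, hne, hsub⟩ := hmax
    have hss : T x ⊂ T (M.tr h x) := by
      refine Finset.ssubset_iff_subset_ne.2 ⟨fun i hi => ?_, fun he => hsub he.ge⟩
      rw [hT] at hi ⊢
      have hle : a + ZnPoset.e i ≤ c + ZnPoset.e i := fun j => by
        have h2 : a j ≤ c j := h j
        change (a + ZnPoset.e i) j ≤ (c + ZnPoset.e i) j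
        rw [add_e_apply, add_e_apply]
        omega
      rw [tr_tr, ← tr_tr M (ZnPoset.le_add_e a i) hle, hi, map_zero]
    have hcard := Finset.card_lt_card hss
    have hn : (T (M.tr h x)).card ≤ n := (Finset.card_le_univ _).trans_eq (Fintype.card_fin n)
    obtain ⟨b, h', τ, hτ⟩ := ih _ (by omega) (M.tr h x) hne rfl
    rw [tr_tr] at hτ
    exact ⟨b, h.trans h', τ, hτ⟩

/-! ### The modules `k[a + ℤτ - ℕⁿ]` as direct summands -/

/-- The indecomposable injective module `k[a + ℤτ - ℕⁿ]`. -/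
noncomputable abbrev cofree (k : Type u) [Field k] (τ : Finset (Fin n)) (a : ZnPoset n) :
    ZnModule k n := ind (quadrant τ a) ⊥ k

/-- The socle element of `k[a + ℤτ - ℕⁿ]`. -/
noncomputable def cofreeOne (k : Type u) [Field k] (τ : Finset (Fin n)) (a : ZnPoset n) :
    (cofree k τ a).obj a := indMk _ _ (self_mem_quadrant τ a) UpperSet.mem_bot 1

/-- Structure maps between degrees of the quadrant are isomorphisms of lines. Any degree `c` of the
quadrant can be compared with `a` in their join, so an endomorphism is determined by its scalar at
`a`. -/
lemma cofree_end_eq_id {τ : Finset (Fin n)} {a : ZnPoset n} (e : cofree k τ a ⟶ cofree k τ a)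
    (he : indVal (quadrant τ a) ⊥ k a (appL e a (cofreeOne k τ a)) = 1) : e = 𝟙 _ := by
  refine hom_ind_ext fun c hc x => ?_
  have hd := sup_mem_quadrant (self_mem_quadrant τ a) hc
  have hx : (cofree k τ a).tr (ZnPoset.le_sup_right a c) x =
      indVal (quadrant τ a) ⊥ k c x • (cofree k τ a).tr (ZnPoset.le_sup_left a c)
        (cofreeOne k τ a) := by
    apply indVal_injective
    rw [indVal_tr _ hd, map_smul, indVal_tr _ hd]
    simp [cofreeOne]
  rw [appL_id, ← indVal_tr (ZnPoset.le_sup_right a c) hd, ← appL_tr, hx, map_smul, map_smul,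
    appL_tr, indVal_tr _ hd, he, smul_eq_mul, mul_one]

/-- A prime element of an injective module lies in a direct summand `k[b + ℤτ - ℕⁿ]`. -/
lemma IsPrimeElement.exists_cofree_summand {E : ZnModule k n} [Injective E] {τ : Finset (Fin n)}
    {b : ZnPoset n} {y : E.obj b} (hy : E.IsPrimeElement τ y) :
    ∃ (j : cofree k τ b ⟶ E) (p : E ⟶ cofree k τ b), j ≫ p = 𝟙 _ ∧
      appL j b (cofreeOne k τ b) = y := by
  classical
  obtain ⟨p, hp⟩ := exists_hom_ind (τ := τ) y fun c hc h h0 => (hy c h).1 h0 hc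
  -- A model of the cyclic submodule generated by `y`: by primeness of `y` it is supported on the
  -- quadrant above `b`. It embeds in `k[b + ℤτ - ℕⁿ]` through `ι` and maps to `E` through `s`;
  -- injectivity of `E` extends `s` along `ι`.
  let K : ZnModule k n := ind (quadrant τ b) (UpperSet.Ici b) k
  let ι : K ⟶ cofree k τ b := homToInd (fun c _ => indVal _ _ k c)
    fun c _ d hd h x => indVal_tr h hd x
  have hι : ∀ c (hc : c ∈ quadrant τ b) x, indVal _ ⊥ k c (appL ι c x) = indVal _ _ k c x :=
    fun c hc x => indVal_homToInd _ _ hc x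
  have : Mono ι := (mono_iff ι).2 fun c x x' hxx => indVal_injective c (by
    by_cases hc : c ∈ quadrant τ b
    · rw [← hι c hc, ← hι c hc, hxx]
    · rw [indVal_eq_zero fun h => hc h.1, indVal_eq_zero fun h => hc h.1])
  let s : K ⟶ E := homOfMaps
    (fun c => if h : b ≤ c then (indVal _ _ k c).smulRight (E.tr h y) else 0) fun {c d} h x => by
      by_cases hc : b ≤ c
      · rw [dif_pos hc, dif_pos (hc.trans h)]
        simp only [LinearMap.smulRight_apply, map_smul, tr_tr]
        by_cases hd : d ∈ quadrant τ b
        · rw [indVal_tr h hd]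
        · rw [(hy d _).2 hd, smul_zero, smul_zero]
      · have : x = 0 := indVal_injective c (by
          rw [map_zero]
          exact indVal_eq_zero (fun h => hc h.2) x)
        rw [this, map_zero, map_zero, map_zero, map_zero]
  let j : cofree k τ b ⟶ E := Injective.factorThru s ι
  have hj : appL j b (cofreeOne k τ b) = y := by
    let z : K.obj b := indMk _ _ (self_mem_quadrant τ b) (le_refl b) 1
    have hz : appL ι b z = cofreeOne k τ b := indVal_injective b (by
      rw [hι b (self_mem_quadrant τ b)]; rfl)
    rw [← hz, ← appL_comp, Injective.comp_factorThru]
    change (if h : b ≤ b then (indVal _ _ k b).smulRight (E.tr h y) else 0) z = y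
    rw [dif_pos le_rfl, LinearMap.smulRight_apply, tr_self]
    exact one_smul _ _
  -- The composite fixes the socle element, since `j` sends it to `y` and `p` has value one on `y`.
  exact ⟨j, p, cofree_end_eq_id _ (by rw [appL_comp, hj, hp]), hj⟩

/-! ### The rank of a finitely determined module near `-∞` -/

/-- The components of `M` have dimension `r` in all sufficiently small degrees. -/
def HasBotRank (M : ZnModule k n) (r : ℕ) : Prop :=
  ∃ c₀ : ZnPoset n, ∀ c ≤ c₀, Module.finrank k (M.obj c) = r

lemma exists_common_le (a b : ZnPoset n) : ∃ c, c ≤ a ∧ c ≤ b :=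
  ⟨fun i => min (a i) (b i), fun _ => min_le_left _ _, fun _ => min_le_right _ _⟩

lemma HasBotRank.unique {M : ZnModule k n} {r s : ℕ} (h : M.HasBotRank r) (h' : M.HasBotRank s) :
    r = s := by
  obtain ⟨c, hc⟩ := h
  obtain ⟨d, hd⟩ := h'
  obtain ⟨e, h1, h2⟩ := exists_common_le c d
  rw [← hc e h1, hd e h2]

lemma HasBotRank.of_iso {M N : ZnModule k n} (e : M ≅ N) {r : ℕ} (h : M.HasBotRank r) :
    N.HasBotRank r := by
  obtain ⟨c, hc⟩ := h
  exact ⟨c, fun d hd => by rw [← hc d hd, (isoL e d).finrank_eq]⟩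

lemma HasBotRank.biprod {A B : ZnModule k n} (hA : A.IsZnFinite) (hB : B.IsZnFinite) {r s : ℕ}
    (h : A.HasBotRank r) (h' : B.HasBotRank s) : (A ⊞ B).HasBotRank (r + s) := by
  obtain ⟨c, hc⟩ := h
  obtain ⟨d, hd⟩ := h'
  obtain ⟨e, h1, h2⟩ := exists_common_le c d
  exact ⟨e, fun x hx => by
    rw [finrank_biprod hA hB, hc x (hx.trans h1), hd x (hx.trans h2)]⟩

lemma IsFinitelyDetermined.exists_hasBotRank {M : ZnModule k n} (h : M.IsFinitelyDetermined) :
    ∃ r, M.HasBotRank r := by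
  obtain ⟨-, lo, hi, hM⟩ := (isFinitelyDetermined_iff M).1 h
  exact ⟨_, lo, fun c hc => (LinearEquiv.ofBijective (M.tr hc)
    (hM.tr_bijective hc fun i => Or.inr (Or.inl le_rfl))).finrank_eq⟩

lemma IsFinitelyDetermined.of_isZero {M : ZnModule k n} (h : IsZero M) :
    M.IsFinitelyDetermined := by
  rw [isZero_iff] at h
  have (b : ZnPoset n) : Subsingleton (M.obj b) := ⟨fun x y => (h b x).trans (h b y).symm⟩
  exact (isFinitelyDetermined_iff M).2 ⟨fun a => inferInstance, 0, 0, fun i b _ =>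
    ⟨Function.injective_of_subsingleton _, fun y => ⟨0, Subsingleton.elim _ _⟩⟩⟩

/-! ### Classification of finite injective modules -/

lemma indVal_bijective {D : LowerSet (ZnPoset n)} {V : Type u} [AddCommGroup V] [Module k V]
    {c : ZnPoset n} (hc : c ∈ D) : Function.Bijective (indVal (k := k) D ⊥ V c) :=
  ⟨indVal_injective c, fun v => ⟨indMk D ⊥ hc UpperSet.mem_bot v, rfl⟩⟩

/-- Multiplication by `x_i` can leave the quadrant only by crossing from `a i` to `a i + 1`, so the
one-point interval at `a i` suffices. -/
lemma isFinitelyDetermined_ind (τ : Finset (Fin n)) (a : ZnPoset n) (V : Type u) [AddCommGroup V]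
    [Module k V] [FiniteDimensional k V] :
    (ind (k := k) (quadrant τ a) ⊥ V).IsFinitelyDetermined := by
  refine (isFinitelyDetermined_iff _).2 ⟨fun b => Module.Finite.of_injective _
    (indVal_injective b), a, a, fun i b hb => ?_⟩
  have hiff : b + ZnPoset.e i ∈ quadrant τ a ↔ b ∈ quadrant τ a := by
    refine ⟨fun h => (quadrant τ a).lower' (ZnPoset.le_add_e b i) h, fun h j hj => ?_⟩
    have h1 : b j ≤ a j := h j hj
    change (b + ZnPoset.e i) j ≤ a j
    rw [add_e_apply]
    split_ifs with hji
    · subst hji; omega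
    · omega
  by_cases hm : b ∈ quadrant τ a
  · have h1 := indVal_bijective (k := k) (V := V) (hiff.2 hm)
    refine (h1.of_comp_iff' _).1 ?_
    convert indVal_bijective (k := k) (V := V) hm using 1
    funext x
    exact indVal_tr _ (hiff.2 hm) x
  · have h1 : ∀ x : (ind (k := k) (quadrant τ a) ⊥ V).obj b, x = 0 := fun x =>
      indVal_injective b (by rw [map_zero]; exact indVal_eq_zero (fun h => hm h.1) x)
    have h2 : ∀ x : (ind (k := k) (quadrant τ a) ⊥ V).obj (b + ZnPoset.e i), x = 0 := fun x =>
      indVal_injective _ (by rw [map_zero]; exact indVal_eq_zero (fun h => hm (hiff.1 h.1)) x)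
    exact ⟨fun x y _ => (h1 x).trans (h1 y).symm, fun y => ⟨0, by rw [map_zero, h2 y]⟩⟩

/-- Every quadrant contains all sufficiently small degrees, so each indecomposable injective,
whatever `τ` and `a` are, contributes exactly one to the rank near `-∞`. This is what makes the rank
count summands. -/
lemma hasBotRank_cofree (τ : Finset (Fin n)) (a : ZnPoset n) : (cofree k τ a).HasBotRank 1 :=
  ⟨a, fun c hc => by
    rw [(LinearEquiv.ofBijective _ (indVal_bijective (k := k) (V := k)
      ((quadrant τ a).lower' hc (self_mem_quadrant τ a)))).finrank_eq, Module.finrank_self]⟩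

lemma not_isZero_cofree (τ : Finset (Fin n)) (a : ZnPoset n) : ¬ IsZero (cofree k τ a) := fun h =>
  one_ne_zero (α := k) (congrArg (indVal (quadrant τ a) ⊥ k a)
    ((isZero_iff _).1 h a (cofreeOne k τ a)))

lemma exists_cofree_summand {E : ZnModule k n} [Injective E] (h : ¬ IsZero E) :
    ∃ (τ : Finset (Fin n)) (a : ZnPoset n) (B : ZnModule k n),
      Nonempty (E ≅ cofree k τ a ⊞ B) := by
  rw [isZero_iff] at h
  push Not at h
  obtain ⟨a, x, hx⟩ := h
  obtain ⟨b, h, τ, hy⟩ := E.exists_isPrimeElement x hx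
  obtain ⟨j, p, hjp, -⟩ := hy.exists_cofree_summand
  exact ⟨τ, b, _, nonempty_iso_biprod_cokernel j p hjp⟩

lemma IsFinitelyDetermined.of_biprod {A B : ZnModule k n} (h : (A ⊞ B).IsFinitelyDetermined) :
    A.IsFinitelyDetermined ∧ B.IsFinitelyDetermined :=
  ⟨h.of_epi_of_mono h biprod.fst biprod.inl, h.of_epi_of_mono h biprod.snd biprod.inr⟩

lemma injective_of_biprod {A B : ZnModule k n} (h : Injective (A ⊞ B)) :
    Injective A ∧ Injective B :=
  ⟨injective_of_retract (E := A ⊞ B) biprod.inl biprod.fst (by simp),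
    injective_of_retract (E := A ⊞ B) biprod.inr biprod.snd (by simp)⟩

/-- A nonzero injective module has a summand of rank one. -/
lemma isZero_of_hasBotRank_zero {E : ZnModule k n} [hE : Injective E]
    (h : E.IsFinitelyDetermined) (h0 : E.HasBotRank 0) : IsZero E := by
  by_contra hz
  obtain ⟨τ, a, B, ⟨e⟩⟩ := exists_cofree_summand hz
  obtain ⟨hA, hB⟩ := (h.of_iso e).of_biprod
  obtain ⟨s, hs⟩ := hB.exists_hasBotRank
  have := (h0.of_iso e).unique ((hasBotRank_cofree τ a).biprod hA.1 hB.1 hs)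
  omega

/-- The rank is one, so in a decomposition one of the two factors has rank zero; being injective and
finitely determined, it vanishes. -/
lemma indecomposable_cofree (τ : Finset (Fin n)) (a : ZnPoset n) :
    Indecomposable (cofree k τ a) := by
  refine ⟨not_isZero_cofree τ a, fun Y Z e => ?_⟩
  have : FiniteDimensional k k := inferInstance
  obtain ⟨hY, hZ⟩ := ((isFinitelyDetermined_ind τ a k).of_iso e).of_biprod
  obtain ⟨iY, iZ⟩ := injective_of_biprod (Injective.of_iso e inferInstance)
  obtain ⟨r, hr⟩ := hY.exists_hasBotRank
  obtain ⟨s, hs⟩ := hZ.exists_hasBotRank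
  have := ((hasBotRank_cofree τ a).of_iso e).unique (hr.biprod hY.1 hZ.1 hs)
  obtain rfl | rfl : r = 0 ∨ s = 0 := by omega
  · exact Or.inl (isZero_of_hasBotRank_zero hY hr)
  · exact Or.inr (isZero_of_hasBotRank_zero hZ hs)

lemma _root_.CategoryTheory.Indecomposable.exists_iso_cofree {A : ZnModule k n} [Injective A]
    (hA : Indecomposable A) : ∃ τ a, Nonempty (A ≅ cofree k τ a) := by
  obtain ⟨τ, a, B, ⟨e⟩⟩ := exists_cofree_summand hA.1
  rcases hA.2 _ _ e with h | h
  · exact absurd h (not_isZero_cofree τ a)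
  · exact ⟨τ, a, ⟨e ≪≫ (isoBiprodZero h).symm⟩⟩

lemma IsFiniteInjective.isFinitelyDetermined_and_hasBotRank {E : ZnModule k n} {r : ℕ}
    (hE : E.IsFiniteInjective r) : E.IsFinitelyDetermined ∧ E.HasBotRank r := by
  induction r generalizing E with
  | zero =>
    have hz := (hasIndecSummands_zero_iff E).1 hE.2
    refine ⟨.of_isZero hz, 0, fun c _ => ?_⟩
    rw [isZero_iff] at hz
    have : Subsingleton (E.obj c) := ⟨fun x y => (hz c x).trans (hz c y).symm⟩
    exact Module.finrank_zero_of_subsingleton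
  | succ r ih =>
    obtain ⟨A, B, hA, hB, ⟨e⟩⟩ := (hasIndecSummands_succ_iff E r).1 hE.2
    obtain ⟨iA, iB⟩ := injective_of_biprod (Injective.of_iso e hE.1)
    obtain ⟨hB₁, hB₂⟩ := ih ⟨iB, hB⟩
    obtain ⟨τ, a, ⟨e'⟩⟩ := hA.exists_iso_cofree
    have hA₁ := (isFinitelyDetermined_ind τ a k).of_iso e'.symm
    exact ⟨(hA₁.biprod hB₁).of_iso e.symm, by
      rw [add_comm]
      exact (((hasBotRank_cofree τ a).of_iso e'.symm).biprod hA₁.1 hB₁.1 hB₂).of_iso e.symm⟩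

/-- Makes the number of summands intrinsic: it equals the rank near `-∞`, independently of the
decomposition. For the converse, split off modules `k[a + ℤτ - ℕⁿ]`; each lowers the rank by one, so
the process stops. -/
lemma isFiniteInjective_iff (E : ZnModule k n) (r : ℕ) : E.IsFiniteInjective r ↔
    Injective E ∧ E.IsFinitelyDetermined ∧ E.HasBotRank r := by
  refine ⟨fun h => ⟨h.1, h.isFinitelyDetermined_and_hasBotRank⟩, fun ⟨hE, hfd, hr⟩ => ⟨hE, ?_⟩⟩
  induction r generalizing E with
  | zero => exact (hasIndecSummands_zero_iff E).2 (isZero_of_hasBotRank_zero hfd hr)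
  | succ r ih =>
    have hz : ¬ IsZero E := fun hz => by
      obtain ⟨c, hc⟩ := hr
      have h1 := hc c le_rfl
      rw [isZero_iff] at hz
      have : Subsingleton (E.obj c) := ⟨fun x y => (hz c x).trans (hz c y).symm⟩
      rw [Module.finrank_zero_of_subsingleton] at h1
      omega
    obtain ⟨τ, a, B, ⟨e⟩⟩ := exists_cofree_summand hz
    obtain ⟨hA, hB⟩ := (hfd.of_iso e).of_biprod
    obtain ⟨iA, iB⟩ := injective_of_biprod (Injective.of_iso e hE)
    obtain ⟨s, hs⟩ := hB.exists_hasBotRank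
    obtain rfl : s = r := by
      have := (hr.of_iso e).unique ((hasBotRank_cofree τ a).biprod hA.1 hB.1 hs)
      omega
    exact (hasIndecSummands_succ_iff E s).2
      ⟨_, B, indecomposable_cofree τ a, ih B ⟨iB, hB, hs⟩ iB hB hs, ⟨e⟩⟩

lemma exists_isFiniteInjective {E : ZnModule k n} [hE : Injective E] (h : E.IsFinitelyDetermined) :
    ∃ r, E.IsFiniteInjective r := by
  obtain ⟨r, hr⟩ := h.exists_hasBotRank
  exact ⟨r, (isFiniteInjective_iff E r).2 ⟨hE, h, hr⟩⟩

/-! ### Existence of finite injective hulls -/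

/-- For `b` in the quadrant, passing from `c` to the join of `b` and `c` moves only coordinates
already above `hi`, so `N_c` is identified with the component at the join. Inverting this
identification turns the structure maps from `N_b` to the join into a compatible family with values
in the single space `N_c`. -/
lemma exists_hom_ind_of_isDeterminedBy {N : ZnModule k n} {lo hi : ZnPoset n}
    (hN : N.IsDeterminedBy lo hi) (c : ZnPoset n)
    (τ : Finset (Fin n)) (hτ : ∀ i, i ∈ τ ↔ hi i < c i) :
    ∃ g : N ⟶ ind (quadrant τ c) ⊥ (N.obj c),
      ∀ b ∈ quadrant τ c, ∀ x : N.obj b,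
        appL g b x = 0 → N.tr (ZnPoset.le_sup_left b c) x = 0 := by
  set D := quadrant τ c with hD
  have hbij : ∀ b ∈ D, Function.Bijective (N.tr (ZnPoset.le_sup_right b c)) := fun b hb =>
    hN.tr_bijective _ fun i => by
      by_cases hi' : hi i < c i
      · exact Or.inr (Or.inr hi')
      · exact Or.inl (max_eq_right (mem_quadrant.1 hb i (by rwa [hτ]))).symm
  let φ : ∀ b ∈ D, N.obj b →ₗ[k] N.obj c := fun b hb =>
    (LinearEquiv.ofBijective _ (hbij b hb)).symm.toLinearMap ∘ₗ N.tr (ZnPoset.le_sup_left b c)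
  have hφ : ∀ b hb x, N.tr (ZnPoset.le_sup_right b c) (φ b hb x) =
      N.tr (ZnPoset.le_sup_left b c) x := fun b hb x =>
    LinearEquiv.apply_symm_apply (LinearEquiv.ofBijective _ (hbij b hb)) _
  have hcompat : ∀ a (ha : a ∈ D) b (hb : b ∈ D) (h : a ≤ b) x,
      φ b hb (N.tr h x) = φ a ha x := fun a ha b hb h x => (hbij b hb).1 <| by
    have hle : a.sup c ≤ b.sup c := fun i => max_le_max (h i) le_rfl
    rw [hφ b hb, ← tr_tr N (ZnPoset.le_sup_right a c) hle, hφ a ha, tr_tr, tr_tr]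
  refine ⟨homToInd φ hcompat, fun b hb x hx => ?_⟩
  rw [← hφ b hb x, ← indVal_homToInd φ hcompat hb x, hx, map_zero, map_zero]

lemma exists_hom_finite_sum {N : ZnModule k n} {ι : Type*} (G : ι → ZnModule k n)
    (hG : ∀ i, Injective (G i) ∧ (G i).IsFinitelyDetermined) (g : ∀ i, N ⟶ G i) (s : Finset ι) :
    ∃ (E : ZnModule k n) (f : N ⟶ E), Injective E ∧ E.IsFinitelyDetermined ∧
      ∀ b (x : N.obj b), appL f b x = 0 → ∀ i ∈ s, appL (g i) b x = 0 := by
  classical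
  induction s using Finset.induction_on with
  | empty =>
    obtain ⟨Z, hz⟩ := HasZeroObject.zero (C := ZnModule k n)
    exact ⟨Z, 0, hz.injective, .of_isZero hz, by simp⟩
  | insert i s _ ih =>
    obtain ⟨E, f, h1, h2, h3⟩ := ih
    have := (hG i).1
    refine ⟨G i ⊞ E, biprod.lift (g i) f, inferInstance, (hG i).2.biprod h2, fun b x hx j hj => ?_⟩
    rcases Finset.mem_insert.1 hj with rfl | hj
    · rw [← biprod.lift_fst (g j) f, appL_comp, hx, map_zero]
    · refine h3 b x ?_ j hj
      rw [← biprod.lift_snd (g i) f, appL_comp, hx, map_zero]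

/-- A finitely determined module has a finite injective hull. -/
lemma IsFinitelyDetermined.exists_mono {N : ZnModule k n} (h : N.IsFinitelyDetermined) :
    ∃ (E : ZnModule k n) (f : N ⟶ E) (r : ℕ), Mono f ∧ E.IsFiniteInjective r := by
  obtain ⟨hfin, lo, hi₀, hN₀⟩ := (isFinitelyDetermined_iff N).1 h
  -- Enlarging `hi` to make the box nonempty is harmless, and the clamping below relies on it.
  obtain ⟨hi, hlohi, hN⟩ : ∃ hi : ZnPoset n, (∀ i, lo i ≤ hi i) ∧ N.IsDeterminedBy lo hi :=
    ⟨fun i => max (lo i) (hi₀ i), fun i => le_max_left _ _,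
      hN₀.mono (fun i => le_rfl) fun i => le_max_right _ _⟩
  choose g hg using fun c => exists_hom_ind_of_isDeterminedBy hN c
    {i : Fin n | hi i < c i}.toFinite.toFinset (by simp)
  obtain ⟨E, f, hE, hfd, hf⟩ := exists_hom_finite_sum _
    (fun c => ⟨inferInstance, have := hfin c; isFinitelyDetermined_ind _ _ _⟩) g
    -- The value `hi i + 1` stands for all coordinates above `hi i`; at such a coordinate the
    -- direction `i` belongs to `τ`.
    (Fintype.piFinset fun i => Finset.Icc (lo i) (hi i + 1))
  obtain ⟨r, hr⟩ := exists_isFiniteInjective hfd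
  refine ⟨E, f, r, (mono_iff f).2 fun b => (injective_iff_map_eq_zero _).2 fun x hx => ?_, hr⟩
  -- The degree `b` clamped to the box. Then `b` lies in the quadrant of `c`: where `c i ≤ hi i`,
  -- the upper bound was not active, so `b i ≤ c i`.
  let c : ZnPoset n := fun i => max (lo i) (min (b i) (hi i + 1))
  have hc : ∀ i, c i = max (lo i) (min (b i) (hi i + 1)) := fun i => rfl
  have h0 := hg c b (fun i hi' => by
    have := hc i
    have := hlohi i
    have hi' : ¬ hi i < c i := by simpa using hi'
    omega) x (hf b x hx c (Fintype.mem_piFinset.2 fun i => Finset.mem_Icc.2 (by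
      have := hc i
      have := hlohi i
      omega)))
  -- The join differs from `b` only where `b i < lo i`, and there it equals `lo i`, so the structure
  -- map to the join loses nothing.
  refine (injective_iff_map_eq_zero _).1 (hN.tr_bijective (ZnPoset.le_sup_left b c) fun i => ?_).1
    x h0
  have h1 : (b.sup c) i = max (b i) (c i) := rfl
  have := hc i
  have := hlohi i
  omega

/-! ### Minimal injective hulls -/

lemma IsFinitelyDetermined.exists_isMinimalInjectiveHull {N : ZnModule k n}
    (h : N.IsFinitelyDetermined) :
    ∃ (E : ZnModule k n) (f : N ⟶ E), IsMinimalInjectiveHull f := by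
  classical
  have hex : ∃ (r : ℕ) (E : ZnModule k n) (f : N ⟶ E), Mono f ∧ E.IsFiniteInjective r := by
    obtain ⟨E, f, r, h⟩ := h.exists_mono
    exact ⟨r, E, f, h⟩
  obtain ⟨E, f, hf, hE⟩ := Nat.find_spec hex
  exact ⟨E, f, hf, _, hE, fun E' f' r' hf' hE' => Nat.find_min' hex ⟨E', f', hf', hE'⟩⟩

lemma IsMinimalInjectiveHull.isFinitelyDetermined {N E : ZnModule k n} {f : N ⟶ E}
    (hf : IsMinimalInjectiveHull f) : E.IsFinitelyDetermined := by
  obtain ⟨-, r, hE, -⟩ := hf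
  exact hE.isFinitelyDetermined_and_hasBotRank.1

lemma IsMinimalInjectiveHull.injective {N E : ZnModule k n} {f : N ⟶ E}
    (hf : IsMinimalInjectiveHull f) : Injective E := by
  obtain ⟨-, r, hE, -⟩ := hf
  exact hE.1

/-- Minimal injective hulls are essential extensions. -/
lemma IsMinimalInjectiveHull.mono_of_mono_comp {N E X : ZnModule k n} {f : N ⟶ E}
    (hf : IsMinimalInjectiveHull f) (g : E ⟶ X) [Mono (f ≫ g)] : Mono g := by
  obtain ⟨hmono, r, hE, hmin⟩ := hf
  have := hE.1
  rw [mono_iff] at hmono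
  have hfg := (mono_iff (f ≫ g)).1 inferInstance
  by_contra hg
  obtain ⟨a, x, hgx, hx⟩ : ∃ (a : ZnPoset n) (x : E.obj a), appL g a x = 0 ∧ x ≠ 0 := by
    by_contra! hcon
    exact hg ((mono_iff g).2 fun b => (injective_iff_map_eq_zero _).2 fun x hx => hcon b x hx)
  obtain ⟨b, h, τ, hy⟩ := E.exists_isPrimeElement x hx
  obtain ⟨j, p, hjp, hj⟩ := hy.exists_cofree_summand
  -- The socle element goes to a multiple of `x`, so `g` kills all of its monomial multiples.
  have hgj : ∀ c (h : b ≤ c), appL g c (appL j c ((cofree k τ b).tr h (cofreeOne k τ b))) = 0 := by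
    intro c h
    rw [appL_tr, hj, tr_tr, appL_tr, hgx, map_zero]
  have hjinj : Mono j := by
    have : Mono (j ≫ p) := by rw [hjp]; infer_instance
    exact mono_of_mono j p
  rw [mono_iff] at hjinj
  obtain ⟨e⟩ := nonempty_iso_biprod_cokernel j p hjp
  obtain ⟨-, hfd, hr⟩ := (isFiniteInjective_iff E r).1 hE
  obtain ⟨hA, hB⟩ := (hfd.of_iso e).of_biprod
  obtain ⟨iA, iB⟩ := injective_of_biprod (Injective.of_iso e hE.1)
  obtain ⟨s, hs⟩ := exists_isFiniteInjective hB
  -- `N` still embeds after the summand is divided out. If `f m` comes from `z` in the summand, then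
  -- in the join of degrees it is a scalar times a multiple of the socle element, which `g` kills.
  -- Injectivity of `f ≫ g` makes that image of `m` zero, hence `z` is zero, since structure maps
  -- within the quadrant are injective.
  have hle := hmin (cokernel j) (f ≫ cokernel.π j) s ((mono_iff _).2 fun c =>
    (injective_iff_map_eq_zero _).2 fun m hm => by
      obtain ⟨z, hz⟩ := exists_of_cokernel_π_eq_zero j c (appL f c m) hm
      by_cases hc : c ∈ quadrant τ b
      · have hd := sup_mem_quadrant (self_mem_quadrant τ b) hc
        have hz' : (cofree k τ b).tr (ZnPoset.le_sup_right b c) z =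
            indVal (quadrant τ b) ⊥ k c z • (cofree k τ b).tr (ZnPoset.le_sup_left b c)
              (cofreeOne k τ b) := by
          apply indVal_injective
          rw [indVal_tr _ hd, map_smul, indVal_tr _ hd]
          simp [cofreeOne]
        have h1 : appL f _ (N.tr (ZnPoset.le_sup_right b c) m) =
            appL j _ ((cofree k τ b).tr (ZnPoset.le_sup_right b c) z) := by
          rw [appL_tr, appL_tr, hz]
        have h2 : appL (f ≫ g) _ (N.tr (ZnPoset.le_sup_right b c) m) = 0 := by
          rw [appL_comp, h1, hz', map_smul, map_smul, hgj, smul_zero]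
        have h3 := (injective_iff_map_eq_zero _).1 (hfg _) _ h2
        rw [h3, map_zero, eq_comm] at h1
        have h4 := (injective_iff_map_eq_zero _).1 (hjinj _) _ h1
        have h5 : z = 0 := indVal_injective c (by
          rw [← indVal_tr (ZnPoset.le_sup_right b c) hd, h4, map_zero, map_zero])
        refine (injective_iff_map_eq_zero _).1 (hmono c) m ?_
        rw [← hz, h5, map_zero]
      · have h5 : z = 0 := indVal_injective c (by
          rw [map_zero]
          exact indVal_eq_zero (fun h => hc h.1) z)
        refine (injective_iff_map_eq_zero _).1 (hmono c) m ?_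
        rw [← hz, h5, map_zero]) hs
  -- The quotient is a finite injective hull with rank one less, which contradicts minimality.
  have := (hr.of_iso e).unique ((hasBotRank_cofree τ b).biprod hA.1 hB.1
    hs.isFinitelyDetermined_and_hasBotRank.2)
  omega

/-- Injections both ways give equal finite dimensions in each degree, so neither map has to be the
inverse of the other. -/
lemma isIso_of_mono_of_mono {E E' : ZnModule k n} (hE : E.IsZnFinite) (hE' : E'.IsZnFinite)
    (g : E ⟶ E') (h : E' ⟶ E) [Mono g] [Mono h] : IsIso g := by
  refine (isIso_iff g).2 fun b => ?_
  have := hE b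
  have := hE' b
  have hg := (mono_iff g).1 inferInstance b
  have hh := (mono_iff h).1 inferInstance b
  exact ⟨hg, (LinearMap.injective_iff_surjective_of_finrank_eq_finrank (le_antisymm
    (LinearMap.finrank_le_finrank_of_injective hg)
    (LinearMap.finrank_le_finrank_of_injective hh))).1 hg⟩

/-- A morphism between minimal injective hulls of `N` over `N` is an isomorphism. -/
lemma IsMinimalInjectiveHull.isIso {N E E' : ZnModule k n} {f : N ⟶ E} {f' : N ⟶ E'}
    (hf : IsMinimalInjectiveHull f) (hf' : IsMinimalInjectiveHull f') (g : E ⟶ E')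
    (hg : f ≫ g = f') : IsIso g := by
  have := hf.1
  have := hf'.1
  have := hf.injective
  have : Mono (f ≫ g) := by rwa [hg]
  have hh : f' ≫ Injective.factorThru f f' = f := Injective.comp_factorThru _ _
  have : Mono (f' ≫ Injective.factorThru f f') := by rwa [hh]
  have := hf.mono_of_mono_comp g
  have := hf'.mono_of_mono_comp (Injective.factorThru f f')
  exact isIso_of_mono_of_mono hf.isFinitelyDetermined.1 hf'.isFinitelyDetermined.1 g
    (Injective.factorThru f f')

/-- The hull splits, and the retraction is a monomorphism by essentiality. This is what stops a
minimal resolution once a cosyzygy is injective. -/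
lemma IsMinimalInjectiveHull.isIso_of_injective {N E : ZnModule k n} {f : N ⟶ E}
    (hf : IsMinimalInjectiveHull f) [Injective N] : IsIso f := by
  have := hf.1
  have hr : f ≫ Injective.factorThru (𝟙 N) f = 𝟙 N := Injective.comp_factorThru _ _
  have : Mono (f ≫ Injective.factorThru (𝟙 N) f) := by rw [hr]; infer_instance
  have := hf.mono_of_mono_comp (Injective.factorThru (𝟙 N) f)
  exact ⟨Injective.factorThru (𝟙 N) f, hr, by
    rw [← cancel_mono (Injective.factorThru (𝟙 N) f), Category.assoc, hr, Category.comp_id,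
      Category.id_comp]⟩

lemma IsMinimalInjectiveHull.isZero {N E : ZnModule k n} {f : N ⟶ E}
    (hf : IsMinimalInjectiveHull f) (hN : IsZero N) : IsZero E := by
  have := hN.injective
  have := hf.isIso_of_injective
  exact hN.of_iso (asIso f).symm

lemma IsMinimalInjectiveHull.iso_comp {M N E : ZnModule k n} {f : N ⟶ E}
    (hf : IsMinimalInjectiveHull f) (e : M ⟶ N) [IsIso e] : IsMinimalInjectiveHull (e ≫ f) := by
  obtain ⟨h, r, hr, hmin⟩ := hf
  exact ⟨inferInstance, r, hr, fun E' f' r' hf' hE' =>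
    hmin E' (inv e ≫ f') r' inferInstance hE'⟩

/-! ### Injective dimension -/

/-- Replace the `i`-th coordinate. -/
def _root_.ZnPoset.upd (b : ZnPoset n) (i : Fin n) (c : ℤ) : ZnPoset n :=
  fun j => if j = i then c else b j

lemma upd_apply (b : ZnPoset n) (i j : Fin n) (c : ℤ) :
    b.upd i c j = if j = i then c else b j := rfl

lemma upd_self (b : ZnPoset n) (i : Fin n) (c : ℤ) : b.upd i c i = c := if_pos rfl

lemma upd_le_upd {b b' : ZnPoset n} (h : b ≤ b') (i : Fin n) {c c' : ℤ} (hc : c ≤ c') :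
    b.upd i c ≤ b'.upd i c' := fun j => by
  change b.upd i c j ≤ b'.upd i c' j
  rw [upd_apply, upd_apply]
  split_ifs
  · exact hc
  · exact h j

lemma le_upd (b : ZnPoset n) {i : Fin n} {c : ℤ} (hc : b i ≤ c) : b ≤ b.upd i c := fun j => by
  change b j ≤ b.upd i c j
  rw [upd_apply]
  split_ifs with h
  · rwa [h]
  · exact le_rfl

lemma upd_le (b : ZnPoset n) {i : Fin n} {c : ℤ} (hc : c ≤ b i) : b.upd i c ≤ b := fun j => by
  change b.upd i c j ≤ b j
  rw [upd_apply]
  split_ifs with h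
  · rwa [h]
  · exact le_rfl

lemma upd_le_upd_add_e (b : ZnPoset n) (i : Fin n) {c d : ℤ} (hc : c ≤ d + 1) :
    b.upd i c ≤ b.upd i d + ZnPoset.e i := fun j => by
  change b.upd i c j ≤ (b.upd i d + ZnPoset.e i) j
  rw [add_e_apply, upd_apply, upd_apply]
  split_ifs <;> omega

lemma upd_add_e_le_upd (b : ZnPoset n) (i : Fin n) {c d : ℤ} (hc : c + 1 ≤ d) :
    b.upd i c + ZnPoset.e i ≤ b.upd i d := fun j => by
  change (b.upd i c + ZnPoset.e i) j ≤ b.upd i d j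
  rw [add_e_apply, upd_apply, upd_apply]
  split_ifs <;> omega

/-! ### Coinduction along one coordinate and its difference sequence -/

lemma add_le_add_zn {a b : ZnPoset n} (h : a ≤ b) (v : ZnPoset n) : a + v ≤ b + v :=
  fun j => add_le_add (h j) le_rfl

/-- The coinduction of `N` along the direction `i`: in degree `b` it is the product of the
components of `N` on the ray `b + ℕ e_i`. -/
noncomputable def coind (i : Fin n) (N : ZnModule k n) : ZnModule k n :=
  ofMaps (fun b => ∀ c : Set.Ici (b i), N.obj (b.upd i c))
    (fun {a _} h => LinearMap.pi fun c =>
      N.tr (upd_le_upd h i le_rfl) ∘ₗ LinearMap.proj (⟨c.1, (h i).trans c.2⟩ : Set.Ici (a i)))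
    (fun _ _ => funext fun _ => tr_self N _ _)
    (fun _ _ _ => funext fun _ => tr_tr N _ _ _)

/-- The component of an element of the coinduced module. -/
def coindVal {i : Fin n} {N : ZnModule k n} {b : ZnPoset n} (y : (coind i N).obj b) (c : ℤ)
    (hc : b i ≤ c) : N.obj (b.upd i c) :=
  (y : ∀ c : Set.Ici (b i), N.obj (b.upd i c)) ⟨c, hc⟩

lemma coind_ext {i : Fin n} {N : ZnModule k n} {b : ZnPoset n} {y z : (coind i N).obj b}
    (h : ∀ c hc, coindVal y c hc = coindVal z c hc) : y = z := funext fun c => h c.1 c.2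

lemma coindVal_tr {i : Fin n} {N : ZnModule k n} {a b : ZnPoset n} (h : a ≤ b)
    (y : (coind i N).obj a) (c : ℤ) (hc : b i ≤ c) :
    coindVal ((coind i N).tr h y) c hc = N.tr (upd_le_upd h i le_rfl)
      (coindVal y c ((h i).trans hc)) := rfl

lemma tr_coindVal_congr {i : Fin n} {N : ZnModule k n} {b d : ZnPoset n} (y : (coind i N).obj b)
    {c c' : ℤ} (hc : b i ≤ c) (hc' : b i ≤ c') (e : c = c') (h : b.upd i c ≤ d)
    (h' : b.upd i c' ≤ d) : N.tr h (coindVal y c hc) = N.tr h' (coindVal y c' hc') := by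
  subst e; rfl

/-- Translation of a `ℤⁿ`-module. -/
def translate (v : ZnPoset n) (N : ZnModule k n) : ZnModule k n :=
  ofMaps (fun b => N.obj (b + v))
    (fun h => N.tr (add_le_add_zn h v))
    (fun _ _ => tr_self N _ _) (fun _ _ _ => tr_tr N _ _ _)

/-- Translation of a morphism. -/
def translateMap (v : ZnPoset n) {M N : ZnModule k n} (f : M ⟶ N) :
    translate v M ⟶ translate v N :=
  homOfMaps (fun b => appL f (b + v)) fun _ _ => appL_tr f _ _

/-- The inclusion of `N` in its coinduction. -/
noncomputable def toCoind (i : Fin n) (N : ZnModule k n) : N ⟶ coind i N :=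
  homOfMaps (fun b => LinearMap.pi fun c : Set.Ici (b i) => N.tr (le_upd b c.2))
    fun h x => funext fun c => by
      change N.tr _ (N.tr _ x) = N.tr _ (N.tr _ x)
      rw [tr_tr, tr_tr]

lemma coindVal_toCoind (i : Fin n) (N : ZnModule k n) (b : ZnPoset n) (x : N.obj b) (c : ℤ)
    (hc : b i ≤ c) : coindVal (appL (toCoind i N) b x) c hc = N.tr (le_upd b hc) x := rfl

/-- The difference map on the coinduction, whose kernel is `N`. -/
noncomputable def coindDiff (i : Fin n) (N : ZnModule k n) :
    coind i N ⟶ coind i (translate (ZnPoset.e i) N) :=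
  homOfMaps (fun b => LinearMap.pi fun c : Set.Ici (b i) =>
    (N.tr (ZnPoset.le_add_e (b.upd i c.1) i) ∘ₗ LinearMap.proj c -
      N.tr (upd_le_upd_add_e b i le_rfl) ∘ₗ
        LinearMap.proj (⟨c.1 + 1, Int.le_add_one c.2⟩ : Set.Ici (b i)) :
      (∀ c : Set.Ici (b i), N.obj (b.upd i c)) →ₗ[k] N.obj (b.upd i c.1 + ZnPoset.e i)))
    fun _ y => funext fun c => by
      change N.tr _ (N.tr _ (coindVal y _ _)) - N.tr _ (N.tr _ (coindVal y _ _)) =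
        N.tr _ (N.tr _ (coindVal y _ _) - N.tr _ (coindVal y _ _))
      rw [map_sub, tr_tr, tr_tr, tr_tr, tr_tr]

lemma coindVal_coindDiff (i : Fin n) (N : ZnModule k n) (b : ZnPoset n) (y : (coind i N).obj b)
    (c : ℤ) (hc : b i ≤ c) : coindVal (appL (coindDiff i N) b y) c hc =
      (N.tr (ZnPoset.le_add_e (b.upd i c) i) (coindVal y c hc) -
        N.tr (upd_le_upd_add_e b i le_rfl) (coindVal y (c + 1) (by omega)) :
          N.obj (b.upd i c + ZnPoset.e i)) := rfl

lemma toCoind_coindDiff (i : Fin n) (N : ZnModule k n) : toCoind i N ≫ coindDiff i N = 0 :=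
  hom_ext_appL fun b x => coind_ext fun c hc => by
    rw [appL_comp, coindVal_coindDiff, coindVal_toCoind, coindVal_toCoind, tr_tr, tr_tr, sub_self]
    rfl

/-- A sequence in the kernel satisfies `y_{c+1} = x_i y_c`, so it is determined by its first entry,
an element of `N`. Surjectivity is the solvability of the recursion `y_{c+1} = x_i y_c - z_c`. -/
lemma coind_shortExact (i : Fin n) (N : ZnModule k n) :
    (ShortComplex.mk _ _ (toCoind_coindDiff i N)).ShortExact where
  exact := by
    rw [shortComplex_exact_iff]
    intro b (y : (coind i N).obj b) (hy : appL (coindDiff i N) b y = 0)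
    have hstep : ∀ c (hc : b i ≤ c), N.tr (upd_le_upd le_rfl i (by omega)) (coindVal y c hc) =
        coindVal y (c + 1) (by omega) := fun c hc => by
      have h0 := coindVal_coindDiff i N b y c hc
      rw [hy] at h0
      have h1 := congrArg (N.tr (upd_add_e_le_upd b i (le_refl (c + 1)))) (sub_eq_zero.1 h0.symm)
      rwa [tr_tr, tr_tr, tr_self] at h1
    -- The degree `b.upd i (b i)` equals `b` only propositionally, so the first entry is moved back
    -- by a structure map.
    refine ⟨N.tr (upd_le b le_rfl) (coindVal y (b i) le_rfl), coind_ext fun c hc => ?_⟩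
    change N.tr (le_upd b hc) _ = _
    rw [tr_tr]
    induction c, hc using Int.leInduction with
    | base => exact tr_self N _ _
    | succ c hc ih =>
      rw [← hstep c hc, ← ih, tr_tr]
  mono_f := (mono_iff _).2 fun b => (injective_iff_map_eq_zero _).2 fun x hx => by
    have h := coindVal_toCoind i N b x (b i) le_rfl
    change appL (toCoind i N) b x = 0 at hx
    rw [hx] at h
    have h1 := congrArg (N.tr (upd_le b le_rfl)) h
    rw [tr_tr, tr_self] at h1
    rw [← h1]
    exact map_zero _
  epi_g := (epi_iff _).2 fun b z => by
    classical
    change (coind i (translate (ZnPoset.e i) N)).obj b at z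
    let t : ℤ → ∀ c, N.obj (b.upd i c) := fun d c =>
      if h : b i ≤ d ∧ d + 1 ≤ c then N.tr (upd_add_e_le_upd b i h.2) (coindVal z d h.1) else 0
    -- The solution of the recursion with first entry zero: `y_c` is minus the sum over `d < c` of
    -- `z_d` transported up to coordinate `c`.
    let y : (coind i N).obj b := fun c : Set.Ici (b i) => - ∑ d ∈ Finset.Ico (b i) c.1, t d c.1
    refine ⟨y, coind_ext fun c hc => ?_⟩
    refine (coindVal_coindDiff i N b y c hc).trans ?_
    change N.tr _ (- ∑ d ∈ Finset.Ico (b i) c, t d c) -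
      N.tr _ (- ∑ d ∈ Finset.Ico (b i) (c + 1), t d (c + 1)) = _
    have hI : Finset.Ico (b i) (c + 1) = insert c (Finset.Ico (b i) c) := by
      ext d
      simp only [Finset.mem_Ico, Finset.mem_insert]
      omega
    rw [hI, Finset.sum_insert (by simp), map_neg, map_neg, map_add, map_sum, map_sum]
    have h1 : ∀ d ∈ Finset.Ico (b i) c, N.tr (ZnPoset.le_add_e (b.upd i c) i) (t d c) =
        N.tr (upd_le_upd_add_e b i le_rfl) (t d (c + 1)) := fun d hd => by
      rw [Finset.mem_Ico] at hd
      simp only [t]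
      rw [dif_pos ⟨hd.1, by omega⟩, dif_pos ⟨hd.1, by omega⟩]
      exact (tr_tr N _ _ _).trans (tr_tr N _ _ _).symm
    have h2 : N.tr (upd_le_upd_add_e b i le_rfl) (t c (c + 1)) = coindVal z c hc := by
      simp only [t]
      rw [dif_pos ⟨hc, le_rfl⟩]
      exact (tr_tr N _ _ _).trans (tr_self N _ _)
    rw [Finset.sum_congr rfl h1, h2]
    abel

/-! ### Injectivity along a set of directions, and the bound on injective dimension -/

/-- The extension property of injective modules, for families of maps that are only required to be
compatible in the directions of `S`. -/
def IsInjectiveAlong (S : Finset (Fin n)) (N : ZnModule k n) : Prop :=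
  ∀ ⦃A B : ZnModule k n⦄ (f : A ⟶ B) [Mono f] (φ : ∀ b, A.obj b →ₗ[k] N.obj b),
    (∀ a b (h : a ≤ b), (∀ i ∉ S, a i = b i) → ∀ x, φ b (A.tr h x) = N.tr h (φ a x)) →
    ∃ ψ : ∀ b, B.obj b →ₗ[k] N.obj b,
      (∀ a b (h : a ≤ b), (∀ i ∉ S, a i = b i) → ∀ x, ψ b (B.tr h x) = N.tr h (ψ a x)) ∧
      ∀ b x, ψ b (appL f b x) = φ b x

/-- Without any direction the compatibility conditions only involve `a = b`, and each injection of
vector spaces splits separately. -/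
lemma isInjectiveAlong_empty (N : ZnModule k n) : N.IsInjectiveAlong ∅ := by
  intro A B f hf φ _
  choose r hr using fun b => (appL f b).exists_leftInverse_of_injective
    (LinearMap.ker_eq_bot.2 ((mono_iff f).1 hf b))
  refine ⟨fun b => φ b ∘ₗ r b, fun a b h hab x => ?_, fun b x =>
    congrArg (φ b) (LinearMap.congr_fun (hr b) x)⟩
  obtain rfl : a = b := funext fun i => hab i (Finset.notMem_empty i)
  rw [tr_self, tr_self]

lemma IsInjectiveAlong.injective {N : ZnModule k n} (h : N.IsInjectiveAlong Finset.univ) :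
    Injective N where
  factors g f _ := by
    obtain ⟨ψ, h1, h2⟩ := h f (appL g) fun a b h _ x => appL_tr g h x
    exact ⟨homOfMaps ψ fun {a b} h x => h1 a b h (fun i hi => absurd (Finset.mem_univ i) hi) x,
      hom_ext_appL h2⟩

lemma IsInjectiveAlong.translate {S : Finset (Fin n)} {N : ZnModule k n}
    (h : N.IsInjectiveAlong S) (v : ZnPoset n) : (ZnModule.translate v N).IsInjectiveAlong S := by
  intro A B f hf φ hφ
  have hl : ∀ b : ZnPoset n, b + -v + v ≤ b := fun b => (neg_add_cancel_right b v).le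
  have hl' : ∀ b : ZnPoset n, b ≤ b + v + -v := fun b => (add_neg_cancel_right b v).ge
  have : Mono (translateMap (-v) f) :=
    (mono_iff _).2 fun b => (mono_iff f).1 hf (b + -v)
  obtain ⟨ψ, h1, h2⟩ := h (translateMap (-v) f) (fun b => N.tr (hl b) ∘ₗ φ (b + -v))
    fun a b hab hS x => by
      refine (congrArg (N.tr (hl b)) (hφ (a + -v) (b + -v)
        (add_le_add_zn hab _)
        (fun i hi => congrArg (· + (-v) i) (hS i hi)) x)).trans ?_
      exact (tr_tr N _ _ _).trans (tr_tr N _ _ _).symm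
  refine ⟨fun b => ψ (b + v) ∘ₗ B.tr (hl' b), fun a b hab hS x => ?_, fun b x => ?_⟩
  · refine Eq.trans ?_ (h1 (a + v) (b + v) (add_le_add_zn hab _)
      (fun i hi => congrArg (· + v i) (hS i hi)) (B.tr (hl' a) x))
    change ψ _ (B.tr _ (B.tr _ x)) = ψ _ (B.tr _ (B.tr _ x))
    rw [tr_tr, tr_tr]
  · have := h2 (b + v) (A.tr (hl' b) x)
    change ψ (b + v) (appL f _ (A.tr (hl' b) x)) = N.tr (hl (b + v)) (φ _ (A.tr (hl' b) x)) at this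
    change ψ (b + v) (B.tr (hl' b) (appL f b x)) = _
    rw [← appL_tr, this]
    rw [hφ b _ (hl' b) (fun i _ => congrFun (add_neg_cancel_right b v).symm i) x]
    refine (tr_tr N _ _ _).trans (tr_self N _ _)

/-- Coinduction is right adjoint to forgetting the action of `x_i`. A family of maps to the
coinduced module that is compatible in direction `i` is determined by the first entries, which form
a family with values in `N` compatible along `S`. Extend that family to `ψ`, then rebuild the entry
at `c` as `ψ` applied to the element moved to coordinate `c`. -/
lemma IsInjectiveAlong.coind {S : Finset (Fin n)} {N : ZnModule k n} (h : N.IsInjectiveAlong S)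
    {i : Fin n} (hi : i ∉ S) : (ZnModule.coind i N).IsInjectiveAlong (insert i S) := by
  intro A B f hf φ hφ
  let ev : ∀ b : ZnPoset n, (ZnModule.coind i N).obj b →ₗ[k] N.obj b := fun b =>
    N.tr (upd_le b le_rfl) ∘ₗ (LinearMap.proj (⟨b i, Set.self_mem_Ici⟩ : Set.Ici (b i)) :
      (∀ c : Set.Ici (b i), N.obj (b.upd i c)) →ₗ[k] _)
  have hev : ∀ b y, ev b y = N.tr (upd_le b le_rfl) (coindVal y (b i) le_rfl) := fun b y => rfl
  obtain ⟨ψ, h1, h2⟩ := h f (fun b => ev b ∘ₗ φ b) fun a b hab hS x => by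
    rw [LinearMap.comp_apply, LinearMap.comp_apply,
      hφ a b hab (fun j hj => hS j fun hj' => hj (Finset.mem_insert_of_mem hj')), hev, hev,
      coindVal_tr, tr_tr, tr_tr]
    exact tr_coindVal_congr _ _ _ (hS i hi).symm _ _
  let Ψ : ∀ b, B.obj b →ₗ[k] (ZnModule.coind i N).obj b := fun b =>
    (LinearMap.pi fun c : Set.Ici (b i) => ψ (b.upd i c.1) ∘ₗ B.tr (le_upd b c.2) :
      B.obj b →ₗ[k] ∀ c : Set.Ici (b i), N.obj (b.upd i c))
  have hΨ : ∀ b x c hc, coindVal (Ψ b x) c hc = ψ (b.upd i c) (B.tr (le_upd b hc) x) :=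
    fun b x c hc => rfl
  refine ⟨Ψ, fun a b hab hS x => coind_ext fun c hc => ?_, fun b x => coind_ext fun c hc => ?_⟩
  · rw [coindVal_tr, hΨ, hΨ, ← h1 _ _ _ fun j hj => ?_, tr_tr, tr_tr]
    rw [upd_apply, upd_apply]
    split_ifs with hji
    · rfl
    · exact hS j fun h => (Finset.mem_insert.1 h).elim hji hj
  · rw [hΨ, ← appL_tr, h2, LinearMap.comp_apply, hφ _ _ _ fun j hj => ?_, hev, coindVal_tr, tr_tr]
    · refine (tr_coindVal_congr (φ b x) _ hc (upd_self b i c) _ (le_refl _)).trans (tr_self N _ _)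
    · rw [upd_apply, if_neg fun hji : j = i => hj (hji ▸ Finset.mem_insert_self i S)]

/-- Here `d` counts the missing directions. The difference sequence for a missing direction has two
terms that are injective along one more direction, so the dimension of `N` exceeds theirs by at most
one. -/
lemma IsInjectiveAlong.hasInjectiveDimensionLT (d : ℕ) {S : Finset (Fin n)} (hS : n = S.card + d)
    {N : ZnModule k n} (h : N.IsInjectiveAlong S) : HasInjectiveDimensionLT N (d + 1) := by
  induction d generalizing S N with
  | zero =>
    obtain rfl : S = Finset.univ := by
      rw [← Finset.card_eq_iff_eq_univ, Fintype.card_fin]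
      omega
    have := h.injective
    infer_instance
  | succ d ih =>
    obtain ⟨i, hi⟩ : ∃ i, i ∉ S := by
      by_contra! hcon
      have : S = Finset.univ := Finset.eq_univ_of_forall hcon
      rw [this, Finset.card_univ, Fintype.card_fin] at hS
      omega
    have hcard : n = (insert i S).card + d := by
      rw [Finset.card_insert_of_notMem hi]
      omega
    have h2 := ih hcard (h.coind hi)
    have h3 := ih hcard ((h.translate (ZnPoset.e i)).coind hi)
    exact (coind_shortExact i N).hasInjectiveDimensionLT_X₁ (d + 1) h3
      (hasInjectiveDimensionLT_of_ge (ZnModule.coind i N) (d + 1) (d + 1 + 1) (by omega))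

/-- Every `ℤⁿ`-module has injective dimension at most `n`. -/
lemma hasInjectiveDimensionLT (N : ZnModule k n) : HasInjectiveDimensionLT N (n + 1) :=
  (isInjectiveAlong_empty N).hasInjectiveDimensionLT n (by simp)

/-! ### Matlis duality -/

lemma neg_le_neg_zn {a b : ZnPoset n} (h : a ≤ b) : -b ≤ -a := fun i => neg_le_neg (h i)

/-- The Matlis dual of a `ℤⁿ`-module. -/
noncomputable def dual (M : ZnModule k n) : ZnModule k n :=
  ofMaps (fun b => Module.Dual k (M.obj (-b))) (fun h => (M.tr (neg_le_neg_zn h)).dualMap)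
    (fun _ ξ => LinearMap.ext fun x => congrArg ξ (tr_self M _ x))
    (fun _ _ ξ => LinearMap.ext fun x => congrArg ξ (tr_tr M _ _ x))

/-- The pairing of a component of the dual. -/
def dualPair {M : ZnModule k n} {b : ZnPoset n} (ξ : (dual M).obj b) : Module.Dual k (M.obj (-b)) :=
  ξ

lemma dualPair_tr {M : ZnModule k n} {a b : ZnPoset n} (h : a ≤ b) (ξ : (dual M).obj a)
    (x : M.obj (-b)) :
    dualPair ((dual M).tr h ξ) x = dualPair ξ (M.tr (neg_le_neg_zn h) x) := rfl

lemma dual_ext {M : ZnModule k n} {b : ZnPoset n} {ξ η : (dual M).obj b}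
    (h : ∀ x, dualPair ξ x = dualPair η x) : ξ = η := LinearMap.ext h

/-- The Matlis dual of a morphism. -/
noncomputable def dualMap {M N : ZnModule k n} (f : M ⟶ N) : dual N ⟶ dual M :=
  homOfMaps (fun b => (appL f (-b)).dualMap) fun h ξ => LinearMap.ext fun x =>
    (congrArg (dualPair ξ) (appL_tr f (neg_le_neg_zn h) x)).symm

@[simp] lemma dualMap_id (M : ZnModule k n) : dualMap (𝟙 M) = 𝟙 (dual M) := rfl

lemma dualMap_comp {L M N : ZnModule k n} (f : L ⟶ M) (g : M ⟶ N) :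
    dualMap (f ≫ g) = dualMap g ≫ dualMap f := rfl

@[simp] lemma dualMap_zero (M N : ZnModule k n) : dualMap (0 : M ⟶ N) = 0 :=
  hom_ext_appL fun _ ξ => LinearMap.ext fun _ => map_zero (dualPair ξ)

lemma dualMap_add {M N : ZnModule k n} (f g : M ⟶ N) :
    dualMap (f + g) = dualMap f + dualMap g :=
  hom_ext_appL fun _ ξ => LinearMap.ext fun _ => map_add (dualPair ξ) _ _

lemma dualMap_sum {M N : ZnModule k n} {ι : Type*} (s : Finset ι) (f : ι → (M ⟶ N)) :
    dualMap (∑ i ∈ s, f i) = ∑ i ∈ s, dualMap (f i) := by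
  classical
  induction s using Finset.induction_on with
  | empty => simp
  | insert i s hi ih => rw [Finset.sum_insert hi, Finset.sum_insert hi, dualMap_add, ih]

/-- The dual of an isomorphism. -/
noncomputable def dualIso {M N : ZnModule k n} (e : M ≅ N) : dual N ≅ dual M where
  hom := dualMap e.hom
  inv := dualMap e.inv
  hom_inv_id := by rw [← dualMap_comp, e.inv_hom_id, dualMap_id]
  inv_hom_id := by rw [← dualMap_comp, e.hom_inv_id, dualMap_id]

lemma mono_dualMap {M N : ZnModule k n} (f : M ⟶ N) [Epi f] : Mono (dualMap f) :=
  (mono_iff _).2 fun b => LinearMap.dualMap_injective_of_surjective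
    ((epi_iff f).1 inferInstance (-b))

lemma epi_dualMap {M N : ZnModule k n} (f : M ⟶ N) [Mono f] : Epi (dualMap f) :=
  (epi_iff _).2 fun b => LinearMap.dualMap_surjective_of_injective
    ((mono_iff f).1 inferInstance (-b))

lemma isIso_of_isIso_dualMap {M N : ZnModule k n} (f : M ⟶ N) (h : IsIso (dualMap f)) :
    IsIso f := by
  rw [isIso_iff] at h ⊢
  have h' : ∀ b, Function.Bijective (appL f (-b)) := fun b =>
    LinearMap.dualMap_bijective_iff.1 (h b)
  intro b
  have := h' (-b)
  rwa [neg_neg] at this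

/-- Over a field, a functional on `M_b` that vanishes on the kernel of `g` factors through `g`. -/
lemma exact_dualMap {L M N : ZnModule k n} (f : L ⟶ M) (g : M ⟶ N) (w : f ≫ g = 0)
    (h : (ShortComplex.mk f g w).Exact) :
    (ShortComplex.mk (dualMap g) (dualMap f)
      (by rw [← dualMap_comp, w, dualMap_zero])).Exact := by
  rw [shortComplex_exact_iff] at h ⊢
  intro b (ξ : Module.Dual k (M.obj (-b))) hξ
  have : ξ ∈ (appL g (-b)).dualMap.range := by
    rw [LinearMap.range_dualMap_eq_dualAnnihilator_ker, Submodule.mem_dualAnnihilator]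
    intro x hx
    obtain ⟨y, rfl⟩ := h _ x hx
    exact LinearMap.congr_fun hξ y
  exact this

lemma shortExact_dualMap {L M N : ZnModule k n} (f : L ⟶ M) (g : M ⟶ N) (w : f ≫ g = 0)
    (h : (ShortComplex.mk f g w).ShortExact) :
    (ShortComplex.mk (dualMap g) (dualMap f)
      (by rw [← dualMap_comp, w, dualMap_zero])).ShortExact where
  exact := exact_dualMap f g w h.exact
  mono_f := have := h.epi_g; mono_dualMap g
  epi_g := have := h.mono_f; epi_dualMap f

/-- The canonical map to the bidual. -/
noncomputable def toBidual (M : ZnModule k n) : M ⟶ dual (dual M) :=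
  homOfMaps (fun b => Module.Dual.eval k (M.obj (- -b)) ∘ₗ M.tr (neg_neg b).ge) fun h x =>
    LinearMap.ext fun ξ => by
      change dualPair ξ (M.tr _ (M.tr _ x)) = dualPair ξ (M.tr _ (M.tr _ x))
      rw [tr_tr, tr_tr]

lemma toBidual_naturality {M N : ZnModule k n} (f : M ⟶ N) :
    f ≫ toBidual N = toBidual M ≫ dualMap (dualMap f) :=
  hom_ext_appL fun _ x => LinearMap.ext fun ξ => (congrArg (dualPair ξ) (appL_tr f _ x)).symm

lemma IsZnFinite.isIso_toBidual {M : ZnModule k n} (h : M.IsZnFinite) : IsIso (toBidual M) := by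
  refine (isIso_iff _).2 fun b => ?_
  have := h (- -b)
  refine (Module.bijective_dual_eval k (M.obj (- -b))).comp ?_
  refine Function.bijective_iff_has_inverse.2 ⟨M.tr (neg_neg b).le, fun x => ?_, fun x => ?_⟩
  · exact (tr_tr M _ _ x).trans (tr_self M _ x)
  · exact (tr_tr M _ _ x).trans (tr_self M _ x)

/-- A `ℤⁿ`-finite module is isomorphic to its bidual. -/
noncomputable def IsZnFinite.bidualIso {M : ZnModule k n} (h : M.IsZnFinite) : M ≅ dual (dual M) :=
  have := h.isIso_toBidual
  asIso (toBidual M)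

lemma IsZnFinite.dual {M : ZnModule k n} (h : M.IsZnFinite) : (dual M).IsZnFinite := fun a => by
  have := h (-a)
  exact inferInstanceAs (FiniteDimensional k (Module.Dual k (M.obj (-a))))

lemma IsZnFinite.of_iso {M N : ZnModule k n} (e : M ≅ N) (h : M.IsZnFinite) : N.IsZnFinite :=
  h.of_epi e.hom

lemma IsFinitelyDetermined.dual {M : ZnModule k n} (h : M.IsFinitelyDetermined) :
    (dual M).IsFinitelyDetermined := by
  obtain ⟨hfin, lo, hi, hM⟩ := (isFinitelyDetermined_iff M).1 h
  -- Multiplication from `b` to `b + e_i` on the dual is the transpose of multiplication from `-b -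
  -- e_i` to `-b`; this shift accounts for the extra `- 1` in the lower bound.
  refine (isFinitelyDetermined_iff _).2 ⟨hfin.dual, fun i => - hi i - 1, fun i => - lo i,
    fun i b (hb : b i < - hi i - 1 ∨ - lo i < b i) => LinearMap.dualMap_bijective_iff.2 (hM.tr_bijective _ fun j => ?_)⟩
  have h1 : (-(b + ZnPoset.e i)) j = - (b + ZnPoset.e i) j := rfl
  have h2 : (-b) j = - b j := rfl
  rw [h1, h2, add_e_apply]
  split_ifs with hj
  · subst hj; omega
  · exact Or.inl (by omega)

/-- Duality commutes with direct sums. -/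
noncomputable def dualBiprod (A B : ZnModule k n) : dual (A ⊞ B) ≅ dual A ⊞ dual B :=
  isoBiprodOfMaps (dualMap biprod.fst) (dualMap biprod.snd) (dualMap biprod.inl)
    (dualMap biprod.inr) (by rw [← dualMap_comp]; simp) (by rw [← dualMap_comp]; simp)
    (by rw [← dualMap_comp]; simp) (by rw [← dualMap_comp]; simp)
    (by rw [← dualMap_comp, ← dualMap_comp, ← dualMap_add, biprod.total, dualMap_id])

lemma isZero_dual {M : ZnModule k n} (h : IsZero M) : IsZero (dual M) := by
  rw [IsZero.iff_id_eq_zero] at h ⊢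
  rw [← dualMap_id, h, dualMap_zero]

lemma IsZnFinite.isZero_of_isZero_dual {M : ZnModule k n} (h : M.IsZnFinite)
    (hz : IsZero (ZnModule.dual M)) : IsZero M :=
  (isZero_dual hz).of_iso h.bidualIso

/-- Dualising a decomposition of the dual gives a decomposition of the bidual, which is `A` itself
by `ℤⁿ`-finiteness. -/
lemma IsZnFinite.indecomposable_dual {A : ZnModule k n} (h : A.IsZnFinite)
    (hA : Indecomposable A) : Indecomposable (ZnModule.dual A) := by
  refine ⟨fun hz => hA.1 (h.isZero_of_isZero_dual hz), fun Y Z e => ?_⟩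
  have hYZ : (Y ⊞ Z).IsZnFinite := h.dual.of_iso e
  have hY : Y.IsZnFinite := hYZ.of_epi biprod.fst
  have hZ : Z.IsZnFinite := hYZ.of_epi biprod.snd
  exact (hA.2 _ _ (h.bidualIso ≪≫ (dualIso e).symm ≪≫ dualBiprod Y Z)).imp
    hY.isZero_of_isZero_dual hZ.isZero_of_isZero_dual

lemma HasIndecSummands.dual {M : ZnModule k n} (h : M.IsZnFinite) {r : ℕ}
    (hM : M.HasIndecSummands r) : (ZnModule.dual M).HasIndecSummands r := by
  induction r generalizing M with
  | zero => exact (hasIndecSummands_zero_iff _).2 (isZero_dual ((hasIndecSummands_zero_iff _).1 hM))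
  | succ r ih =>
    obtain ⟨A, B, hA, hB, ⟨e⟩⟩ := (hasIndecSummands_succ_iff M r).1 hM
    have hAB := h.of_iso e
    exact (hasIndecSummands_succ_iff _ r).2 ⟨_, _,
      (hAB.of_epi biprod.fst : A.IsZnFinite).indecomposable_dual hA, ih (hAB.of_epi biprod.snd) hB,
      ⟨(dualIso e).symm ≪≫ dualBiprod A B⟩⟩

/-! ### The total space as a module over the polynomial ring -/

open scoped TensorProduct

instance (M : ZnModule k n) : IsScalarTower k (AddMonoidAlgebra k (Fin n → ℕ)) M.Total where
  smul_assoc c r x := by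
    change (AddMonoidAlgebra.lift k (Module.End k M.Total) (Fin n → ℕ) M.monomialHom (c • r)) x =
      c • (AddMonoidAlgebra.lift k (Module.End k M.Total) (Fin n → ℕ) M.monomialHom r) x
    rw [map_smul]
    rfl

lemma total_induction {M : ZnModule k n} {p : M.Total → Prop} (x : M.Total) (h0 : p 0)
    (hincl : ∀ a m, p (M.incl a m)) (hadd : ∀ x y, p x → p y → p (x + y)) : p x := by
  let := Classical.decEq (ZnPoset n)
  exact DirectSum.induction_on (motive := p) x h0 hincl hadd

/-- The projection of the total space onto a component. -/
noncomputable def comp (M : ZnModule k n) (a : ZnPoset n) : M.Total →ₗ[k] M.obj a :=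
  DirectSum.component k (ZnPoset n) (fun a => M.obj a) a

lemma comp_incl_of_eq (M : ZnModule k n) {a b : ZnPoset n} (h : a = b) (m : M.obj a) :
    M.comp b (M.incl a m) = M.tr h.le m := by
  subst h
  rw [tr_self]
  let := Classical.decEq (ZnPoset n)
  exact DirectSum.lof_apply k (M := fun a => M.obj a) a m

lemma comp_incl_of_ne (M : ZnModule k n) {a b : ZnPoset n} (h : a ≠ b) (m : M.obj a) :
    M.comp b (M.incl a m) = 0 := by
  let := Classical.decEq (ZnPoset n)
  exact (DirectSum.component.of k (M := fun a => M.obj a) b a m).trans (dif_neg h)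

lemma total_ext {M : ZnModule k n} {x y : M.Total} (h : ∀ a, M.comp a x = M.comp a y) : x = y :=
  DirectSum.ext_component (M := fun a => M.obj a) k h

lemma single_smul_incl_eq (M : ZnModule k n) (v : Fin n → ℕ) (r : k) {a b : ZnPoset n}
    (hab : b = a + ZnPoset.ofNat v) (h : a ≤ b) (m : M.obj a) :
    (AddMonoidAlgebra.single v r : AddMonoidAlgebra k (Fin n → ℕ)) • M.incl a m =
      M.incl b (r • M.tr h m) := by
  subst hab
  exact M.single_smul_incl v r a m

lemma exists_ofNat {a b : ZnPoset n} (h : a ≤ b) : ∃ v, b = a + ZnPoset.ofNat v :=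
  ⟨fun i => (b i - a i).toNat, funext fun i => by
    have h1 : a i ≤ b i := h i
    change b i = a i + ((b i - a i).toNat : ℤ)
    omega⟩

/-- The map of total spaces induced by a morphism. -/
noncomputable def totalMapAux {M N : ZnModule k n} (f : M ⟶ N) : M.Total →ₗ[k] N.Total :=
  let := Classical.decEq (ZnPoset n)
  DirectSum.toModule k (ZnPoset n) N.Total fun a => N.incl a ∘ₗ appL f a

lemma totalMapAux_incl {M N : ZnModule k n} (f : M ⟶ N) (a : ZnPoset n) (m : M.obj a) :
    totalMapAux f (M.incl a m) = N.incl a (appL f a m) := by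
  let := Classical.decEq (ZnPoset n)
  exact DirectSum.toModule_lof k (φ := fun a => N.incl a ∘ₗ appL f a) a m

/-- The map of total spaces induced by a morphism is linear over the polynomial ring. -/
noncomputable def totalMap {M N : ZnModule k n} (f : M ⟶ N) :
    M.Total →ₗ[AddMonoidAlgebra k (Fin n → ℕ)] N.Total where
  toFun := totalMapAux f
  map_add' := map_add _
  map_smul' r x := by
    rw [RingHom.id_apply]
    induction r using AddMonoidAlgebra.induction_linear with
    | zero => rw [zero_smul, zero_smul, map_zero]
    | add r s hr hs => rw [add_smul, add_smul, map_add, hr, hs]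
    | single v c =>
      induction x using total_induction with
      | h0 => rw [smul_zero, map_zero, smul_zero]
      | hadd x y hx hy => rw [smul_add, map_add, hx, hy, map_add, smul_add]
      | hincl a m =>
        have h := ZnPoset.le_add_ofNat a v
        rw [single_smul_incl_eq M v c rfl h, totalMapAux_incl, totalMapAux_incl,
          single_smul_incl_eq N v c rfl h, map_smul, appL_tr]

lemma totalMap_incl {M N : ZnModule k n} (f : M ⟶ N) (a : ZnPoset n) (m : M.obj a) :
    totalMap f (M.incl a m) = N.incl a (appL f a m) := totalMapAux_incl f a m

lemma comp_totalMap {M N : ZnModule k n} (f : M ⟶ N) (a : ZnPoset n) (x : M.Total) :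
    N.comp a (totalMap f x) = appL f a (M.comp a x) := by
  induction x using total_induction with
  | h0 => simp only [map_zero]
  | hadd x y hx hy => rw [map_add, map_add, map_add, map_add, hx, hy]
  | hincl b m =>
    rw [totalMap_incl]
    by_cases h : b = a
    · rw [comp_incl_of_eq _ h, comp_incl_of_eq _ h, appL_tr]
    · rw [comp_incl_of_ne _ h, comp_incl_of_ne _ h, map_zero]

lemma totalMap_injective {M N : ZnModule k n} (f : M ⟶ N) [Mono f] :
    Function.Injective (totalMap f) := fun x y h => total_ext fun a =>
  (mono_iff f).1 inferInstance a (by rw [← comp_totalMap, ← comp_totalMap, h])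

/-! ### Flatness and injectivity -/

/-- The bilinear form on total spaces given by a morphism to the dual. -/
noncomputable def totalForm {M F : ZnModule k n} (g : M ⟶ dual F) :
    M.Total →ₗ[k] F.Total →ₗ[k] k :=
  let := Classical.decEq (ZnPoset n)
  DirectSum.toModule k (ZnPoset n) (F.Total →ₗ[k] k) fun a =>
    LinearMap.lcomp k k (F.comp (-a)) ∘ₗ (appL g a : M.obj a →ₗ[k] Module.Dual k (F.obj (-a)))

lemma totalForm_incl {M F : ZnModule k n} (g : M ⟶ dual F) (a : ZnPoset n) (m : M.obj a)
    (x : F.Total) : totalForm g (M.incl a m) x = dualPair (appL g a m) (F.comp (-a) x) := by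
  let := Classical.decEq (ZnPoset n)
  exact LinearMap.congr_fun (DirectSum.toModule_lof k (φ := fun a =>
    LinearMap.lcomp k k (F.comp (-a)) ∘ₗ (appL g a : M.obj a →ₗ[k] Module.Dual k (F.obj (-a))))
    a m) x

/-- The form is balanced over the polynomial ring, so it descends to a functional on the tensor
product of the total spaces. This is half of the identification of maps `M ⟶ F*` with functionals on
`M ⊗ F`. -/
lemma totalForm_smul {M F : ZnModule k n} (g : M ⟶ dual F)
    (r : AddMonoidAlgebra k (Fin n → ℕ)) (x : M.Total) (y : F.Total) :
    totalForm g (r • x) y = totalForm g x (r • y) := by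
  induction r using AddMonoidAlgebra.induction_linear with
  | zero => rw [zero_smul, zero_smul, map_zero, map_zero, LinearMap.zero_apply]
  | add r s hr hs => rw [add_smul, add_smul, map_add, map_add, LinearMap.add_apply, hr, hs]
  | single v c =>
    induction x using total_induction with
    | h0 => rw [smul_zero, map_zero, LinearMap.zero_apply, LinearMap.zero_apply]
    | hadd x x' hx hx' =>
      rw [smul_add, map_add, map_add, LinearMap.add_apply, LinearMap.add_apply, hx, hx']
    | hincl a m =>
      induction y using total_induction with
      | h0 => rw [smul_zero, map_zero, map_zero]
      | hadd y y' hy hy' => rw [smul_add, map_add, map_add, hy, hy']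
      | hincl d z =>
        rw [single_smul_incl_eq M v c rfl (ZnPoset.le_add_ofNat a v),
          single_smul_incl_eq F v c rfl (ZnPoset.le_add_ofNat d v), totalForm_incl, totalForm_incl]
        by_cases h : d = -(a + ZnPoset.ofNat v)
        · have h' : d + ZnPoset.ofNat v = -a := by rw [h]; abel
          rw [comp_incl_of_eq F h, comp_incl_of_eq F h', map_smul, map_smul, map_smul]
          change c • dualPair (appL g _ (M.tr _ m)) _ = _
          rw [appL_tr, dualPair_tr, tr_tr, tr_tr]
        · have h' : d + ZnPoset.ofNat v ≠ -a := fun h' => h (by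
            rw [neg_add, ← h']; abel)
          rw [comp_incl_of_ne F h, comp_incl_of_ne F h', map_zero, map_zero]

/-- The Matlis dual of a flat module is injective. -/
lemma IsFlat.injective_dual {F : ZnModule k n} (hF : F.IsFlat) : Injective (dual F) where
  factors {A B} g f _ := by
    have : Module.Flat (AddMonoidAlgebra k (Fin n → ℕ)) F.Total := hF
    let form : A.Total →+ F.Total →+ k :=
      { toFun x := (totalForm g x).toAddMonoidHom
        map_zero' := by ext; simp
        map_add' x y := by ext; simp }
    let ℓ₀ : A.Total ⊗[AddMonoidAlgebra k (Fin n → ℕ)] F.Total →+ k :=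
      TensorProduct.liftAddHom form fun r x y => totalForm_smul g r x y
    have hℓ₀ : ∀ x y, ℓ₀ (x ⊗ₜ y) = totalForm g x y := fun x y => TensorProduct.liftAddHom_tmul ..
    let ℓ : A.Total ⊗[AddMonoidAlgebra k (Fin n → ℕ)] F.Total →ₗ[k] k :=
      { ℓ₀ with
        map_smul' c t := by
          change ℓ₀ (c • t) = c • ℓ₀ t
          induction t with
          | zero => rw [smul_zero, map_zero, smul_zero]
          | add s t hs ht => rw [smul_add, map_add, hs, ht, map_add, smul_add]
          | tmul x y =>
            rw [TensorProduct.smul_tmul', hℓ₀, hℓ₀, map_smul, LinearMap.smul_apply] }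
    have hℓ : ∀ x y, ℓ (x ⊗ₜ y) = totalForm g x y := hℓ₀
    let j := ((totalMap f).rTensor F.Total).restrictScalars k
    have hj : ∀ x y, j (x ⊗ₜ y) = totalMap f x ⊗ₜ y := fun x y => LinearMap.rTensor_tmul ..
    have hinj : Function.Injective j :=
      Module.Flat.rTensor_preserves_injective_linearMap _ (totalMap_injective f)
    -- Flatness of `F` made `j` injective. A retraction of vector spaces is enough, with no grading:
    -- only values on tensors of opposite degrees are used below.
    obtain ⟨r, hr⟩ := j.exists_leftInverse_of_injective (LinearMap.ker_eq_bot.2 hinj)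
    let ψ : ∀ b, B.obj b →ₗ[k] Module.Dual k (F.obj (-b)) := fun b =>
      LinearMap.mk₂ k (fun y z => ℓ (r (B.incl b y ⊗ₜ F.incl (-b) z)))
        (fun y y' z => by rw [map_add, TensorProduct.add_tmul, map_add, map_add])
        (fun c y z => by rw [map_smul, ← TensorProduct.smul_tmul', map_smul, map_smul])
        (fun y z z' => by rw [map_add, TensorProduct.tmul_add, map_add, map_add])
        (fun c y z => by rw [map_smul, TensorProduct.tmul_smul, map_smul, map_smul])
    have hψ : ∀ b y z, ψ b y z = ℓ (r (B.incl b y ⊗ₜ F.incl (-b) z)) := fun b y z => rfl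
    refine ⟨homOfMaps ψ fun {a b} h y => LinearMap.ext fun z => ?_, hom_ext_appL fun b x =>
      dual_ext fun z => ?_⟩
    · change ψ b (B.tr h y) z = ψ a y (F.tr (neg_le_neg_zn h) z)
      obtain ⟨v, hv⟩ := exists_ofNat h
      have h1 := single_smul_incl_eq B v 1 hv h y
      have h2 := single_smul_incl_eq F v 1 (show -a = -b + ZnPoset.ofNat v by rw [hv]; abel)
        (neg_le_neg_zn h) z
      rw [one_smul] at h1 h2
      -- Moving the monomial `x^v` across the tensor sign is exactly compatibility with the
      -- structure maps.
      rw [hψ, hψ, ← h1, ← h2, TensorProduct.smul_tmul]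
    · change ψ b (appL f b x) z = _
      rw [hψ, ← totalMap_incl, ← hj]
      have := LinearMap.congr_fun hr (A.incl b x ⊗ₜ F.incl (-b) z)
      rw [LinearMap.comp_apply, LinearMap.id_apply] at this
      rw [this, hℓ, totalForm_incl, comp_incl_of_eq F rfl, tr_self]

/-- A module generated by a compatible family of elements over a codirected upper set is flat. -/
lemma isFlat_of_generators (M : ZnModule k n) (U : Set (ZnPoset n)) (hne : U.Nonempty)
    (hup : ∀ a ∈ U, ∀ b, a ≤ b → b ∈ U) (hdir : ∀ a ∈ U, ∀ b ∈ U, ∃ c ∈ U, c ≤ a ∧ c ≤ b)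
    (u : ∀ a, M.obj a) (hu : ∀ a ∈ U, ∀ b, ∀ h : a ≤ b, M.tr h (u a) = u b)
    (hu0 : ∀ a ∈ U, u a ≠ 0) (hgen : ∀ a ∈ U, ∀ x : M.obj a, ∃ r : k, x = r • u a)
    (hzero : ∀ a ∉ U, ∀ x : M.obj a, x = 0) : M.IsFlat := by
  classical
  -- Distinct monomials send `u a` to distinct degrees, so the coefficients of `r` can be read off
  -- from `r • u a`. Hence each generator spans a free module of rank one.
  have hcoef : ∀ a ∈ U, ∀ (r : AddMonoidAlgebra k (Fin n → ℕ)) (v : Fin n → ℕ),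
      M.comp (a + ZnPoset.ofNat v) (r • M.incl a (u a)) =
        r.coeff v • u (a + ZnPoset.ofNat v) := by
    intro a ha r v
    induction r using AddMonoidAlgebra.induction_linear with
    | zero => rw [zero_smul, map_zero]; exact (zero_smul k _).symm
    | add r s hr hs => rw [add_smul, map_add, hr, hs]; exact (add_smul _ _ _).symm
    | single w c =>
      rw [single_smul_incl_eq M w c rfl (ZnPoset.le_add_ofNat a w)]
      by_cases h : w = v
      · subst h
        rw [comp_incl_of_eq M rfl, tr_self, hu a ha]
        simp
      · rw [comp_incl_of_ne]
        · simp [Finsupp.single_eq_of_ne' h]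
        · intro heq
          refine h (funext fun i => ?_)
          have h1 : ZnPoset.ofNat w = ZnPoset.ofNat v := add_left_cancel heq
          exact Int.ofNat_inj.1 (congrFun h1 i)
  have hfaith : ∀ a ∈ U, ∀ r : AddMonoidAlgebra k (Fin n → ℕ), r • M.incl a (u a) = 0 → r = 0 := by
    intro a ha r hr
    have : ∀ v, r.coeff v = 0 := fun v => by
      have h1 := hcoef a ha r v
      rw [hr, map_zero, eq_comm, smul_eq_zero] at h1
      exact h1.resolve_right (hu0 _ (hup a ha _ (ZnPoset.le_add_ofNat a v)))
    ext v
    exact this v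
  have hmono : ∀ a ∈ U, ∀ b, a ≤ b → ∃ r : AddMonoidAlgebra k (Fin n → ℕ),
      M.incl b (u b) = r • M.incl a (u a) := by
    intro a ha b hab
    obtain ⟨v, hv⟩ := exists_ofNat hab
    exact ⟨AddMonoidAlgebra.single v 1, by
      rw [single_smul_incl_eq M v 1 hv hab, one_smul, hu a ha]⟩
  have hone : ∀ x : M.Total, ∃ a ∈ U, ∃ r : AddMonoidAlgebra k (Fin n → ℕ),
      x = r • M.incl a (u a) := by
    intro x
    induction x using total_induction with
    | h0 =>
      obtain ⟨a, ha⟩ := hne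
      exact ⟨a, ha, 0, (zero_smul _ _).symm⟩
    | hincl a m =>
      by_cases ha : a ∈ U
      · obtain ⟨c, rfl⟩ := hgen a ha m
        exact ⟨a, ha, algebraMap k _ c, by rw [algebraMap_smul, map_smul]⟩
      · obtain ⟨b, hb⟩ := hne
        exact ⟨b, hb, 0, by rw [zero_smul, hzero a ha m, map_zero]⟩
    | hadd x y hx hy =>
      obtain ⟨a, ha, r, rfl⟩ := hx
      obtain ⟨b, hb, s, rfl⟩ := hy
      obtain ⟨c, hc, hca, hcb⟩ := hdir a ha b hb
      obtain ⟨r', hr'⟩ := hmono c hc a hca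
      obtain ⟨s', hs'⟩ := hmono c hc b hcb
      exact ⟨c, hc, r * r' + s * s', by rw [add_smul, mul_smul, mul_smul, ← hr', ← hs']⟩
  -- Codirectedness of `U` puts any finite set of elements in the span of a single generator.
  have hfin : ∀ (l : ℕ) (x : Fin l → M.Total), ∃ a ∈ U,
      ∀ i, ∃ r : AddMonoidAlgebra k (Fin n → ℕ), x i = r • M.incl a (u a) := by
    intro l
    induction l with
    | zero =>
      obtain ⟨a, ha⟩ := hne
      exact fun _ => ⟨a, ha, fun i => i.elim0⟩
    | succ l ih =>
      intro x
      obtain ⟨a, ha, r, hr⟩ := hone (x 0)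
      obtain ⟨b, hb, hx⟩ := ih fun i => x i.succ
      obtain ⟨c, hc, hca, hcb⟩ := hdir a ha b hb
      obtain ⟨r', hr'⟩ := hmono c hc a hca
      obtain ⟨s', hs'⟩ := hmono c hc b hcb
      refine ⟨c, hc, fun i => Fin.cases ⟨r * r', by rw [mul_smul, ← hr', hr]⟩ (fun i => ?_) i⟩
      obtain ⟨s, hs⟩ := hx i
      exact ⟨s * s', by rw [mul_smul, ← hs', hs]⟩
  -- Equational criterion: a relation among elements `r i • u a` is already a relation among the
  -- coefficients `r i`, because `u a` has no annihilator. One generator therefore trivialises it.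
  refine Module.Flat.iff_forall_isTrivialRelation.2 fun {l f x} hrel => ?_
  obtain ⟨a, ha, hx⟩ := hfin l x
  choose r hr using hx
  refine ⟨1, fun i _ => r i, fun _ => M.incl a (u a), fun i => by simpa using hr i, fun _ => ?_⟩
  refine hfaith a ha _ ?_
  rw [Finset.sum_smul, ← hrel]
  exact Finset.sum_congr rfl fun i _ => by rw [mul_smul, ← hr i]

/-- The Matlis dual of `k[a + ℤτ - ℕⁿ]` is flat. -/
lemma isFlat_dual_cofree (τ : Finset (Fin n)) (a : ZnPoset n) : (dual (cofree k τ a)).IsFlat := by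
  -- The generators are the coordinate functionals; in each degree of the negated quadrant they span
  -- a one-dimensional dual, and joins in the quadrant become common lower bounds.
  refine isFlat_of_generators _ {b | -b ∈ quadrant τ a} ⟨-a, ?_⟩ ?_ ?_
    (fun b => indVal (quadrant τ a) ⊥ k (-b)) ?_ ?_ ?_ ?_
  · change - -a ∈ quadrant τ a
    rw [neg_neg]
    exact self_mem_quadrant τ a
  · exact fun b hb c hbc => (quadrant τ a).lower' (neg_le_neg_zn hbc) hb
  · intro b hb c hc
    refine ⟨-((-b).sup (-c)), ?_, ?_, ?_⟩
    · change - -((-b).sup (-c)) ∈ quadrant τ a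
      rw [neg_neg]
      exact sup_mem_quadrant hb hc
    · exact (neg_le_neg_zn (ZnPoset.le_sup_left (-b) (-c))).trans (neg_neg b).le
    · exact (neg_le_neg_zn (ZnPoset.le_sup_right (-b) (-c))).trans (neg_neg c).le
  · exact fun b hb c h => LinearMap.ext fun x => indVal_tr (neg_le_neg_zn h) hb x
  · intro b hb h0
    obtain ⟨x, hx⟩ := (indVal_bijective (k := k) (V := k) (show -b ∈ quadrant τ a from hb)).2 1
    have := LinearMap.congr_fun h0 x
    exact one_ne_zero (hx.symm.trans this)
  · intro b hb (ξ : Module.Dual k ((cofree k τ a).obj (-b)))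
    obtain ⟨e, he⟩ : ∃ e : (cofree k τ a).obj (-b) ≃ₗ[k] k,
        ∀ x, e x = indVal (quadrant τ a) ⊥ k (-b) x :=
      ⟨LinearEquiv.ofBijective _ (indVal_bijective (k := k) (V := k)
        (show -b ∈ quadrant τ a from hb)), fun x => rfl⟩
    refine ⟨ξ (e.symm 1), LinearMap.ext fun x => ?_⟩
    change ξ x = ξ (e.symm 1) * indVal (quadrant τ a) ⊥ k (-b) x
    rw [← he, mul_comm, ← smul_eq_mul, ← map_smul, ← map_smul, smul_eq_mul, mul_one,
      LinearEquiv.symm_apply_apply]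
  · intro b hb (ξ : Module.Dual k ((cofree k τ a).obj (-b)))
    refine LinearMap.ext fun x => ?_
    have : x = 0 := indVal_injective (-b) (by
      rw [map_zero]
      exact indVal_eq_zero (fun h => hb h.1) x)
    exact (congrArg ξ this).trans (map_zero ξ)

/-- A direct summand of a finite direct sum of flat modules is flat. -/
lemma isFlat_of_sum_eq_id {ι : Type} [Fintype ι] {M : ZnModule k n} (X : ι → ZnModule k n)
    (hX : ∀ i, (X i).IsFlat) (p : ∀ i, M ⟶ X i) (j : ∀ i, X i ⟶ M)
    (h : ∑ i, p i ≫ j i = 𝟙 M) : M.IsFlat := by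
  classical
  have : ∀ i, Module.Flat (AddMonoidAlgebra k (Fin n → ℕ)) (X i).Total := hX
  refine Module.Flat.of_retract (M := DirectSum ι fun i => (X i).Total)
    (∑ i, DirectSum.lof _ ι (fun i => (X i).Total) i ∘ₗ totalMap (p i))
    (DirectSum.toModule _ ι M.Total fun i => totalMap (j i)) (LinearMap.ext fun x => ?_)
  rw [LinearMap.comp_apply, LinearMap.sum_apply, map_sum]
  simp only [LinearMap.comp_apply, DirectSum.toModule_lof, LinearMap.id_apply]
  induction x using total_induction with
  | h0 => simp
  | hadd x y hx hy => simp only [map_add, Finset.sum_add_distrib, hx, hy]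
  | hincl a m =>
    simp only [totalMap_incl, ← map_sum]
    congr 1
    have := congrArg (fun f => appL f a m) h
    simpa only [appL_sum, appL_comp, appL_id] using this

/-! ### Finite flat modules -/

/-- Each summand is isomorphic to some `k[a + ℤτ - ℕⁿ]`, whose dual is flat. Dualising the
resolution of the identity by inclusions and projections exhibits the dual of `E` as a retract of a
sum of flat modules. -/
lemma IsFiniteInjective.dual {E : ZnModule k n} {r : ℕ} (hE : E.IsFiniteInjective r) :
    (ZnModule.dual E).IsFiniteFlat r := by
  have hfin := hE.isFinitelyDetermined_and_hasBotRank.1.1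
  refine ⟨?_, hfin.dual, hE.2.dual hfin⟩
  obtain ⟨hinj, X, hX, ⟨e⟩⟩ := hE
  have hiX : ∀ i, Injective (X i) := fun i =>
    injective_of_retract (biproduct.ι X i ≫ e.inv) (e.hom ≫ biproduct.π X i) (by simp)
  refine isFlat_of_sum_eq_id (fun i => ZnModule.dual (X i)) (fun i => ?_)
    (fun i => dualMap (biproduct.ι X i ≫ e.inv)) (fun i => dualMap (e.hom ≫ biproduct.π X i)) ?_
  · obtain ⟨τ, a, ⟨f⟩⟩ := (hX i).exists_iso_cofree
    refine isFlat_of_sum_eq_id (ι := Unit) (fun _ => ZnModule.dual (cofree k τ a))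
      (fun _ => isFlat_dual_cofree τ a) (fun _ => dualMap f.inv) (fun _ => dualMap f.hom) ?_
    simp [← dualMap_comp]
  · simp only [← dualMap_comp]
    rw [← dualMap_sum, ← dualMap_id]
    congr 1
    have : ∑ i, (e.hom ≫ biproduct.π X i) ≫ biproduct.ι X i ≫ e.inv =
        e.hom ≫ (∑ i, biproduct.π X i ≫ biproduct.ι X i) ≫ e.inv := by
      simp only [Preadditive.comp_sum, Preadditive.sum_comp, Category.assoc]
    rw [this, biproduct.total, Category.id_comp, e.hom_inv_id]

lemma IsFiniteFlat.dual {F : ZnModule k n} {r : ℕ} (hF : F.IsFiniteFlat r) :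
    (ZnModule.dual F).IsFiniteInjective r :=
  ⟨hF.1.injective_dual, hF.2.2.dual hF.2.1⟩

/-- Flat modules need no separate classification: the dual is finite injective, hence finitely
determined, and `F` is its own bidual. -/
lemma IsFiniteFlat.isFinitelyDetermined {F : ZnModule k n} {r : ℕ} (hF : F.IsFiniteFlat r) :
    F.IsFinitelyDetermined :=
  hF.dual.isFinitelyDetermined_and_hasBotRank.1.dual.of_iso hF.2.1.bidualIso.symm

/-! ### Minimal flat covers -/

/-- Finite flat modules are projective relative to `ℤⁿ`-finite modules. -/
lemma IsFiniteFlat.exists_lift {F A B : ZnModule k n} {r : ℕ} (hF : F.IsFiniteFlat r)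
    (hA : A.IsZnFinite) (p : A ⟶ B) [Epi p] (g : F ⟶ B) : ∃ h : F ⟶ A, h ≫ p = g := by
  have := hF.1.injective_dual
  have := mono_dualMap p
  have := hA.isIso_toBidual
  have := (hA.of_epi p).isIso_toBidual
  -- Extend the dual problem into the injective module `F*`, dualise, and return through the bidual
  -- isomorphisms of `A` and `B`.
  refine ⟨toBidual F ≫ dualMap (Injective.factorThru (dualMap g) (dualMap p)) ≫
    inv (toBidual A), ?_⟩
  have h1 : inv (toBidual A) ≫ p = dualMap (dualMap p) ≫ inv (toBidual B) := by
    rw [IsIso.inv_comp_eq, ← Category.assoc, ← toBidual_naturality, Category.assoc,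
      IsIso.hom_inv_id, Category.comp_id]
  rw [Category.assoc, Category.assoc, h1, ← Category.assoc (dualMap _), ← dualMap_comp,
    Injective.comp_factorThru, ← Category.assoc, ← toBidual_naturality, Category.assoc,
    IsIso.hom_inv_id, Category.comp_id]

lemma IsMinimalFlatCover.isFinitelyDetermined {F N : ZnModule k n} {f : F ⟶ N}
    (hf : IsMinimalFlatCover f) : F.IsFinitelyDetermined := by
  obtain ⟨-, r, hF, -⟩ := hf
  exact hF.isFinitelyDetermined

lemma IsMinimalFlatCover.isZnFinite {F N : ZnModule k n} {f : F ⟶ N}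
    (hf : IsMinimalFlatCover f) : N.IsZnFinite := by
  have := hf.1
  exact hf.isFinitelyDetermined.1.of_epi f

lemma IsMinimalFlatCover.exists_lift {F N F' N' : ZnModule k n} {f : F ⟶ N} {f' : F' ⟶ N'}
    (hf : IsMinimalFlatCover f) (hf' : IsMinimalFlatCover f') (g : F ⟶ N') :
    ∃ h : F ⟶ F', h ≫ f' = g := by
  have := hf'.1
  obtain ⟨-, r, hF, -⟩ := hf
  exact hF.exists_lift hf'.isFinitelyDetermined.1 f' g

/-- The dual of a minimal flat cover is a minimal injective hull. -/
lemma IsMinimalFlatCover.dual {F N : ZnModule k n} {f : F ⟶ N} (hf : IsMinimalFlatCover f) :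
    IsMinimalInjectiveHull (dualMap f) := by
  have hN := hf.isZnFinite
  have := hN.isIso_toBidual
  obtain ⟨hepi, r, hF, hmin⟩ := hf
  refine ⟨mono_dualMap f, r, hF.dual, fun E' f' r' hf' hE' => ?_⟩
  have := epi_dualMap f'
  -- A competing hull of `N*` dualises to a competing cover of `N** ≅ N` with the same number of
  -- summands.
  exact hmin _ (dualMap f' ≫ inv (toBidual N)) r' inferInstance hE'.dual

lemma IsFinitelyDetermined.exists_isMinimalFlatCover {N : ZnModule k n}
    (h : N.IsFinitelyDetermined) : ∃ (F : ZnModule k n) (f : F ⟶ N), IsMinimalFlatCover f := by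
  classical
  have hex : ∃ (r : ℕ) (F : ZnModule k n) (f : F ⟶ N), Epi f ∧ F.IsFiniteFlat r := by
    obtain ⟨E, f, r, hf, hE⟩ := h.dual.exists_mono
    have := h.1.isIso_toBidual
    have := epi_dualMap f
    exact ⟨r, _, dualMap f ≫ inv (toBidual N), inferInstance, hE.dual⟩
  obtain ⟨F, f, hf, hF⟩ := Nat.find_spec hex
  exact ⟨F, f, hf, _, hF, fun F' f' r' hf' hF' => Nat.find_min' hex ⟨F', f', hf', hF'⟩⟩

/-- A morphism between minimal flat covers of `N` over `N` is an isomorphism. -/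
lemma IsMinimalFlatCover.isIso {F F' N : ZnModule k n} {f : F ⟶ N} {f' : F' ⟶ N}
    (hf : IsMinimalFlatCover f) (hf' : IsMinimalFlatCover f') (g : F ⟶ F') (hg : g ≫ f' = f) :
    IsIso g :=
  isIso_of_isIso_dualMap g (hf'.dual.isIso hf.dual (dualMap g) (by rw [← dualMap_comp, hg]))

lemma IsMinimalFlatCover.comp_iso {F M N : ZnModule k n} {f : F ⟶ M}
    (hf : IsMinimalFlatCover f) (e : M ⟶ N) [IsIso e] : IsMinimalFlatCover (f ≫ e) := by
  obtain ⟨h, r, hr, hmin⟩ := hf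
  exact ⟨inferInstance, r, hr, fun F' f' r' hf' hF' =>
    hmin F' (f' ≫ inv e) r' inferInstance hF'⟩

/-! ### Covers of kernels and hulls of cokernels -/

/-- In a spliced complex the differential is `f = a ≫ m` with `m` mono, so it has the same kernel as
`a`. This moves minimality from the syzygy used in the construction to the kernel named in the
definition. -/
lemma isMinimalFlatCover_kernel_lift {X Y Z K : ZnModule k n} (f : Y ⟶ Z) (g : X ⟶ Y)
    (w : g ≫ f = 0) (a : Y ⟶ K) (m : K ⟶ Z) [Mono m] (hf : f = a ≫ m) {q : X ⟶ kernel a}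
    (hq : IsMinimalFlatCover q) (hg : g = q ≫ kernel.ι a) :
    IsMinimalFlatCover (kernel.lift f g w) := by
  subst hf
  have h : kernel.lift (a ≫ m) g w = q ≫ (kernelCompMono a m).inv := by
    rw [← cancel_mono (kernel.ι _), kernel.lift_ι, hg]
    simp
  rw [h]
  exact hq.comp_iso _

lemma isMinimalInjectiveHull_cokernel_desc {X Y Z K : ZnModule k n} (f : X ⟶ Y) (g : Y ⟶ Z)
    (w : f ≫ g = 0) (a : K ⟶ Y) (p : X ⟶ K) [Epi p] (hf : f = p ≫ a) {q : cokernel a ⟶ Z}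
    (hq : IsMinimalInjectiveHull q) (hg : g = cokernel.π a ≫ q) :
    IsMinimalInjectiveHull (cokernel.desc f g w) := by
  subst hf
  have h : cokernel.desc (p ≫ a) g w = (cokernelEpiComp p a).hom ≫ q := by
    rw [← cancel_epi (cokernel.π _), cokernel.π_desc, hg]
    simp
  rw [h]
  exact hq.iso_comp _

/-- Isomorphisms on two consecutive terms identify the kernels, so `u` compares two minimal covers
of one module. This is the inductive step of uniqueness. -/
lemma isIso_of_isMinimalFlatCover_kernel_lift {X Y Z X' Y' Z' : ZnModule k n} {f : Y ⟶ Z}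
    {g : X ⟶ Y} {w : g ≫ f = 0} {f' : Y' ⟶ Z'} {g' : X' ⟶ Y'} {w' : g' ≫ f' = 0}
    (h : IsMinimalFlatCover (kernel.lift f g w)) (h' : IsMinimalFlatCover (kernel.lift f' g' w'))
    (u : X ⟶ X') (v : Y ⟶ Y') (t : Z ⟶ Z') [IsIso v] [IsIso t] (hu : g ≫ v = u ≫ g')
    (hv : f ≫ t = v ≫ f') : IsIso u := by
  refine (h.comp_iso (kernel.mapIso f f' (asIso v) (asIso t) hv).hom).isIso h' u ?_
  rw [← cancel_mono (kernel.ι f'), Category.assoc, kernel.lift_ι, ← hu, Category.assoc]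
  have := kernel.lift_ι f' (kernel.ι f ≫ v) (by rw [Category.assoc, ← hv, kernel.condition_assoc,
    zero_comp])
  exact (kernel.lift_ι_assoc f g w v).symm.trans (congrArg (kernel.lift f g w ≫ ·) this.symm)

lemma isIso_of_isMinimalInjectiveHull_cokernel_desc {X Y Z X' Y' Z' : ZnModule k n} {f : X ⟶ Y}
    {g : Y ⟶ Z} {w : f ≫ g = 0} {f' : X' ⟶ Y'} {g' : Y' ⟶ Z'} {w' : f' ≫ g' = 0}
    (h : IsMinimalInjectiveHull (cokernel.desc f g w))
    (h' : IsMinimalInjectiveHull (cokernel.desc f' g' w'))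
    (u : X ⟶ X') (v : Y ⟶ Y') (t : Z ⟶ Z') [IsIso u] [IsIso v] (hu : f ≫ v = u ≫ f')
    (hv : g ≫ t = v ≫ g') : IsIso t := by
  refine h.isIso (h'.iso_comp (cokernel.mapIso f f' (asIso u) (asIso v) hu).hom) t ?_
  rw [← cancel_epi (cokernel.π f), cokernel.π_desc_assoc, hv]
  have := cokernel.π_desc f (v ≫ cokernel.π f') (by rw [← Category.assoc, hu, Category.assoc,
    cokernel.condition, comp_zero])
  refine Eq.trans ?_ (congrArg (· ≫ cokernel.desc f' g' w') this.symm |>.trans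
    (Category.assoc _ _ _))
  rw [Category.assoc, cokernel.π_desc]

/-- The inductive step in building a chain map: `g ≫ v` lands in the kernel of `f'`, and finite flat
modules lift through its cover. -/
lemma exists_lift_of_isMinimalFlatCover_kernel_lift {X Y Z X' Y' Z' : ZnModule k n} {f : Y ⟶ Z}
    {g : X ⟶ Y} {w : g ≫ f = 0} {f' : Y' ⟶ Z'} {g' : X' ⟶ Y'} {w' : g' ≫ f' = 0}
    (h : IsMinimalFlatCover (kernel.lift f g w)) (h' : IsMinimalFlatCover (kernel.lift f' g' w'))
    (v : Y ⟶ Y') (t : Z ⟶ Z') (hv : f ≫ t = v ≫ f') : ∃ u : X ⟶ X', u ≫ g' = g ≫ v := by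
  obtain ⟨u, hu⟩ := h.exists_lift h' (kernel.lift f' (g ≫ v) (by
    rw [Category.assoc, ← hv, ← Category.assoc, w, zero_comp]))
  refine ⟨u, ?_⟩
  have := congrArg (· ≫ kernel.ι f') hu
  simpa using this

/-! ### Flange presentations -/

namespace FlangePresentation

variable {N : ZnModule k n}

lemma toN_fromN (P : FlangePresentation N) : P.toN ≫ P.fromN = P.φ := by
  simp [toN, fromN]

lemma epi_toN (P : FlangePresentation N) : Epi P.toN := by
  unfold toN; infer_instance

lemma mono_fromN (P : FlangePresentation N) : Mono P.fromN := by
  unfold fromN; infer_instance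

/-- The flange presentation composed of a surjection and an injection. -/
noncomputable def ofEpiMono {F E : ZnModule k n} (f : F ⟶ N) (g : N ⟶ E) [Epi f] [Mono g]
    (hF : F.IsFlat) (hE : Injective E) : FlangePresentation N where
  F := F
  E := E
  φ := f ≫ g
  flat := hF
  injective := hE
  iso := have := strongEpi_of_epi f; (image.isoStrongEpiMono f g rfl).symm

lemma IsFinite.isFinitelyDetermined {P : FlangePresentation N} (h : P.IsFinite) :
    N.IsFinitelyDetermined := by
  obtain ⟨⟨r, hr⟩, s, hs⟩ := h
  have := P.epi_toN
  have := P.mono_fromN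
  exact hr.isFinitelyDetermined.of_epi_of_mono hs.isFinitelyDetermined_and_hasBotRank.1 P.toN
    P.fromN

lemma IsMinimal.isFinite {P : FlangePresentation N} (h : P.IsMinimal) : P.IsFinite := by
  obtain ⟨r, s, hr, hs, -⟩ := h
  exact ⟨⟨r, hr⟩, s, hs⟩

/-- Replacing only the surjection and keeping the injection of `P` gives another flange
presentation, so the joint minimality implies minimality on each side. -/
lemma IsMinimal.isMinimalFlatCover {P : FlangePresentation N} (h : P.IsMinimal) :
    IsMinimalFlatCover P.toN := by
  obtain ⟨r, s, hr, hs, hmin⟩ := h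
  have := P.mono_fromN
  exact ⟨P.epi_toN, r, hr, fun F' f' r' hf' hF' =>
    (hmin (ofEpiMono f' P.fromN hF'.1 P.injective) r' s hF' hs).1⟩

lemma IsMinimal.isMinimalInjectiveHull {P : FlangePresentation N} (h : P.IsMinimal) :
    IsMinimalInjectiveHull P.fromN := by
  obtain ⟨r, s, hr, hs, hmin⟩ := h
  have := P.epi_toN
  exact ⟨P.mono_fromN, s, hs, fun E' f' s' hf' hE' =>
    (hmin (ofEpiMono P.toN f' P.flat hE'.1) r s' hr hE').2⟩

/-- Any cover composes with any hull, so the two counts can be minimised independently and both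
minima are attained at once. -/
lemma exists_isMinimal (h : N.IsFinitelyDetermined) :
    ∃ P : FlangePresentation N, P.IsMinimal := by
  obtain ⟨F, f, hf, r, hF, hfmin⟩ := h.exists_isMinimalFlatCover
  obtain ⟨E, g, hg, s, hE, hgmin⟩ := h.exists_isMinimalInjectiveHull
  exact ⟨ofEpiMono f g hF.1 hE.1, r, s, hF, hE, fun P r' s' hr' hs' =>
    ⟨hfmin P.F P.toN r' P.epi_toN hr', hgmin P.E P.fromN s' P.mono_fromN hs'⟩⟩

lemma IsMinimal.isomorphic {P P' : FlangePresentation N} (h : P.IsMinimal) (h' : P'.IsMinimal) :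
    P.Isomorphic P' := by
  obtain ⟨f, hf⟩ := h.isMinimalFlatCover.exists_lift h'.isMinimalFlatCover P.toN
  have := P.mono_fromN
  have := P'.injective
  have he : P.fromN ≫ Injective.factorThru P'.fromN P.fromN = P'.fromN :=
    Injective.comp_factorThru _ _
  have := h.isMinimalFlatCover.isIso h'.isMinimalFlatCover f hf
  have := h.isMinimalInjectiveHull.isIso h'.isMinimalInjectiveHull _ he
  refine ⟨asIso f, asIso (Injective.factorThru P'.fromN P.fromN), ?_, hf, he⟩
  rw [asIso_hom, asIso_hom, ← P.toN_fromN, ← P'.toN_fromN, Category.assoc, he, ← Category.assoc, hf]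

end FlangePresentation

/-! ### Flat presentations and injective copresentations -/

lemma isIso_cokernel_desc {X Y Z : ZnModule k n} (f : X ⟶ Y) (g : Y ⟶ Z) (w : f ≫ g = 0) [Epi g]
    (h : (ShortComplex.mk f g w).Exact) : IsIso (cokernel.desc f g w) := by
  have hc : IsColimit (CokernelCofork.ofπ g w) := h.gIsCokernel
  let e := (cokernelIsCokernel f).coconePointUniqueUpToIso hc
  have he : cokernel.desc f g w = e.hom := by
    rw [← cancel_epi (cokernel.π f), cokernel.π_desc]
    exact ((cokernelIsCokernel f).comp_coconePointUniqueUpToIso_hom hc WalkingParallelPair.one).symm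
  rw [he]
  infer_instance

lemma isIso_kernel_lift {X Y Z : ZnModule k n} (f : X ⟶ Y) (g : Y ⟶ Z) (w : f ≫ g = 0) [Mono f]
    (h : (ShortComplex.mk f g w).Exact) : IsIso (kernel.lift g f w) := by
  have hc : IsLimit (KernelFork.ofι f w) := h.fIsKernel
  let e := hc.conePointUniqueUpToIso (kernelIsKernel g)
  have he : kernel.lift g f w = e.hom := by
    rw [← cancel_mono (kernel.ι g), kernel.lift_ι]
    exact (hc.conePointUniqueUpToIso_hom_comp (kernelIsKernel g) WalkingParallelPair.zero).symm
  rw [he]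
  infer_instance

lemma exact_comp_kernel_ι {X Y Z : ZnModule k n} (q : Y ⟶ Z) (p : X ⟶ kernel q) [Epi p] :
    (ShortComplex.mk (p ≫ kernel.ι q) q (by simp)).Exact := by
  rw [shortComplex_exact_iff]
  intro b (x : Y.obj b) hx
  obtain ⟨y, rfl⟩ := exists_kernel_ι_eq q b x hx
  obtain ⟨z, rfl⟩ := (epi_iff p).1 inferInstance b y
  exact ⟨z, rfl⟩

lemma exact_cokernel_π_comp {X Y Z : ZnModule k n} (i : X ⟶ Y) (j : cokernel i ⟶ Z) [Mono j] :
    (ShortComplex.mk i (cokernel.π i ≫ j) (by simp)).Exact := by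
  rw [shortComplex_exact_iff]
  intro b (x : Y.obj b) hx
  exact exists_of_cokernel_π_eq_zero i b x ((injective_iff_map_eq_zero _).1
    ((mono_iff j).1 inferInstance b) _ hx)

namespace FlatPresentation

variable {N : ZnModule k n}

lemma IsFinite.isFinitelyDetermined {P : FlatPresentation N} (h : P.IsFinite) :
    N.IsFinitelyDetermined := by
  obtain ⟨⟨r, hr⟩, s, hs⟩ := h
  exact (IsFinitelyDetermined.cokernel P.d hr.isFinitelyDetermined
    hs.isFinitelyDetermined).of_iso P.iso

lemma _root_.ZnModule.IsMinimalFlatCover.exists_isFiniteFlat {F N : ZnModule k n} {f : F ⟶ N}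
    (h : IsMinimalFlatCover f) : ∃ r, F.IsFiniteFlat r := by
  obtain ⟨-, r, hr, -⟩ := h
  exact ⟨r, hr⟩

lemma IsMinimal.isFinite {P : FlatPresentation N} (h : P.IsMinimal) : P.IsFinite :=
  ⟨h.2.exists_isFiniteFlat, h.1.exists_isFiniteFlat⟩

lemma exists_isMinimal (h : N.IsFinitelyDetermined) :
    ∃ P : FlatPresentation N, P.IsMinimal := by
  obtain ⟨F₀, q₀, h₀⟩ := h.exists_isMinimalFlatCover
  obtain ⟨F₁, q₁, h₁⟩ := (h₀.isFinitelyDetermined.kernel q₀ h).exists_isMinimalFlatCover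
  have := h₀.1
  have := h₁.1
  have w : (q₁ ≫ kernel.ι q₀) ≫ q₀ = 0 := by simp
  have := isIso_cokernel_desc _ _ w (exact_comp_kernel_ι q₀ q₁)
  obtain ⟨r₀, hr₀⟩ := h₀.exists_isFiniteFlat
  obtain ⟨r₁, hr₁⟩ := h₁.exists_isFiniteFlat
  let P : FlatPresentation N :=
    { F₁ := F₁
      F₀ := F₀
      d := q₁ ≫ kernel.ι q₀
      flat₁ := hr₁.1
      flat₀ := hr₀.1
      iso := asIso (cokernel.desc (q₁ ≫ kernel.ι q₀) q₀ w) }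
  have hπ : P.π = q₀ := cokernel.π_desc _ _ _
  refine ⟨P, ?_, ?_⟩
  · rw [hπ]
    exact h₀
  · exact isMinimalFlatCover_kernel_lift P.π P.d P.d_π q₀ (𝟙 N)
      (hπ.trans (Category.comp_id _).symm) h₁ rfl

lemma IsMinimal.isomorphic {P P' : FlatPresentation N} (h : P.IsMinimal) (h' : P'.IsMinimal) :
    P.Isomorphic P' := by
  obtain ⟨f₀, hf₀⟩ := h.1.exists_lift h'.1 P.π
  have := h.1.isIso h'.1 f₀ hf₀
  obtain ⟨f₁, hf₁⟩ := exists_lift_of_isMinimalFlatCover_kernel_lift h.2 h'.2 f₀ (𝟙 N) (by simp [hf₀])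
  have := isIso_of_isMinimalFlatCover_kernel_lift h.2 h'.2 f₁ f₀ (𝟙 N) hf₁.symm (by simp [hf₀])
  exact ⟨asIso f₁, asIso f₀, hf₁.symm, hf₀⟩

end FlatPresentation

namespace InjectiveCopresentation

variable {N : ZnModule k n}

lemma IsFinite.isFinitelyDetermined {P : InjectiveCopresentation N} (h : P.IsFinite) :
    N.IsFinitelyDetermined := by
  obtain ⟨⟨r, hr⟩, s, hs⟩ := h
  exact (IsFinitelyDetermined.kernel P.d hr.isFinitelyDetermined_and_hasBotRank.1
    hs.isFinitelyDetermined_and_hasBotRank.1).of_iso P.iso.symm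

lemma _root_.ZnModule.IsMinimalInjectiveHull.exists_isFiniteInjective {N E : ZnModule k n}
    {f : N ⟶ E} (h : IsMinimalInjectiveHull f) : ∃ r, E.IsFiniteInjective r := by
  obtain ⟨-, r, hr, -⟩ := h
  exact ⟨r, hr⟩

lemma IsMinimal.isFinite {P : InjectiveCopresentation N} (h : P.IsMinimal) : P.IsFinite :=
  ⟨h.1.exists_isFiniteInjective, h.2.exists_isFiniteInjective⟩

lemma exists_isMinimal (h : N.IsFinitelyDetermined) :
    ∃ P : InjectiveCopresentation N, P.IsMinimal := by
  obtain ⟨E₀, i₀, h₀⟩ := h.exists_isMinimalInjectiveHull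
  obtain ⟨E₁, i₁, h₁⟩ := (h.cokernel i₀ h₀.isFinitelyDetermined).exists_isMinimalInjectiveHull
  have := h₀.1
  have := h₁.1
  have w : i₀ ≫ cokernel.π i₀ ≫ i₁ = 0 := by simp
  have := isIso_kernel_lift _ _ w (exact_cokernel_π_comp i₀ i₁)
  let P : InjectiveCopresentation N :=
    { E₀ := E₀
      E₁ := E₁
      d := cokernel.π i₀ ≫ i₁
      injective₀ := h₀.injective
      injective₁ := h₁.injective
      iso := asIso (kernel.lift (cokernel.π i₀ ≫ i₁) i₀ w) }
  have hι : P.ι = i₀ := kernel.lift_ι _ _ _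
  refine ⟨P, ?_, ?_⟩
  · rw [hι]
    exact h₀
  · exact isMinimalInjectiveHull_cokernel_desc P.ι P.d P.ι_d i₀ (𝟙 N)
      (hι.trans (Category.id_comp _).symm) h₁ rfl

lemma IsMinimal.isomorphic {P P' : InjectiveCopresentation N} (h : P.IsMinimal)
    (h' : P'.IsMinimal) : P.Isomorphic P' := by
  have := h.1.1
  have := h'.1.injective
  have he₀ : P.ι ≫ Injective.factorThru P'.ι P.ι = P'.ι := Injective.comp_factorThru _ _
  have := h.1.isIso h'.1 _ he₀
  set e₀ := Injective.factorThru P'.ι P.ι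
  have := h.2.1
  have := h'.2.injective
  let e₁ := Injective.factorThru (cokernel.desc P.ι (e₀ ≫ P'.d) (by
    rw [← Category.assoc, he₀, P'.ι_d])) (cokernel.desc P.ι P.d P.ι_d)
  have he₁ : P.d ≫ e₁ = e₀ ≫ P'.d := by
    have h := cokernel.π_desc P.ι P.d P.ι_d
    rw [← h, Category.assoc, Injective.comp_factorThru, cokernel.π_desc]
  have := isIso_of_isMinimalInjectiveHull_cokernel_desc h.2 h'.2 (𝟙 N) e₀ e₁ (by simp [he₀]) he₁
  exact ⟨asIso e₀, asIso e₁, he₁, he₀⟩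

end InjectiveCopresentation

/-! ### Augmented complexes -/

section

variable {A : Type*} [Category* A] [Abelian A]

lemma quasiIsoAt_zero_iff_chain {K : ChainComplex A ℕ} {N : A}
    (π : K ⟶ (ChainComplex.single₀ A).obj N) (p : K.X 0 ⟶ N) (hp : π.f 0 = p)
    (w : K.d 1 0 ≫ p = 0) :
    QuasiIsoAt π 0 ↔ (ShortComplex.mk _ p w).Exact ∧ Epi p := by
  subst hp
  rw [ChainComplex.quasiIsoAt₀_iff]
  exact ShortComplex.quasiIso_iff_of_zeros' ((HomologicalComplex.shortComplexFunctor' A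
    (ComplexShape.down ℕ) 1 0 0).map π) (K.shape _ _ (by simp))
    (HomologicalComplex.single_obj_d (c := .down ℕ) _ _ _ _) (HomologicalComplex.single_obj_d (c := .down ℕ) _ _ _ _)

/-- Replaces the quasi-isomorphism by exactness of the augmented complex, the form in which
resolutions are built and used here. -/
lemma quasiIso_iff_chain {K : ChainComplex A ℕ} {N : A}
    (π : K ⟶ (ChainComplex.single₀ A).obj N) (p : K.X 0 ⟶ N) (hp : π.f 0 = p)
    (w : K.d 1 0 ≫ p = 0) :
    QuasiIso π ↔ ((ShortComplex.mk _ p w).Exact ∧ Epi p) ∧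
      ∀ i, (ShortComplex.mk _ _ (K.d_comp_d (i + 2) (i + 1) i)).Exact := by
  have h (i : ℕ) : QuasiIsoAt π (i + 1) ↔
      (ShortComplex.mk _ _ (K.d_comp_d (i + 2) (i + 1) i)).Exact := by
    rw [quasiIsoAt_iff_exactAt' π _ (ChainComplex.exactAt_succ_single_obj ..)]
    exact HomologicalComplex.exactAt_iff' _ (i + 2) (i + 1) i (by simp) (by simp)
  rw [quasiIso_iff, ← quasiIsoAt_zero_iff_chain π p hp w]
  exact ⟨fun H => ⟨H 0, fun i => (h i).1 (H _)⟩,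
    fun H i => i.casesOn H.1 fun i => (h i).2 (H.2 i)⟩

lemma quasiIsoAt_zero_iff_cochain {K : CochainComplex A ℕ} {N : A}
    (ι : (CochainComplex.single₀ A).obj N ⟶ K) (p : N ⟶ K.X 0) (hp : ι.f 0 = p)
    (w : p ≫ K.d 0 1 = 0) :
    QuasiIsoAt ι 0 ↔ (ShortComplex.mk p _ w).Exact ∧ Mono p := by
  subst hp
  rw [CochainComplex.quasiIsoAt₀_iff]
  exact ShortComplex.quasiIso_iff_of_zeros ((HomologicalComplex.shortComplexFunctor' A
    (ComplexShape.up ℕ) 0 0 1).map ι) (HomologicalComplex.single_obj_d (c := .up ℕ) _ _ _ _)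
    (HomologicalComplex.single_obj_d (c := .up ℕ) _ _ _ _) (K.shape _ _ (by simp))

lemma quasiIso_iff_cochain {K : CochainComplex A ℕ} {N : A}
    (ι : (CochainComplex.single₀ A).obj N ⟶ K) (p : N ⟶ K.X 0) (hp : ι.f 0 = p)
    (w : p ≫ K.d 0 1 = 0) :
    QuasiIso ι ↔ ((ShortComplex.mk p _ w).Exact ∧ Mono p) ∧
      ∀ i, (ShortComplex.mk _ _ (K.d_comp_d i (i + 1) (i + 2))).Exact := by
  have h (i : ℕ) : QuasiIsoAt ι (i + 1) ↔
      (ShortComplex.mk _ _ (K.d_comp_d i (i + 1) (i + 2))).Exact := by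
    rw [quasiIsoAt_iff_exactAt ι _ (CochainComplex.exactAt_succ_single_obj ..)]
    exact HomologicalComplex.exactAt_iff' _ i (i + 1) (i + 2) (by simp) (by simp)
  rw [quasiIso_iff, ← quasiIsoAt_zero_iff_cochain ι p hp w]
  exact ⟨fun H => ⟨H 0, fun i => (h i).1 (H _)⟩,
    fun H i => i.casesOn H.1 fun i => (h i).2 (H.2 i)⟩

end

/-! ### The length of minimal resolutions -/

/-- Dimension shifting: the cosyzygy `C j` has injective dimension at most `n - j`. So `C n` is
injective, its minimal hull is an isomorphism, and `C (n + 1)` vanishes; minimal hulls of zero are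
zero from then on. -/
lemma isZero_of_shortExact_of_isMinimalInjectiveHull (C E : ℕ → ZnModule k n)
    (f : ∀ i, C i ⟶ E i) (g : ∀ i, E i ⟶ C (i + 1)) (w : ∀ i, f i ≫ g i = 0)
    (hs : ∀ i, (ShortComplex.mk _ _ (w i)).ShortExact) (hf : ∀ i, IsMinimalInjectiveHull (f i))
    (i : ℕ) (hi : n < i) : IsZero (E i) := by
  have hC : ∀ j ≤ n, HasInjectiveDimensionLT (C j) (n - j + 1) := by
    intro j
    induction j with
    | zero => exact fun _ => hasInjectiveDimensionLT _
    | succ j ih =>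
      intro hj
      have := (hf j).injective
      have h₁ := ih (by omega)
      rw [show n - j + 1 = (n - (j + 1) + 1) + 1 by omega] at h₁
      exact (hs j).hasInjectiveDimensionLT_X₃ _ (hasInjectiveDimensionLT_of_ge _ 1 _ (by omega)) h₁
  have hz : ∀ j, IsZero (C (n + 1 + j)) := by
    intro j
    induction j with
    | zero =>
      have h := hC n le_rfl
      rw [Nat.sub_self, zero_add, ← injective_iff_hasInjectiveDimensionLT_one] at h
      have := (hf n).isIso_of_injective
      have := (hs n).epi_g
      refine IsZero.of_epi_eq_zero (g n) ?_
      rw [← cancel_epi (f n), w n, comp_zero]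
    | succ j ih =>
      have := (hs (n + 1 + j)).epi_g
      exact IsZero.of_epi_eq_zero (g (n + 1 + j)) (((hf _).isZero ih).eq_of_src _ _)
  obtain ⟨j, rfl⟩ : ∃ j, i = n + 1 + j := ⟨i - (n + 1), by omega⟩
  exact (hf _).isZero (hz j)

lemma shortExact_cokernel_desc {X Y Z : ZnModule k n} (f : X ⟶ Y) (g : Y ⟶ Z) (w : f ≫ g = 0)
    [Mono (cokernel.desc f g w)] :
    (ShortComplex.mk (cokernel.desc f g w) (cokernel.π g)
      (by rw [← cancel_epi (cokernel.π f), cokernel.π_desc_assoc, cokernel.condition,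
        comp_zero])).ShortExact := by
  refine ShortComplex.ShortExact.mk' ?_ ‹_› (inferInstanceAs (Epi (cokernel.π g)))
  have h := ShortComplex.exact_cokernel g
  refine (ShortComplex.exact_iff_of_epi_of_isIso_of_mono (S₁ := ShortComplex.mk g (cokernel.π g)
    (cokernel.condition g)) (S₂ := ShortComplex.mk (cokernel.desc f g w) (cokernel.π g) _)
    { τ₁ := cokernel.π f, τ₂ := 𝟙 _, τ₃ := 𝟙 _}).1 h

lemma shortExact_kernel_lift {X Y Z : ZnModule k n} (f : Y ⟶ Z) (g : X ⟶ Y) (w : g ≫ f = 0)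
    [Epi (kernel.lift f g w)] :
    (ShortComplex.mk (kernel.ι g) (kernel.lift f g w)
      (by rw [← cancel_mono (kernel.ι f), Category.assoc, kernel.lift_ι, kernel.condition,
        zero_comp])).ShortExact := by
  refine ShortComplex.ShortExact.mk' ?_ (inferInstanceAs (Mono (kernel.ι g))) ‹_›
  have h := ShortComplex.exact_kernel g
  refine (ShortComplex.exact_iff_of_epi_of_isIso_of_mono (S₂ := ShortComplex.mk (kernel.ι g) g
    (kernel.condition g)) (S₁ := ShortComplex.mk (kernel.ι g) (kernel.lift f g w) _)
    { τ₁ := 𝟙 _, τ₂ := 𝟙 _, τ₃ := kernel.ι f}).2 h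

lemma exact_comp_comp {A : Type*} [Category* A] [Abelian A] {X Y Z V W : A} (p : X ⟶ Y)
    (f : Y ⟶ Z) (g : Z ⟶ V) (i : V ⟶ W) [Epi p] [Mono i] (w : f ≫ g = 0)
    (h : (ShortComplex.mk f g w).Exact) (w' : (p ≫ f) ≫ g ≫ i = 0) :
    (ShortComplex.mk (p ≫ f) (g ≫ i) w').Exact := by
  have w'' : (p ≫ f) ≫ g = 0 := by rw [Category.assoc, w, comp_zero]
  have h' : (ShortComplex.mk (p ≫ f) g w'').Exact :=
    (ShortComplex.exact_iff_of_epi_of_isIso_of_mono (S₁ := ShortComplex.mk (p ≫ f) g w'')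
      (S₂ := ShortComplex.mk f g w) { τ₁ := p, τ₂ := 𝟙 _, τ₃ := 𝟙 _ }).2 h
  exact (ShortComplex.exact_iff_of_epi_of_isIso_of_mono (S₁ := ShortComplex.mk (p ≫ f) g w'')
      (S₂ := ShortComplex.mk (p ≫ f) (g ≫ i) w') { τ₁ := 𝟙 _, τ₂ := 𝟙 _, τ₃ := i }).1 h'

/-! ### Minimal injective resolutions -/

lemma IsFinitelyDetermined.exists_shortExact_hulls {N : ZnModule k n}
    (h : N.IsFinitelyDetermined) : ∃ (C E : ℕ → ZnModule k n) (f : ∀ i, C i ⟶ E i)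
      (g : ∀ i, E i ⟶ C (i + 1)) (w : ∀ i, f i ≫ g i = 0),
      C 0 = N ∧ (∀ i, (ShortComplex.mk _ _ (w i)).ShortExact) ∧
        ∀ i, IsMinimalInjectiveHull (f i) := by
  -- Choosing hulls on the subtype of finitely determined modules lets the recursion carry the
  -- property needed to continue with the cokernel.
  choose E f hf using fun K : {K : ZnModule k n // K.IsFinitelyDetermined} =>
    K.2.exists_isMinimalInjectiveHull
  let C : ℕ → {K : ZnModule k n // K.IsFinitelyDetermined} := fun j =>
    j.rec ⟨N, h⟩ fun _ K => ⟨Limits.cokernel (f K), K.2.cokernel (f K) (hf K).isFinitelyDetermined⟩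
  refine ⟨fun i => (C i).1, fun i => E (C i), fun i => f (C i), fun i => cokernel.π (f (C i)),
    fun i => cokernel.condition _, rfl, fun i => ?_, fun i => hf (C i)⟩
  exact ShortComplex.ShortExact.mk' (ShortComplex.exact_cokernel _) (hf (C i)).1
    (inferInstanceAs (Epi (cokernel.π (f (C i)))))

namespace InjRes

variable {N : ZnModule k n}

lemma quasiIso_iff (R : InjectiveResolution N) :
    ((ShortComplex.mk (coaug R) _ (coaug_d R)).Exact ∧ Mono (coaug R)) ∧
      ∀ i, (ShortComplex.mk _ _ (R.cocomplex.d_comp_d i (i + 1) (i + 2))).Exact :=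
  (quasiIso_iff_cochain R.ι (coaug R) rfl (coaug_d R)).1 R.quasiIso

lemma IsFinite.isFinitelyDetermined {R : InjectiveResolution N} (h : IsFinite R) :
    N.IsFinitelyDetermined := by
  obtain ⟨⟨h₀, _⟩, -⟩ := quasiIso_iff R
  obtain ⟨_, hr⟩ := h.1 0
  obtain ⟨_, hs⟩ := h.1 1
  exact IsFinitelyDetermined.kernel_of_exact hr.isFinitelyDetermined_and_hasBotRank.1
    hs.isFinitelyDetermined_and_hasBotRank.1 _ _ _ h₀

lemma isZero_of_isMinimal {R : InjectiveResolution N} (h : IsMinimal R) (i : ℕ) (hi : n < i) :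
    IsZero (R.cocomplex.X i) := by
  obtain ⟨-, h₀, h₁, h₂⟩ := h
  -- The cosyzygies are the cokernels named in the definition of minimality; the augmentation makes
  -- the first two cases special.
  let C : ℕ → ZnModule k n := fun
    | 0 => N
    | 1 => cokernel (coaug R)
    | i + 2 => cokernel (R.cocomplex.d i (i + 1))
  let f : ∀ i, C i ⟶ R.cocomplex.X i := fun
    | 0 => coaug R
    | 1 => cokernel.desc _ _ (coaug_d R)
    | i + 2 => cokernel.desc _ _ (R.cocomplex.d_comp_d i (i + 1) (i + 2))
  let g : ∀ i, R.cocomplex.X i ⟶ C (i + 1) := fun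
    | 0 => cokernel.π (coaug R)
    | i + 1 => cokernel.π (R.cocomplex.d i (i + 1))
  have hs : ∀ i, ∃ w : f i ≫ g i = 0, (ShortComplex.mk _ _ w).ShortExact := fun
    | 0 => ⟨cokernel.condition _, ShortComplex.ShortExact.mk' (ShortComplex.exact_cokernel _)
        h₀.1 (inferInstanceAs (Epi (cokernel.π (coaug R))))⟩
    | 1 => have := h₁.1; ⟨_, shortExact_cokernel_desc _ _ _⟩
    | i + 2 => have := (h₂ i).1; ⟨_, shortExact_cokernel_desc _ _ _⟩
  choose w hs using hs
  exact isZero_of_shortExact_of_isMinimalInjectiveHull C _ f g w hs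
    (fun | 0 => h₀ | 1 => h₁ | i + 2 => h₂ i) i hi

lemma exists_isMinimal_of_shortExact (C E : ℕ → ZnModule k n) (f : ∀ i, C i ⟶ E i)
    (g : ∀ i, E i ⟶ C (i + 1)) (w : ∀ i, f i ≫ g i = 0)
    (hs : ∀ i, (ShortComplex.mk _ _ (w i)).ShortExact) (hf : ∀ i, IsMinimalInjectiveHull (f i)) :
    ∃ R : InjectiveResolution (C 0), IsMinimal R := by
  have hm : ∀ i, Mono (f i) := fun i => (hf i).1
  have he : ∀ i, Epi (g i) := fun i => (hs i).epi_g
  have hd : ∀ i, (g i ≫ f (i + 1)) ≫ g (i + 1) ≫ f (i + 2) = 0 := fun i => by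
    rw [Category.assoc, ← Category.assoc (f _), w, zero_comp, comp_zero]
  let K : CochainComplex (ZnModule k n) ℕ := CochainComplex.of E (fun i => g i ≫ f (i + 1)) hd
  have hK (i : ℕ) : K.d i (i + 1) = g i ≫ f (i + 1) := CochainComplex.of_d E (fun i => g i ≫ f (i + 1)) i
  have w₀ : f 0 ≫ K.d 0 1 = 0 := by
    rw [hK, ← Category.assoc, w, zero_comp]
  let ι := (CochainComplex.fromSingle₀Equiv K (C 0)).symm ⟨f 0, w₀⟩
  have hι : ι.f 0 = f 0 := CochainComplex.fromSingle₀Equiv_symm_apply_f_zero _ _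
  have hq : QuasiIso ι := by
    refine (quasiIso_iff_cochain ι (f 0) hι w₀).2 ⟨⟨?_, hm 0⟩, fun i => ?_⟩
    · have h := exact_comp_comp (𝟙 _) (f 0) (g 0) (f 1) (w 0) (hs 0).exact (by
        rw [Category.id_comp, ← Category.assoc, w, zero_comp])
      simpa only [hK, Category.id_comp] using h
    · have h := exact_comp_comp (g i) (f (i + 1)) (g (i + 1)) (f (i + 2)) (w _) (hs _).exact (hd i)
      simpa only [hK] using h
  let R : InjectiveResolution (C 0) :=
    { cocomplex := K, injective := fun i => (hf i).injective, ι := ι, quasiIso := hq }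
  have hiso (i : ℕ) : IsIso (cokernel.desc (f i) (g i) (w i)) := isIso_cokernel_desc _ _ _ (hs i).exact
  have hc : coaug R = f 0 := hι
  -- The vanishing required for finiteness is itself the length bound for minimal hulls.
  refine ⟨R, ⟨fun i => (hf i).exists_isFiniteInjective, n, fun i hi =>
    isZero_of_shortExact_of_isMinimalInjectiveHull C E f g w hs hf i hi⟩, ?_, ?_, fun i => ?_⟩
  · rw [hc]
    exact hf 0
  · exact isMinimalInjectiveHull_cokernel_desc _ _ _ (f 0) (𝟙 _)
      (hc.trans (Category.id_comp _).symm) ((hf 1).iso_comp (cokernel.desc (f 0) (g 0) (w 0)))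
      ((hK 0).trans (by rw [cokernel.π_desc_assoc]))
  · exact isMinimalInjectiveHull_cokernel_desc _ _ _ (f (i + 1)) (g i) (hK i)
      ((hf (i + 2)).iso_comp (cokernel.desc (f (i + 1)) (g (i + 1)) (w (i + 1))))
      ((hK (i + 1)).trans (by rw [cokernel.π_desc_assoc]))

lemma exists_isMinimal (h : N.IsFinitelyDetermined) : ∃ R : InjectiveResolution N, IsMinimal R := by
  obtain ⟨C, E, f, g, w, rfl, hs, hf⟩ := h.exists_shortExact_hulls
  exact exists_isMinimal_of_shortExact C E f g w hs hf

lemma IsMinimal.isomorphic {R R' : InjectiveResolution N} (h : IsMinimal R)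
    (h' : IsMinimal R') : Isomorphic R R' := by
  obtain ⟨-, h₀, h₁, h₂⟩ := h
  obtain ⟨-, h₀', h₁', h₂'⟩ := h'
  let φ := InjectiveResolution.desc (𝟙 N) R' R
  have hφ₀ : coaug R ≫ φ.f 0 = coaug R' :=
    (InjectiveResolution.desc_commutes_zero (𝟙 N) R' R).trans (Category.id_comp _)
  -- Any comparison map over `N` works. Two consecutive degrees are carried along because the next
  -- cokernel depends on both.
  have hi : ∀ i, IsIso (φ.f i) ∧ IsIso (φ.f (i + 1)) := by
    intro i
    induction i with
    | zero =>
      have := h₀.isIso h₀' (φ.f 0) hφ₀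
      exact ⟨this, isIso_of_isMinimalInjectiveHull_cokernel_desc h₁ h₁' (𝟙 N) (φ.f 0) (φ.f 1)
        (hφ₀.trans (Category.id_comp _).symm) (φ.comm 0 1).symm⟩
    | succ i ih =>
      have := ih.1
      have := ih.2
      exact ⟨this, isIso_of_isMinimalInjectiveHull_cokernel_desc (h₂ i) (h₂' i) (φ.f i)
        (φ.f (i + 1)) (φ.f (i + 2)) (φ.comm _ _).symm (φ.comm _ _).symm⟩
  have := fun i => (hi i).1
  have := HomologicalComplex.Hom.isIso_of_components φ
  exact ⟨asIso φ, HomologicalComplex.from_single_hom_ext hφ₀⟩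

end InjRes

/-! ### Minimal flat resolutions -/

/-- Dualise the sequences: covers become minimal hulls, the injective bound applies, and a
`ℤⁿ`-finite module with zero dual is zero. -/
lemma isZero_of_shortExact_of_isMinimalFlatCover (C F : ℕ → ZnModule k n)
    (f : ∀ i, F i ⟶ C i) (g : ∀ i, C (i + 1) ⟶ F i) (w : ∀ i, g i ≫ f i = 0)
    (hs : ∀ i, (ShortComplex.mk _ _ (w i)).ShortExact) (hf : ∀ i, IsMinimalFlatCover (f i))
    (i : ℕ) (hi : n < i) : IsZero (F i) := by
  obtain ⟨r, hr⟩ := (hf i).exists_isFiniteFlat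
  exact hr.2.1.isZero_of_isZero_dual (isZero_of_shortExact_of_isMinimalInjectiveHull
    (fun i => dual (C i)) (fun i => dual (F i)) (fun i => dualMap (f i)) (fun i => dualMap (g i))
    _ (fun i => shortExact_dualMap _ _ _ (hs i)) (fun i => (hf i).dual) i hi)

lemma IsFinitelyDetermined.exists_shortExact_covers {N : ZnModule k n}
    (h : N.IsFinitelyDetermined) : ∃ (C F : ℕ → ZnModule k n) (f : ∀ i, F i ⟶ C i)
      (g : ∀ i, C (i + 1) ⟶ F i) (w : ∀ i, g i ≫ f i = 0),
      C 0 = N ∧ (∀ i, (ShortComplex.mk _ _ (w i)).ShortExact) ∧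
        ∀ i, IsMinimalFlatCover (f i) := by
  choose F f hf using fun K : {K : ZnModule k n // K.IsFinitelyDetermined} =>
    K.2.exists_isMinimalFlatCover
  let C : ℕ → {K : ZnModule k n // K.IsFinitelyDetermined} := fun j =>
    j.rec ⟨N, h⟩ fun _ K => ⟨Limits.kernel (f K), (hf K).isFinitelyDetermined.kernel (f K) K.2⟩
  refine ⟨fun i => (C i).1, fun i => F (C i), fun i => f (C i), fun i => kernel.ι (f (C i)),
    fun i => kernel.condition _, rfl, fun i => ?_, fun i => hf (C i)⟩
  exact ShortComplex.ShortExact.mk' (ShortComplex.exact_kernel _)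
    (inferInstanceAs (Mono (kernel.ι (f (C i))))) (hf (C i)).1

namespace FlatResolution

variable {N : ZnModule k n}

lemma quasiIso_iff (R : FlatResolution N) :
    ((ShortComplex.mk _ R.aug R.d_aug).Exact ∧ Epi R.aug) ∧
      ∀ i, (ShortComplex.mk _ _ (R.complex.d_comp_d (i + 2) (i + 1) i)).Exact :=
  (quasiIso_iff_chain R.π R.aug rfl R.d_aug).1 R.quasiIso

lemma IsFinite.isFinitelyDetermined {R : FlatResolution N} (h : R.IsFinite) :
    N.IsFinitelyDetermined := by
  obtain ⟨⟨h₀, _⟩, -⟩ := R.quasiIso_iff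
  obtain ⟨_, hr⟩ := h.1 0
  obtain ⟨_, hs⟩ := h.1 1
  exact IsFinitelyDetermined.cokernel_of_exact hs.isFinitelyDetermined hr.isFinitelyDetermined
    _ _ _ h₀

lemma isZero_of_isMinimal {R : FlatResolution N} (h : R.IsMinimal) (i : ℕ) (hi : n < i) :
    IsZero (R.complex.X i) := by
  obtain ⟨-, h₀, h₁, h₂⟩ := h
  let C : ℕ → ZnModule k n := fun
    | 0 => N
    | 1 => kernel R.aug
    | i + 2 => kernel (R.complex.d (i + 1) i)
  let f : ∀ i, R.complex.X i ⟶ C i := fun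
    | 0 => R.aug
    | 1 => kernel.lift _ _ R.d_aug
    | i + 2 => kernel.lift _ _ (R.complex.d_comp_d (i + 2) (i + 1) i)
  let g : ∀ i, C (i + 1) ⟶ R.complex.X i := fun
    | 0 => kernel.ι R.aug
    | i + 1 => kernel.ι (R.complex.d (i + 1) i)
  have hs : ∀ i, ∃ w : g i ≫ f i = 0, (ShortComplex.mk _ _ w).ShortExact := fun
    | 0 => ⟨kernel.condition _, ShortComplex.ShortExact.mk' (ShortComplex.exact_kernel _)
        (inferInstanceAs (Mono (kernel.ι R.aug))) h₀.1⟩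
    | 1 => have := h₁.1; ⟨_, shortExact_kernel_lift _ _ _⟩
    | i + 2 => have := (h₂ i).1; ⟨_, shortExact_kernel_lift _ _ _⟩
  choose w hs using hs
  exact isZero_of_shortExact_of_isMinimalFlatCover C _ f g w hs
    (fun | 0 => h₀ | 1 => h₁ | i + 2 => h₂ i) i hi

lemma exists_isMinimal_of_shortExact (C F : ℕ → ZnModule k n) (f : ∀ i, F i ⟶ C i)
    (g : ∀ i, C (i + 1) ⟶ F i) (w : ∀ i, g i ≫ f i = 0)
    (hs : ∀ i, (ShortComplex.mk _ _ (w i)).ShortExact) (hf : ∀ i, IsMinimalFlatCover (f i)) :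
    ∃ R : FlatResolution (C 0), R.IsMinimal := by
  have hm : ∀ i, Epi (f i) := fun i => (hf i).1
  have he : ∀ i, Mono (g i) := fun i => (hs i).mono_f
  have hd : ∀ i, (f (i + 2) ≫ g (i + 1)) ≫ f (i + 1) ≫ g i = 0 := fun i => by
    rw [Category.assoc, ← Category.assoc (g _), w, zero_comp, comp_zero]
  let K : ChainComplex (ZnModule k n) ℕ := ChainComplex.of F (fun i => f (i + 1) ≫ g i) hd
  have hK (i : ℕ) : K.d (i + 1) i = f (i + 1) ≫ g i := ChainComplex.of_d F (fun i => f (i + 1) ≫ g i) i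
  have w₀ : K.d 1 0 ≫ f 0 = 0 := by
    rw [hK, Category.assoc, w, comp_zero]
  let π := (ChainComplex.toSingle₀Equiv K (C 0)).symm ⟨f 0, w₀⟩
  have hπ : π.f 0 = f 0 := ChainComplex.toSingle₀Equiv_symm_apply_f_zero _ _
  have hq : QuasiIso π := by
    refine (quasiIso_iff_chain π (f 0) hπ w₀).2 ⟨⟨?_, hm 0⟩, fun i => ?_⟩
    · have h := exact_comp_comp (f 1) (g 0) (f 0) (𝟙 _) (w 0) (hs 0).exact (by
        rw [Category.comp_id, Category.assoc, w, comp_zero])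
      simpa only [hK, Category.comp_id] using h
    · have h := exact_comp_comp (f (i + 2)) (g (i + 1)) (f (i + 1)) (g i) (w _) (hs _).exact (hd i)
      simpa only [hK] using h
  let R : FlatResolution (C 0) :=
    { complex := K
      flat := fun i => (hf i).exists_isFiniteFlat.choose_spec.1
      π := π
      quasiIso := hq }
  have hiso (i : ℕ) : IsIso (kernel.lift (f i) (g i) (w i)) := isIso_kernel_lift _ _ _ (hs i).exact
  have hc : R.aug = f 0 := hπ
  refine ⟨R, ⟨fun i => (hf i).exists_isFiniteFlat, n, fun i hi =>
    isZero_of_shortExact_of_isMinimalFlatCover C F f g w hs hf i hi⟩, ?_, ?_, fun i => ?_⟩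
  · rw [hc]
    exact hf 0
  · exact isMinimalFlatCover_kernel_lift _ _ _ (f 0) (𝟙 _)
      (hc.trans (Category.comp_id _).symm) ((hf 1).comp_iso (kernel.lift (f 0) (g 0) (w 0)))
      ((hK 0).trans (by rw [Category.assoc, kernel.lift_ι]))
  · exact isMinimalFlatCover_kernel_lift _ _ _ (f (i + 1)) (g i) (hK i)
      ((hf (i + 2)).comp_iso (kernel.lift (f (i + 1)) (g (i + 1)) (w (i + 1))))
      ((hK (i + 1)).trans (by rw [Category.assoc, kernel.lift_ι]))

lemma exists_isMinimal (h : N.IsFinitelyDetermined) : ∃ R : FlatResolution N, R.IsMinimal := by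
  obtain ⟨C, F, f, g, w, rfl, hs, hf⟩ := h.exists_shortExact_covers
  exact exists_isMinimal_of_shortExact C F f g w hs hf

lemma IsMinimal.isomorphic {R R' : FlatResolution N} (h : R.IsMinimal) (h' : R'.IsMinimal) :
    R.Isomorphic R' := by
  obtain ⟨-, h₀, h₁, h₂⟩ := h
  obtain ⟨-, h₀', h₁', h₂'⟩ := h'
  obtain ⟨f₀, hf₀⟩ := h₀.exists_lift h₀' R.aug
  obtain ⟨f₁, hf₁⟩ := exists_lift_of_isMinimalFlatCover_kernel_lift h₁ h₁' f₀ (𝟙 N)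
    ((Category.comp_id _).trans hf₀.symm)
  -- Flat modules need not be projective, so the comparison map is built degree by degree from
  -- liftings through minimal covers.
  have hl := fun i p q hp =>
    exists_lift_of_isMinimalFlatCover_kernel_lift (h₂ i) (h₂' i) q p hp
  let φ : R.complex ⟶ R'.complex := ChainComplex.mkHom _ _ f₀ f₁ hf₁ fun i p =>
    ⟨(hl i p.1 p.2.1 p.2.2.symm).choose, (hl i p.1 p.2.1 p.2.2.symm).choose_spec⟩
  have hφ₀ : φ.f 0 ≫ R'.aug = R.aug := hf₀
  have hi : ∀ i, IsIso (φ.f i) ∧ IsIso (φ.f (i + 1)) := by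
    intro i
    induction i with
    | zero =>
      have := h₀.isIso h₀' (φ.f 0) hφ₀
      exact ⟨this, isIso_of_isMinimalFlatCover_kernel_lift h₁ h₁' (φ.f 1) (φ.f 0) (𝟙 N)
        (φ.comm 1 0).symm ((Category.comp_id _).trans hφ₀.symm)⟩
    | succ i ih =>
      have := ih.1
      have := ih.2
      exact ⟨this, isIso_of_isMinimalFlatCover_kernel_lift (h₂ i) (h₂' i) (φ.f (i + 2))
        (φ.f (i + 1)) (φ.f i) (φ.comm _ _).symm (φ.comm _ _).symm⟩
  have := fun i => (hi i).1
  have := HomologicalComplex.Hom.isIso_of_components φ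
  exact ⟨asIso φ, HomologicalComplex.to_single_hom_ext hφ₀⟩

end FlatResolution

end ZnModule

theorem theorem4p15 {k : Type u} [Field k] (n : ℕ) (N : ZnModule k n) :
    List.TFAE [
      N.IsFinitelyDetermined,
      ∃ P : ZnModule.FlangePresentation N, P.IsFinite,
      ∃ P : ZnModule.FlatPresentation N, P.IsFinite,
      ∃ P : ZnModule.InjectiveCopresentation N, P.IsFinite,
      ∃ R : ZnModule.FlatResolution N, R.IsFinite,
      ∃ R : InjectiveResolution N, ZnModule.InjRes.IsFinite R,
      ∃ P : ZnModule.FlangePresentation N, P.IsMinimal,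
      ∃ P : ZnModule.FlatPresentation N, P.IsMinimal,
      ∃ P : ZnModule.InjectiveCopresentation N, P.IsMinimal,
      ∃ R : ZnModule.FlatResolution N, R.IsMinimal,
      ∃ R : InjectiveResolution N, ZnModule.InjRes.IsMinimal R] ∧
    (∀ P P' : ZnModule.FlangePresentation N, P.IsMinimal → P'.IsMinimal → P.Isomorphic P') ∧
    (∀ P P' : ZnModule.FlatPresentation N, P.IsMinimal → P'.IsMinimal → P.Isomorphic P') ∧
    (∀ P P' : ZnModule.InjectiveCopresentation N,
      P.IsMinimal → P'.IsMinimal → P.Isomorphic P') ∧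
    (∀ R R' : ZnModule.FlatResolution N, R.IsMinimal → R'.IsMinimal → R.Isomorphic R') ∧
    (∀ R R' : InjectiveResolution N, ZnModule.InjRes.IsMinimal R → ZnModule.InjRes.IsMinimal R' →
      ZnModule.InjRes.Isomorphic R R') ∧
    (∀ R : ZnModule.FlatResolution N, R.IsMinimal → ∀ i, n < i → IsZero (R.complex.X i)) ∧
    (∀ R : InjectiveResolution N, ZnModule.InjRes.IsMinimal R →
      ∀ i, n < i → IsZero (R.cocomplex.X i)) := by
  refine ⟨?_, fun _ _ h h' => h.isomorphic h', fun _ _ h h' => h.isomorphic h',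
    fun _ _ h h' => h.isomorphic h', fun _ _ h h' => h.isomorphic h',
    fun _ _ h h' => ZnModule.InjRes.IsMinimal.isomorphic h h',
    fun _ h => ZnModule.FlatResolution.isZero_of_isMinimal h,
    fun _ h => ZnModule.InjRes.isZero_of_isMinimal h⟩
  -- Finite determination is the hub: it yields every minimal object, a minimal object is finite,
  -- and a finite object forces finite determination. Positions are counted from one.
  tfae_have 1 → 7 := ZnModule.FlangePresentation.exists_isMinimal
  tfae_have 1 → 8 := ZnModule.FlatPresentation.exists_isMinimal
  tfae_have 1 → 9 := ZnModule.InjectiveCopresentation.exists_isMinimal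
  tfae_have 1 → 10 := ZnModule.FlatResolution.exists_isMinimal
  tfae_have 1 → 11 := ZnModule.InjRes.exists_isMinimal
  tfae_have 7 → 2 := fun ⟨P, h⟩ => ⟨P, h.isFinite⟩
  tfae_have 8 → 3 := fun ⟨P, h⟩ => ⟨P, h.isFinite⟩
  tfae_have 9 → 4 := fun ⟨P, h⟩ => ⟨P, h.isFinite⟩
  tfae_have 10 → 5 := fun ⟨R, h⟩ => ⟨R, h.1⟩
  tfae_have 11 → 6 := fun ⟨R, h⟩ => ⟨R, h.1⟩
  tfae_have 2 → 1 := fun ⟨_, h⟩ => h.isFinitelyDetermined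
  tfae_have 3 → 1 := fun ⟨_, h⟩ => h.isFinitelyDetermined
  tfae_have 4 → 1 := fun ⟨_, h⟩ => h.isFinitelyDetermined
  tfae_have 5 → 1 := fun ⟨_, h⟩ => h.isFinitelyDetermined
  tfae_have 6 → 1 := fun ⟨_, h⟩ => ZnModule.InjRes.IsFinite.isFinitelyDetermined h
  tfae_finish
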